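/- **Algebras.** All algebras below contain orthogonal idempotents $\mathrm{Id}_k$ ($k\in\mathbb Z_{\ge 0}$), and a generator written $R:i\to j$ satisfies $R=R\,\mathrm{Id}_i=\mathrm{Id}_jR$; products are composed as maps, and every relation is imposed at each vertex $k$ at which all its terms make sense. The relations of $\mathbb A_q$ for elements $d_+:k\to k+1$, $d_-:k\to k-1$, $T_i:k\to k$ ($1\le i<k$), $y_i:k\to k$ ($1\le i\le k$) are $$(T_i-1)(T_i+q)=0,\quad T_iT_{i+1}T_i=T_{i+1}T_iT_{i+1},\quad T_iT_j=T_jT_i\ (|i-j|>1),$$ $$T_iy_{i+1}T_i=qy_i,\quad y_iT_j=T_jy_i\ (i\notin\{j,j+1\}),\quad y_iy_j=y_jy_i,$$ $$d_-^2T_{k-1}=d_-^2,\quad d_-T_i=T_id_-\ (1\le i\le k-2),\quad d_-y_i=y_id_-\ (1\le i\le k-1),$$ $$T_1d_+^2=d_+^2,\quad d_+T_i=T_{i+1}d_+\ (1\le i\le k-1),\quad d_+y_i=T_1\cdots T_iy_iT_i^{-1}\cdots T_1^{-1}d_+\ (1\le i\le k),$$ $$d_+d_--d_-d_+=(q-1)T_1\cdots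 T_{k-1}y_k .$$ The algebra $\mathbb A_{q,t}$ is the $\mathbb Q(q,t)$-algebra generated by the $\mathrm{Id}_k$ and $d_+,d_+^*:k\to k+1$, $d_-:k\to k-1$, $T_i:k\to k$ ($1\le i<k$), $y_i,z_i:k\to k$ ($1\le i\le k$), subject to the relations of $\mathbb A_q$ for $d_-,d_+,T_i,y_i$, the relations of $\mathbb A_{q^{-1}}$ for $d_-,d_+^*,T_i^{-1},z_i$, and $$d_+z_i=z_{i+1}d_+,\quad d_+^*y_i=y_{i+1}d_+^*\ (1\le i\le k),\quad z_1d_+=-tq^{k+1}y_1d_+^*.$$ The algebra $\mathbb B_{q,t}$ is the $\mathbb Q(q,t)$-algebra generated by the $\mathrm{Id}_k$ and $d_+:k\to k+1$, $d_-:k\to k-1$, $T_i$ ($1\le i<k$), $z_i$ ($1\le i\le k$) $:k\to k$, subject to all the relations of $\mathbb A_q$ listed above that do not involve the $y_i$, and, with $\varphi=\frac1{q-1}(d_+d_--d_-d_+)$, $$T_i^{-1}z_{i+1}T_i^{-1}=q^{-1}z_i,\quad z_iT_j=T_jz_i\ (i\notin\{j,j+1\}),\quad z_iz_j=z_jz_i,$$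 $$q\varphi d_-=d_-\varphi T_{k-1},\quad T_1\varphi d_+=qd_+\varphi,\quad z_id_-=d_-z_i,\quad d_+z_i=z_{i+1}d_+,$$ $$z_1(qd_+d_--d_-d_+)=qt\,(d_+d_--d_-d_+)z_k .$$ **Spaces and operators.** Let $\Lambda$ be the ring of symmetric functions, with power sums $p_n$, let $V_k=\Lambda\otimes\mathbb C(q,t)[y_1,\dots,y_k]$ and $W_k=(y_1\cdots y_k)^{-1}V_k\supset V_k$, and let $V_\bullet=\bigoplus_{k\ge0}V_k\subset W_\bullet=\bigoplus_{k\ge0}W_k$. Write $F[X\pm(q-1)u]$ for the result of the substitution $p_n\mapsto p_n\pm(q^n-1)u^n$ in $F$ (the $y_i$ are kept), and $\mathrm{Exp}[-uX]=\exp\bigl(-\sum_{n\ge1}p_nu^n/n\bigr)$. For $F\in W_k$ put $$T_iF=\frac{(q-1)y_iF+(y_{i+1}-qy_i)\,s_iF}{y_{i+1}-y_i},\qquad y_iF=y_i\cdot F,$$ where $s_i$ exchanges $y_i$ and $y_{i+1}$, $$d_-F=-\operatorname{Res}_{y_k}F[X-(q-1)y_k]\,\mathrm{Exp}[-y_k^{-1}X]\,dy_k\quad(k\ge1),\qquad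 d_+F=T_1\cdots T_k\bigl(F[X+(q-1)y_{k+1}]\bigr),$$ where $\operatorname{Res}_{y_k}$ takes the coefficient of $y_k^{-1}$, and $$d^*_{+,CM}F=\gamma\bigl(F[X+(q-1)y_{k+1}]\bigr),\qquad \gamma(y_i)=y_{i+1}\ (i\le k),\quad \gamma(y_{k+1})=ty_1 .$$ **Theorem.** There are algebra homomorphisms $\alpha:\mathbb B_{q,t}\to\mathbb A_{q,t}$, sending each generator to the generator of the same name, and $\beta:\mathbb A_{q,t}\to\mathbb B_{q,t}$ with $\beta(\mathrm{Id}_k)=\mathrm{Id}_k$, $\beta(T_i)=T_i$, $\beta(d_\pm)=d_\pm$, $\beta(d_+^*)=q^{-k}z_1d_+$ at vertex $k$, and $\beta(z_1)=-qt\,y_1z_1$, where $y_1=q^{1-k}\varphi T_{k-1}\cdots T_1:k\to k$ in $\mathbb B_{q,t}$. Moreover: 1. The operators $T_i,d_+,d_-$ above and $d_+^*=-(qty_1)^{-1}d^*_{+,CM}$ are well defined on $W_\bullet$ and, with $y_i$ acting by multiplication and $\mathrm{Id}_k$ as the projection to $W_k$, define a ($\mathbb C(q,t)$-linear) representation of $\mathbb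 A_{q,t}$ on $W_\bullet$. 2. In this representation $\alpha(\mathbb B_{q,t})$ preserves the subspace $V_\bullet\subset W_\bullet$, and hence defines a representation of $\mathbb B_{q,t}$ on $V_\bullet$. 3. $\alpha\beta(\mathbb A_{q,t})$ also preserves $V_\bullet$, and the resulting representation of $\mathbb A_{q,t}$ on $V_\bullet$ is the Carlsson–Mellit one: $T_i$, $y_i$, $d_+$, $d_-$ act by the formulas above, $\mathrm{Id}_k$ is the projection to $V_k$, and $d_+^*$ acts as $d^*_{+,CM}$. -/

import Mathlib

noncomputable section

namespace DyckPath

/-! ### The algebras `𝔸_{q,t}` and `𝔹_{q,t}`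

Both are presented by generators and relations.  A generator `R : i → j` of the quiver with vertex
set `ℕ` satisfies `R = R Id_i = Id_j R`; products are composed like maps, the right factor first.
In the comments, "vertex `k`" means that the relation is between elements starting at `k`. -/

/-- Generators of `𝔸_{q,t}`: `idem k = Id_k`, `dPlus k, dPlusStar k : k → k+1`,
`dMinus k : k+1 → k`, and `T k i = T_i`, `y k i = y_i`, `z k i = z_i : k → k`. -/
inductive AGen : Type
  | idem (k : ℕ)
  | dPlus (k : ℕ)
  | dPlusStar (k : ℕ)
  | dMinus (k : ℕ)
  | T (k i : ℕ)
  | y (k i : ℕ)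
  | z (k i : ℕ)

/-- The vertex at which a generator starts. -/
def AGen.src : AGen → ℕ
  | .idem k => k
  | .dPlus k => k
  | .dPlusStar k => k
  | .dMinus k => k + 1
  | .T k _ => k
  | .y k _ => k
  | .z k _ => k

/-- The vertex at which a generator ends. -/
def AGen.tgt : AGen → ℕ
  | .idem k => k
  | .dPlus k => k + 1
  | .dPlusStar k => k + 1
  | .dMinus k => k
  | .T k _ => k
  | .y k _ => k
  | .z k _ => k

/-- The range of the indices: `T_i : k → k` for `1 ≤ i < k`, and `y_i, z_i : k → k` for
`1 ≤ i ≤ k`.  The symbols outside this range are not generators; they are set to zero below. -/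
def AGen.InRange : AGen → Prop
  | .T k i => 1 ≤ i ∧ i < k
  | .y k i => 1 ≤ i ∧ i ≤ k
  | .z k i => 1 ≤ i ∧ i ≤ k
  | _ => True

/-- Generators of `𝔹_{q,t}`. -/
inductive BGen : Type
  | idem (k : ℕ)
  | dPlus (k : ℕ)
  | dMinus (k : ℕ)
  | T (k i : ℕ)
  | z (k i : ℕ)

/-- The vertex at which a generator starts. -/
def BGen.src : BGen → ℕ
  | .idem k => k
  | .dPlus k => k
  | .dMinus k => k + 1
  | .T k _ => k
  | .z k _ => k

/-- The vertex at which a generator ends. -/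
def BGen.tgt : BGen → ℕ
  | .idem k => k
  | .dPlus k => k + 1
  | .dMinus k => k
  | .T k _ => k
  | .z k _ => k

/-- The range of the indices, as for `𝔸_{q,t}`. -/
def BGen.InRange : BGen → Prop
  | .T k i => 1 ≤ i ∧ i < k
  | .z k i => 1 ≤ i ∧ i ≤ k
  | _ => True

/-- `x_1 x_2 ⋯ x_m`. -/
def prodUp {F : Type*} [Monoid F] (x : ℕ → F) (m : ℕ) : F :=
  ((List.range m).map fun j => x (j + 1)).prod

/-- `x_m ⋯ x_2 x_1`. -/
def prodDown {F : Type*} [Monoid F] (x : ℕ → F) (m : ℕ) : F :=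
  ((List.range m).map fun j => x (j + 1)).reverse.prod

/-- The inverse of `T` in the corner algebra with unit `e`, for `T` with `(T - e)(T + q e) = 0`:
`T⁻¹ = q⁻¹ (T + (q - 1) e)`. -/
def heckeInv {K F : Type*} [Field K] [Ring F] [Algebra K F] (q : K) (e T : F) : F :=
  q⁻¹ • (T + (q - 1) • e)

/-- The defining relations of `𝔸_q` for elements `d_+ = dp`, `d_- = dm`, `T`, `y` of an
algebra `F`, where `Ti` stands for `T⁻¹`. -/
inductive AqRel {K F : Type*} [Field K] [Ring F] [Algebra K F] (q : K)
    (e dp dm : ℕ → F) (T Ti y : ℕ → ℕ → F) : F → F → Prop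
  | hecke (k i : ℕ) (h : 1 ≤ i ∧ i < k) :
      AqRel q e dp dm T Ti y ((T k i - e k) * (T k i + q • e k)) 0
  | braid (k i : ℕ) (h : 1 ≤ i ∧ i + 1 < k) :
      AqRel q e dp dm T Ti y (T k i * T k (i + 1) * T k i) (T k (i + 1) * T k i * T k (i + 1))
  | T_comm (k i j : ℕ) (h : 1 ≤ i ∧ i + 1 < j ∧ j < k) :
      AqRel q e dp dm T Ti y (T k i * T k j) (T k j * T k i)
  | T_y_T (k i : ℕ) (h : 1 ≤ i ∧ i < k) :
      AqRel q e dp dm T Ti y (T k i * y k (i + 1) * T k i) (q • y k i)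
  | y_T (k i j : ℕ) (hi : 1 ≤ i ∧ i ≤ k) (hj : 1 ≤ j ∧ j < k) (hij : i ≠ j ∧ i ≠ j + 1) :
      AqRel q e dp dm T Ti y (y k i * T k j) (T k j * y k i)
  | y_comm (k i j : ℕ) (hi : 1 ≤ i ∧ i ≤ k) (hj : 1 ≤ j ∧ j ≤ k) :
      AqRel q e dp dm T Ti y (y k i * y k j) (y k j * y k i)
  /-- `d_-² T_{k-1} = d_-²` at vertex `k = n + 2` -/
  | dm_dm_T (n : ℕ) :
      AqRel q e dp dm T Ti y (dm n * dm (n + 1) * T (n + 2) (n + 1)) (dm n * dm (n + 1))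
  /-- `d_- T_i = T_i d_-` at vertex `k + 1` -/
  | dm_T (k i : ℕ) (h : 1 ≤ i ∧ i < k) :
      AqRel q e dp dm T Ti y (dm k * T (k + 1) i) (T k i * dm k)
  /-- `d_- y_i = y_i d_-` at vertex `k + 1` -/
  | dm_y (k i : ℕ) (h : 1 ≤ i ∧ i ≤ k) :
      AqRel q e dp dm T Ti y (dm k * y (k + 1) i) (y k i * dm k)
  | T_dp_dp (k : ℕ) :
      AqRel q e dp dm T Ti y (T (k + 2) 1 * dp (k + 1) * dp k) (dp (k + 1) * dp k)
  | dp_T (k i : ℕ) (h : 1 ≤ i ∧ i < k) :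
      AqRel q e dp dm T Ti y (dp k * T k i) (T (k + 1) (i + 1) * dp k)
  /-- `d_+ y_i = T_1 ⋯ T_i y_i T_i⁻¹ ⋯ T_1⁻¹ d_+` -/
  | dp_y (k i : ℕ) (h : 1 ≤ i ∧ i ≤ k) :
      AqRel q e dp dm T Ti y (dp k * y k i)
        (prodUp (T (k + 1)) i * y (k + 1) i * prodDown (Ti (k + 1)) i * dp k)
  /-- `d_+ d_- - d_- d_+ = (q - 1) T_1 ⋯ T_{k-1} y_k` at vertex `k = n + 1` -/
  | commutator (n : ℕ) :
      AqRel q e dp dm T Ti y (dp n * dm n - dm (n + 1) * dp (n + 1))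
        ((q - 1) • (prodUp (T (n + 1)) n * y (n + 1) (n + 1)))

section Presentations

variable (K : Type*) [Field K] (q t : K)

/-- A generator of `𝔸_{q,t}` as an element of the free algebra. -/
def aFree (g : AGen) : FreeAlgebra K AGen := FreeAlgebra.ι K g

/-- A generator of `𝔹_{q,t}` as an element of the free algebra. -/
def bFree (g : BGen) : FreeAlgebra K BGen := FreeAlgebra.ι K g

/-- The inverse of `T_i : k → k`. -/
def aFreeTInv (k i : ℕ) : FreeAlgebra K AGen :=
  heckeInv q (aFree K (.idem k)) (aFree K (.T k i))

/-- The inverse of `T_i : k → k`. -/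
def bFreeTInv (k i : ℕ) : FreeAlgebra K BGen :=
  heckeInv q (bFree K (.idem k)) (bFree K (.T k i))

/-- The defining relations of `𝔸_{q,t}`. -/
inductive ARel : FreeAlgebra K AGen → FreeAlgebra K AGen → Prop
  | idem_idem (k : ℕ) :
      ARel (aFree K (.idem k) * aFree K (.idem k)) (aFree K (.idem k))
  | idem_orth (j k : ℕ) (h : j ≠ k) :
      ARel (aFree K (.idem j) * aFree K (.idem k)) 0
  | source (g : AGen) : ARel (aFree K g * aFree K (.idem g.src)) (aFree K g)
  | target (g : AGen) : ARel (aFree K (.idem g.tgt) * aFree K g) (aFree K g)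
  | outOfRange (g : AGen) (h : ¬ g.InRange) : ARel (aFree K g) 0
  /-- the relations of `𝔸_q` for `d_-, d_+, T_i, y_i` -/
  | left (a b : FreeAlgebra K AGen)
      (h : AqRel q (fun k => aFree K (.idem k)) (fun k => aFree K (.dPlus k))
        (fun k => aFree K (.dMinus k)) (fun k i => aFree K (.T k i)) (aFreeTInv K q)
        (fun k i => aFree K (.y k i)) a b) : ARel a b
  /-- the relations of `𝔸_{q⁻¹}` for `d_-, d_+^*, T_i⁻¹, z_i` -/
  | right (a b : FreeAlgebra K AGen)
      (h : AqRel q⁻¹ (fun k => aFree K (.idem k)) (fun k => aFree K (.dPlusStar k))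
        (fun k => aFree K (.dMinus k)) (aFreeTInv K q) (fun k i => aFree K (.T k i))
        (fun k i => aFree K (.z k i)) a b) : ARel a b
  | dPlus_z (k i : ℕ) (h : 1 ≤ i ∧ i ≤ k) :
      ARel (aFree K (.dPlus k) * aFree K (.z k i))
        (aFree K (.z (k + 1) (i + 1)) * aFree K (.dPlus k))
  | dPlusStar_y (k i : ℕ) (h : 1 ≤ i ∧ i ≤ k) :
      ARel (aFree K (.dPlusStar k) * aFree K (.y k i))
        (aFree K (.y (k + 1) (i + 1)) * aFree K (.dPlusStar k))
  /-- `z_1 d_+ = - t q^{k+1} y_1 d_+^*` -/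
  | z_dPlus (k : ℕ) :
      ARel (aFree K (.z (k + 1) 1) * aFree K (.dPlus k))
        (-(t * q ^ (k + 1)) • (aFree K (.y (k + 1) 1) * aFree K (.dPlusStar k)))

/-- `d_+ d_- - d_- d_+ : k → k` for `k = n + 1`. -/
def bFreeComm (n : ℕ) : FreeAlgebra K BGen :=
  bFree K (.dPlus n) * bFree K (.dMinus n) - bFree K (.dMinus (n + 1)) * bFree K (.dPlus (n + 1))

/-- `φ = (q - 1)⁻¹ (d_+ d_- - d_- d_+) : k → k` for `k = n + 1`. -/
def bFreePhi (n : ℕ) : FreeAlgebra K BGen := (q - 1)⁻¹ • bFreeComm K n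

/-- The defining relations of `𝔹_{q,t}`. -/
inductive BRel : FreeAlgebra K BGen → FreeAlgebra K BGen → Prop
  | idem_idem (k : ℕ) :
      BRel (bFree K (.idem k) * bFree K (.idem k)) (bFree K (.idem k))
  | idem_orth (j k : ℕ) (h : j ≠ k) :
      BRel (bFree K (.idem j) * bFree K (.idem k)) 0
  | source (g : BGen) : BRel (bFree K g * bFree K (.idem g.src)) (bFree K g)
  | target (g : BGen) : BRel (bFree K (.idem g.tgt) * bFree K g) (bFree K g)
  | outOfRange (g : BGen) (h : ¬ g.InRange) : BRel (bFree K g) 0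
  | hecke (k i : ℕ) (h : 1 ≤ i ∧ i < k) :
      BRel ((bFree K (.T k i) - bFree K (.idem k)) * (bFree K (.T k i) + q • bFree K (.idem k))) 0
  | braid (k i : ℕ) (h : 1 ≤ i ∧ i + 1 < k) :
      BRel (bFree K (.T k i) * bFree K (.T k (i + 1)) * bFree K (.T k i))
        (bFree K (.T k (i + 1)) * bFree K (.T k i) * bFree K (.T k (i + 1)))
  | T_comm (k i j : ℕ) (h : 1 ≤ i ∧ i + 1 < j ∧ j < k) :
      BRel (bFree K (.T k i) * bFree K (.T k j)) (bFree K (.T k j) * bFree K (.T k i))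
  | T_z_T (k i : ℕ) (h : 1 ≤ i ∧ i < k) :
      BRel (bFreeTInv K q k i * bFree K (.z k (i + 1)) * bFreeTInv K q k i)
        (q⁻¹ • bFree K (.z k i))
  | z_T (k i j : ℕ) (hi : 1 ≤ i ∧ i ≤ k) (hj : 1 ≤ j ∧ j < k) (hij : i ≠ j ∧ i ≠ j + 1) :
      BRel (bFree K (.z k i) * bFree K (.T k j)) (bFree K (.T k j) * bFree K (.z k i))
  | z_comm (k i j : ℕ) (hi : 1 ≤ i ∧ i ≤ k) (hj : 1 ≤ j ∧ j ≤ k) :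
      BRel (bFree K (.z k i) * bFree K (.z k j)) (bFree K (.z k j) * bFree K (.z k i))
  | dm_dm_T (n : ℕ) :
      BRel (bFree K (.dMinus n) * bFree K (.dMinus (n + 1)) * bFree K (.T (n + 2) (n + 1)))
        (bFree K (.dMinus n) * bFree K (.dMinus (n + 1)))
  | dm_T (k i : ℕ) (h : 1 ≤ i ∧ i < k) :
      BRel (bFree K (.dMinus k) * bFree K (.T (k + 1) i))
        (bFree K (.T k i) * bFree K (.dMinus k))
  | T_dp_dp (k : ℕ) :
      BRel (bFree K (.T (k + 2) 1) * bFree K (.dPlus (k + 1)) * bFree K (.dPlus k))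
        (bFree K (.dPlus (k + 1)) * bFree K (.dPlus k))
  | dp_T (k i : ℕ) (h : 1 ≤ i ∧ i < k) :
      BRel (bFree K (.dPlus k) * bFree K (.T k i))
        (bFree K (.T (k + 1) (i + 1)) * bFree K (.dPlus k))
  /-- `q φ d_- = d_- φ T_{k-1}` at vertex `k = n + 2` -/
  | phi_dm (n : ℕ) :
      BRel (q • (bFreePhi K q n * bFree K (.dMinus (n + 1))))
        (bFree K (.dMinus (n + 1)) * bFreePhi K q (n + 1) * bFree K (.T (n + 2) (n + 1)))
  /-- `T_1 φ d_+ = q d_+ φ` at vertex `k = n + 1` -/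
  | phi_dp (n : ℕ) :
      BRel (bFree K (.T (n + 2) 1) * bFreePhi K q (n + 1) * bFree K (.dPlus (n + 1)))
        (q • (bFree K (.dPlus (n + 1)) * bFreePhi K q n))
  | z_dm (k i : ℕ) (h : 1 ≤ i ∧ i ≤ k) :
      BRel (bFree K (.z k i) * bFree K (.dMinus k))
        (bFree K (.dMinus k) * bFree K (.z (k + 1) i))
  | dp_z (k i : ℕ) (h : 1 ≤ i ∧ i ≤ k) :
      BRel (bFree K (.dPlus k) * bFree K (.z k i))
        (bFree K (.z (k + 1) (i + 1)) * bFree K (.dPlus k))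
  /-- `z_1 (q d_+ d_- - d_- d_+) = q t (d_+ d_- - d_- d_+) z_k` at vertex `k = n + 1` -/
  | z_comm_z (n : ℕ) :
      BRel (bFree K (.z (n + 1) 1) * (q • (bFree K (.dPlus n) * bFree K (.dMinus n))
          - bFree K (.dMinus (n + 1)) * bFree K (.dPlus (n + 1))))
        ((q * t) • (bFreeComm K n * bFree K (.z (n + 1) (n + 1))))

/-- The algebra `𝔸_{q,t}` over `K`. -/
abbrev AAlg : Type _ := RingQuot (ARel K q t)

/-- The algebra `𝔹_{q,t}` over `K`. -/
abbrev BAlg : Type _ := RingQuot (BRel K q t)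

/-- The generators of `𝔸_{q,t}`. -/
def aGen (g : AGen) : AAlg K q t := RingQuot.mkAlgHom K (ARel K q t) (aFree K g)

/-- The generators of `𝔹_{q,t}`. -/
def bGen (g : BGen) : BAlg K q t := RingQuot.mkAlgHom K (BRel K q t) (bFree K g)

/-- The element `y_1 = q^{1-k} φ T_{k-1} ⋯ T_1 : k → k` of `𝔹_{q,t}` for `k = n + 1`; equivalently
`T_i y_{i+1} T_i = q y_i` and `φ = T_1 ⋯ T_{k-1} y_k`. -/
def bYOne (n : ℕ) : BAlg K q t :=
  (q ^ n)⁻¹ • (RingQuot.mkAlgHom K (BRel K q t) (bFreePhi K q n)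
    * prodDown (fun i => bGen K q t (.T (n + 1) i)) n)

variable {K q t}

/-- `α : 𝔹_{q,t} → 𝔸_{q,t}` sends the generators to the corresponding generators. -/
structure IsAlpha (α : BAlg K q t →ₐ[K] AAlg K q t) : Prop where
  idem : ∀ k, α (bGen K q t (.idem k)) = aGen K q t (.idem k)
  dPlus : ∀ k, α (bGen K q t (.dPlus k)) = aGen K q t (.dPlus k)
  dMinus : ∀ k, α (bGen K q t (.dMinus k)) = aGen K q t (.dMinus k)
  T : ∀ k i, 1 ≤ i → i < k → α (bGen K q t (.T k i)) = aGen K q t (.T k i)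
  z : ∀ k i, 1 ≤ i → i ≤ k → α (bGen K q t (.z k i)) = aGen K q t (.z k i)

/-- `β : 𝔸_{q,t} → 𝔹_{q,t}` fixes `Id_k`, `T_i`, `d_-`, `d_+`, and has
`β(d_+^*) = q^{-k} z_1 d_+` at vertex `k` and `β(z_1) = - q t y_1 z_1`. -/
structure IsBeta (β : AAlg K q t →ₐ[K] BAlg K q t) : Prop where
  idem : ∀ k, β (aGen K q t (.idem k)) = bGen K q t (.idem k)
  T : ∀ k i, 1 ≤ i → i < k → β (aGen K q t (.T k i)) = bGen K q t (.T k i)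
  dMinus : ∀ k, β (aGen K q t (.dMinus k)) = bGen K q t (.dMinus k)
  dPlus : ∀ k, β (aGen K q t (.dPlus k)) = bGen K q t (.dPlus k)
  dPlusStar : ∀ k, β (aGen K q t (.dPlusStar k))
    = (q ^ k)⁻¹ • (bGen K q t (.z (k + 1) 1) * bGen K q t (.dPlus k))
  z_one : ∀ n, β (aGen K q t (.z (n + 1) 1))
    = -(q * t) • (bYOne K q t n * bGen K q t (.z (n + 1) 1))

end Presentations

/-! ### The spaces `V_k ⊆ W_k` and the operators on them -/

section Operators

variable (K : Type*) [Field K]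

/-- The ring `Λ` of symmetric functions over a field `K` of characteristic zero, as the polynomial
ring in the power sums: the variable `X n` is the power sum `p_{n+1}`. -/
abbrev SymFun : Type _ := MvPolynomial ℕ K

/-- The ring of Laurent polynomials `Λ[y_1^{±1}, y_2^{±1}, …]`, in which all `V_k` and `W_k` lie.
A monomial is given by its exponents. -/
abbrev Lau : Type _ := AddMonoidAlgebra (SymFun K) (ℕ →₀ ℤ)

variable {K}

/-- `y_i ^ m` for an integer `m`. -/
def yPow (i : ℕ) (m : ℤ) : Lau K := AddMonoidAlgebra.single (Finsupp.single i m) 1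

/-- The variable `y_i`. -/
def yVar (i : ℕ) : Lau K := yPow i 1

/-- `s_i F`: the variables `y_i` and `y_{i+1}` are exchanged. -/
def swapY (i : ℕ) (F : Lau K) : Lau K :=
  F.coeff.sum fun a c => AddMonoidAlgebra.single (a.mapDomain (Equiv.swap i (i + 1))) c

/-- `F[X + ε (q - 1) y_j]`: the plethystic substitution `p_n ↦ p_n + ε (q^n - 1) y_j^n`, which
leaves all variables `y_i` alone. -/
def pleth (q ε : K) (j : ℕ) (F : Lau K) : Lau K :=
  F.coeff.sum fun a c =>
    MvPolynomial.aeval (fun n : ℕ =>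
        (AddMonoidAlgebra.single 0 (MvPolynomial.X n) : Lau K)
          + (ε * (q ^ (n + 1) - 1)) • yPow j ((n : ℤ) + 1)) c
      * AddMonoidAlgebra.single a 1

/-- `γ` on polynomials in `y_1, …, y_{k+1}`: `y_i ↦ y_{i+1}` for `i ≤ k`, and `y_{k+1} ↦ t y_1`. -/
def gammaOp (t : K) (k : ℕ) (F : Lau K) : Lau K :=
  F.coeff.sum fun a c =>
    AddMonoidAlgebra.single (a.mapDomain fun i => if i = k + 1 then 1 else i + 1)
      (t ^ (a (k + 1)) • c)

variable (K) in
/-- The plethystic exponential `Exp[-u X] = exp (- ∑_{n ≥ 1} p_n u^n / n)`, a power series in `u`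
over `Λ`. -/
def pExpNeg [CharZero K] : PowerSeries (SymFun K) :=
  (PowerSeries.exp (SymFun K)).subst
    (PowerSeries.mk fun n : ℕ =>
      if n = 0 then (0 : SymFun K) else -((n : K)⁻¹ • MvPolynomial.X (n - 1)))

lemma swapY_single (i : ℕ) (a : ℕ →₀ ℤ) (c : SymFun K) :
    swapY i (AddMonoidAlgebra.single a c)
      = AddMonoidAlgebra.single (a.mapDomain (Equiv.swap i (i + 1))) c := by
  simp [swapY]

lemma swapY_add (i : ℕ) (F G : Lau K) : swapY i (F + G) = swapY i F + swapY i G := by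
  unfold swapY
  rw [AddMonoidAlgebra.coeff_add, Finsupp.sum_add_index']
  · simp
  · simp

lemma yPow_add (i : ℕ) (m n : ℤ) : (yPow i (m + n) : Lau K) = yPow i m * yPow i n := by
  simp [yPow, AddMonoidAlgebra.single_mul_single, Finsupp.single_add]

/-- `F - s_i F` is divisible by `y_{i+1} - y_i`. -/
lemma dvd_sub_swapY (i : ℕ) (F : Lau K) : (yVar (i + 1) - yVar i : Lau K) ∣ F - swapY i F := by
  have key : ∀ m : ℤ,
      Ideal.Quotient.mk (Ideal.span {(yVar (i + 1) - yVar i : Lau K)}) (yPow (i + 1) m)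
        = Ideal.Quotient.mk (Ideal.span {(yVar (i + 1) - yVar i : Lau K)}) (yPow i m) := by
    have hom : ∀ j : ℕ, ∃ f : Multiplicative ℤ →*
        (Lau K ⧸ Ideal.span {(yVar (i + 1) - yVar i : Lau K)}),
        ∀ m : ℤ, f (Multiplicative.ofAdd m) = Ideal.Quotient.mk _ (yPow j m) := fun j =>
      ⟨{ toFun := fun m => Ideal.Quotient.mk _ (yPow j m.toAdd)
         map_one' := by
           rw [← map_one (Ideal.Quotient.mk _)]
           simp [yPow, AddMonoidAlgebra.one_def]
         map_mul' := fun m n => by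
           rw [← map_mul, ← yPow_add]; rfl }, fun _ => rfl⟩
    obtain ⟨f, hf⟩ := hom (i + 1)
    obtain ⟨g, hg⟩ := hom i
    have hfg : f = g := by
      apply MonoidHom.ext_mint
      rw [hf, hg, Ideal.Quotient.eq]
      exact Ideal.subset_span rfl
    intro m
    rw [← hf, ← hg, hfg]
  rw [← Ideal.mem_span_singleton, ← Ideal.Quotient.eq]
  induction F using AddMonoidAlgebra.induction_linear with
  | zero => simp [swapY]
  | add F G hF hG => rw [swapY_add, map_add, map_add, hF, hG]
  | single a c =>
    obtain ⟨b, hb, ha⟩ : ∃ b : ℕ →₀ ℤ, b.mapDomain (Equiv.swap i (i + 1)) = b ∧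
        a = Finsupp.single i (a i) + Finsupp.single (i + 1) (a (i + 1)) + b := by
      refine ⟨(a.erase i).erase (i + 1), ?_, ?_⟩
      · ext j
        rw [Finsupp.mapDomain_equiv_apply]
        rcases eq_or_ne j i with rfl | h1
        · simp
        · rcases eq_or_ne j (i + 1) with rfl | h2
          · simp
          · simp [Equiv.swap_apply_of_ne_of_ne h1 h2]
      · ext j
        rcases eq_or_ne j i with rfl | h1
        · simp
        · rcases eq_or_ne j (i + 1) with rfl | h2
          · simp
          · simp [h1, h2]
    have e1 : (AddMonoidAlgebra.single a c : Lau K)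
        = yPow i (a i) * yPow (i + 1) (a (i + 1)) * AddMonoidAlgebra.single b c := by
      conv_lhs => rw [ha]
      simp [yPow, AddMonoidAlgebra.single_mul_single]
    have e2 : swapY i (AddMonoidAlgebra.single a c : Lau K)
        = yPow (i + 1) (a i) * yPow i (a (i + 1)) * AddMonoidAlgebra.single b c := by
      rw [swapY_single]
      conv_lhs => rw [ha]
      simp [yPow, AddMonoidAlgebra.single_mul_single, Finsupp.mapDomain_add, hb]
    rw [e2, e1, map_mul, map_mul, map_mul, map_mul, key, key]

lemma exists_heckeT (q : K) (i : ℕ) (F : Lau K) : ∃ G : Lau K,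
    (yVar (i + 1) - yVar i) * G
      = (q - 1) • (yVar i * F) + (yVar (i + 1) - q • yVar i) * swapY i F := by
  obtain ⟨D, hD⟩ := dvd_sub_swapY i F
  refine ⟨swapY i F + (q - 1) • (yVar i * D), ?_⟩
  have h : (yVar (i + 1) - yVar i) * ((q - 1) • (yVar i * D))
      = (q - 1) • (yVar i * (F - swapY i F)) := by
    rw [hD, mul_smul_comm]
    ring_nf
  rw [mul_add, h]
  simp only [sub_smul, one_smul, mul_sub, sub_mul, smul_sub, smul_mul_assoc]
  abel

/-- The Demazure–Lusztig operator
`T_i F = ((q - 1) y_i F + (y_{i+1} - q y_i) s_i F) / (y_{i+1} - y_i)`, where the (exact) quotient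
is taken in the integral domain of Laurent polynomials. -/
def heckeT (q : K) (i : ℕ) (F : Lau K) : Lau K := (exists_heckeT q i F).choose

/-- The defining property of `T_i F`. -/
lemma heckeT_spec (q : K) (i : ℕ) (F : Lau K) :
    (yVar (i + 1) - yVar i) * heckeT q i F
      = (q - 1) • (yVar i * F) + (yVar (i + 1) - q • yVar i) * swapY i F :=
  (exists_heckeT q i F).choose_spec

/-- `T_1 (T_2 (⋯ (T_k F)))`. -/
def heckeProd (q : K) : ℕ → Lau K → Lau K
  | 0, F => F
  | k + 1, F => heckeProd q k (heckeT q (k + 1) F)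

/-- `d_+ F = T_1 ⋯ T_k (F[X + (q - 1) y_{k+1}])` for `F` at vertex `k`. -/
def dPlusOp (q : K) (k : ℕ) (F : Lau K) : Lau K := heckeProd q k (pleth q 1 (k + 1) F)

/-- `d_{+,CM}^* F = γ (F[X + (q - 1) y_{k+1}])` for `F` at vertex `k`. -/
def dPlusStarCM (q t : K) (k : ℕ) (F : Lau K) : Lau K := gammaOp t k (pleth q 1 (k + 1) F)

/-- `d_+^* = - (q t y_1)⁻¹ d_{+,CM}^*`. -/
def dPlusStarOp (q t : K) (k : ℕ) (F : Lau K) : Lau K :=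
  -((q * t)⁻¹ • (yPow 1 (-1) * dPlusStarCM q t k F))

/-- The residue `Res_{y_k} F Exp[-y_k⁻¹ X] dy_k`, the coefficient of `y_k⁻¹` in
`F · ∑_n E_n y_k^{-n}` where `Exp[-u X] = ∑_n E_n u^n`: the term `c y^a` of `F` contributes
`c E_n` times `y^a` with `y_k` removed, where `a_k - n = -1`. -/
def resExp [CharZero K] (k : ℕ) (F : Lau K) : Lau K :=
  F.coeff.sum fun a c =>
    if 0 ≤ a k + 1 then
      AddMonoidAlgebra.single (a.erase k) (c * (pExpNeg K).coeff (a k + 1).toNat)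
    else 0

/-- `d_- F = - Res_{y_k} F[X - (q - 1) y_k] Exp[-y_k⁻¹ X] dy_k` for `F` at vertex `k ≥ 1`. -/
def dMinusOp [CharZero K] (q : K) (k : ℕ) (F : Lau K) : Lau K :=
  -resExp k (pleth q (-1) k F)

variable (K)

/-- `V_k = Λ ⊗ K[y_1, …, y_k]`. -/
def V (k : ℕ) : Submodule K (Lau K) where
  carrier := {F | ∀ a, F.coeff a ≠ 0 → ∀ i, 0 ≤ a i ∧ (a i ≠ 0 → 1 ≤ i ∧ i ≤ k)}
  zero_mem' := by simp
  add_mem' := by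
    intro F G hF hG a ha
    by_cases h : F.coeff a = 0
    · exact hG a fun h' => ha (by simp [h, h'])
    · exact hF a h
  smul_mem' := by
    intro c F hF a ha
    exact hF a fun h => ha (by simp [h])

/-- `W_k = (y_1 ⋯ y_k)⁻¹ V_k`. -/
def W (k : ℕ) : Submodule K (Lau K) :=
  (V K k).comap (LinearMap.mulLeft K (∏ i ∈ Finset.Icc 1 k, yVar i))

lemma yVar_mul_mem {k i : ℕ} (h : 1 ≤ i ∧ i ≤ k) {F : Lau K} (hF : F ∈ V K k) :
    yVar i * F ∈ V K k := by
  intro a ha j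
  have hc : (yVar i * F).coeff a = F.coeff (-Finsupp.single i 1 + a) := by
    simp [yVar, yPow, AddMonoidAlgebra.coeff_single_mul_apply]
  rw [hc] at ha
  have := hF _ ha j
  simp only [Finsupp.add_apply, Finsupp.neg_apply, Finsupp.single_apply] at this
  split_ifs at this with hij
  · subst hij
    exact ⟨by omega, fun _ => h⟩
  · simpa using this

lemma V_le_W (k : ℕ) : V K k ≤ W K k := by
  intro F hF
  have : ∀ s : Finset ℕ, s ⊆ Finset.Icc 1 k → (∏ i ∈ s, yVar i) * F ∈ V K k := by
    intro s
    induction s using Finset.induction_on with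
    | empty => intro _; simpa using hF
    | insert i s hi ih =>
      intro hs
      rw [Finset.prod_insert hi, mul_assoc]
      exact yVar_mul_mem K (Finset.mem_Icc.mp (hs (Finset.mem_insert_self i s)))
        (ih ((Finset.subset_insert i s).trans hs))
  exact this _ subset_rfl

/-- `V_• = ⨁ V_k`. -/
abbrev VBullet : Type _ := DirectSum ℕ fun k => V K k

/-- `W_• = ⨁ W_k`. -/
abbrev WBullet : Type _ := DirectSum ℕ fun k => W K k

/-- The inclusion `V_• ⊆ W_•`. -/
def inclVW : VBullet K →ₗ[K] WBullet K :=
  DirectSum.lmap fun k => Submodule.inclusion (V_le_W K k)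

end Operators

/-- The homomorphism `ρ` is an action of `𝔸_{q,t}` on `⨁ M_k`, where `M_k` is `V_k` or `W_k`, in
which `Id_k` is the projection to `M_k`, `T_i`, `d_+` and `d_-` are the operators above, `y_i` is
multiplication by `y_i`, and `d_+^*` is the given operator `star`. -/
structure ActsBy {K₀ K : Type*} [Field K₀] [Field K] [CharZero K] [Algebra K₀ K] (q t : K₀)
    (M : ℕ → Submodule K (Lau K)) (star : ℕ → Lau K → Lau K)
    (ρ : AAlg K₀ q t →ₐ[K₀] Module.End K (DirectSum ℕ fun k => M k)) : Prop where
  idem : ∀ k w, ρ (aGen K₀ q t (.idem k)) w = DirectSum.of (fun k => M k) k (w k)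
  T : ∀ k i w, 1 ≤ i → i < k →
    (ρ (aGen K₀ q t (.T k i)) w k : Lau K) = heckeT (algebraMap K₀ K q) i (w k)
  y : ∀ k i w, 1 ≤ i → i ≤ k → (ρ (aGen K₀ q t (.y k i)) w k : Lau K) = yVar i * (w k : Lau K)
  dPlus : ∀ k w, (ρ (aGen K₀ q t (.dPlus k)) w (k + 1) : Lau K)
    = dPlusOp (algebraMap K₀ K q) k (w k)
  dMinus : ∀ k w, (ρ (aGen K₀ q t (.dMinus k)) w k : Lau K)
    = dMinusOp (algebraMap K₀ K q) (k + 1) (w (k + 1))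
  dPlusStar : ∀ k w, (ρ (aGen K₀ q t (.dPlusStar k)) w (k + 1) : Lau K) = star k (w k)

/-! ### The ground fields -/

/-- The field `ℚ(q, t)`. -/
abbrev Qqt : Type := FractionRing (MvPolynomial (Fin 2) ℚ)

/-- The field `ℂ(q, t)`. -/
abbrev Cqt : Type := FractionRing (MvPolynomial (Fin 2) ℂ)

/-- `ℂ(q, t)` is an extension of `ℚ(q, t)` in the natural way. -/
instance instAlgebraQqtCqt : Algebra Qqt Cqt :=
  RingHom.toAlgebra (IsFractionRing.map (A := MvPolynomial (Fin 2) ℚ)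
    (B := MvPolynomial (Fin 2) ℂ) (j := MvPolynomial.map (algebraMap ℚ ℂ))
    (MvPolynomial.map_injective _ (algebraMap ℚ ℂ).injective))

/-- The parameter `q`. -/
def qPar : Qqt := algebraMap (MvPolynomial (Fin 2) ℚ) Qqt (MvPolynomial.X 0)

/-- The parameter `t`. -/
def tPar : Qqt := algebraMap (MvPolynomial (Fin 2) ℚ) Qqt (MvPolynomial.X 1)

end DyckPath

end

open DyckPath

noncomputable section

namespace DyckPath

/-! ### Words in a braid monoid -/

section Words

variable {M N : Type*} [Monoid M] [Monoid N]

/-! The algebraic half rests on eliminating the `y_i` from `𝔸_q`. Put `φ = (q-1)⁻¹(d_+d_- -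
d_-d_+)`. The last relation of `𝔸_q` says `φ = T_1 ⋯ T_{k-1} y_k`, so every `y_i` is determined by
`d_±` and `T`. Conversely the two relations `q φ d_- = d_- φ T_{k-1}` and `T_1 φ d_+ = q d_+ φ`
already imply every relation that involves the `y_i` (`DyckSystem.aqRel`). The only hard case is
`y_1 y_2 = y_2 y_1`, which comes down to `φ² T_{k-1} = T_1 φ²` (`DyckSystem.phi_sq_mul_T`); all
other commutations follow by conjugating with the `T_i`.

This makes `𝔸_{q,t}` two copies of such a presentation, for `q` and for `q⁻¹`, sharing `d_-` and
`T`, together with three cross relations. For `α`, the relations of `𝔹_{q,t}` are checked in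
`𝔸_{q,t}` (`ASystem.bSystem`). For `β`, the elements `q^{-k} z_1 d_+`, `d_-`, `T_i⁻¹` of `𝔹_{q,t}`
are shown to satisfy the reduced presentation at `q⁻¹` (`BSystem.dyckSystem_star`); the point is
that their commutator is a multiple of `φ z_k` (`BSystem.phiOf_star`).

For the operators, `d_+ = T_1 ⋯ T_k τ` with `τ F = F[X+(q-1)y_{k+1}]`, and `OpSystem` collects the
identities for `τ`, `d_-`, `d_+^*`, `T_i`, `y_i` from which `𝔸_{q,t}` follows. The operators `τ`,
`s_i` and, up to the factor `y_1⁻¹`, `d_+^*` come from algebra homomorphisms, so identities between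
them are checked on `p_n` and `y_i`. The operator `d_-` is a residue in a variable `w` replacing
`y_k`. The one analytic input is that the shift `p_n ↦ p_n + (q^n-1)x^n` multiplies `Exp[-w⁻¹X]` by
`(w-qx)/(w-x)` (`expL_mul`). Single residues are then read off from leading terms in `w⁻¹`, and
relations with two factors `d_-` follow because an iterated residue does not change when its two
variables are exchanged (`coeff_resHom_resHom_swapHom`).

The commutator `φ^*` of `d_+^*` and `d_-` comes out as the residue `phiStar`, in which the pole
`y_1⁻¹` of `d_+^*` has cancelled. So `φ^*`, and with it every `z_i`, preserves `V_•` although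
`d_+^*` does not; this gives part 2. Since `αβ(d_+^*) = -qt y_1 d_+^*`, the action through `αβ`
replaces `d_+^*` by `d_{+,CM}^*`, which is part 3. -/

lemma prodUp_zero (x : ℕ → M) : prodUp x 0 = 1 := rfl

lemma prodUp_succ (x : ℕ → M) (m : ℕ) : prodUp x (m + 1) = prodUp x m * x (m + 1) := by
  simp [prodUp, List.range_succ]

lemma prodUp_succ' (x : ℕ → M) (m : ℕ) :
    prodUp x (m + 1) = x 1 * prodUp (fun j => x (j + 1)) m := by
  simp [prodUp, List.range_succ_eq_map, Function.comp_def]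

lemma prodDown_zero (x : ℕ → M) : prodDown x 0 = 1 := rfl

lemma prodDown_succ (x : ℕ → M) (m : ℕ) : prodDown x (m + 1) = x (m + 1) * prodDown x m := by
  simp [prodDown, List.range_succ]

lemma prodDown_succ' (x : ℕ → M) (m : ℕ) :
    prodDown x (m + 1) = prodDown (fun j => x (j + 1)) m * x 1 := by
  simp [prodDown, List.range_succ_eq_map, Function.comp_def]

lemma map_prodUp {G : Type*} [FunLike G M N] [MonoidHomClass G M N] (f : G) (x : ℕ → M) (m : ℕ) :
    f (prodUp x m) = prodUp (fun j => f (x j)) m := by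
  simp [prodUp, map_list_prod, Function.comp_def]

lemma map_prodDown {G : Type*} [FunLike G M N] [MonoidHomClass G M N] (f : G) (x : ℕ → M)
    (m : ℕ) : f (prodDown x m) = prodDown (fun j => f (x j)) m := by
  simp [prodDown, map_list_prod, Function.comp_def]

lemma prodUp_congr {x x' : ℕ → M} {m : ℕ} (h : ∀ j, 1 ≤ j → j ≤ m → x j = x' j) :
    prodUp x m = prodUp x' m := by
  induction m with
  | zero => rfl
  | succ m ih =>
    rw [prodUp_succ, prodUp_succ, ih fun j h1 h2 => h j h1 (by omega), h (m + 1) (by omega) le_rfl]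

lemma prodDown_congr {x x' : ℕ → M} {m : ℕ} (h : ∀ j, 1 ≤ j → j ≤ m → x j = x' j) :
    prodDown x m = prodDown x' m := by
  induction m with
  | zero => rfl
  | succ m ih =>
    rw [prodDown_succ, prodDown_succ, ih fun j h1 h2 => h j h1 (by omega),
      h (m + 1) (by omega) le_rfl]

lemma mul_prodUp_of_intertwine {d : M} {x x' : ℕ → M} {m : ℕ}
    (h : ∀ j, 1 ≤ j → j ≤ m → d * x j = x' j * d) : d * prodUp x m = prodUp x' m * d := by
  induction m with
  | zero => simp [prodUp_zero]
  | succ m ih =>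
    rw [prodUp_succ, prodUp_succ, ← mul_assoc, ih fun j h1 h2 => h j h1 (by omega), mul_assoc,
      h (m + 1) (by omega) le_rfl, mul_assoc]

lemma mul_prodDown_of_intertwine {d : M} {x x' : ℕ → M} {m : ℕ}
    (h : ∀ j, 1 ≤ j → j ≤ m → d * x j = x' j * d) : d * prodDown x m = prodDown x' m * d := by
  induction m with
  | zero => simp [prodDown_zero]
  | succ m ih =>
    rw [prodDown_succ, prodDown_succ, ← mul_assoc, h (m + 1) (by omega) le_rfl, mul_assoc,
      ih fun j h1 h2 => h j h1 (by omega), mul_assoc]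

/-- The elements `x_1, …, x_{k-1}` satisfy the braid relations. -/
structure BraidSeq (k : ℕ) (x : ℕ → M) : Prop where
  braid : ∀ i, 1 ≤ i → i + 1 < k → x i * x (i + 1) * x i = x (i + 1) * x i * x (i + 1)
  comm : ∀ i j, 1 ≤ i → i + 1 < j → j < k → x i * x j = x j * x i

variable {k : ℕ} {x : ℕ → M}

lemma BraidSeq.comm_prodUp (h : BraidSeq k x) {m j : ℕ} (hm : m + 1 < j) (hj : j < k) :
    x j * prodUp x m = prodUp x m * x j :=
  mul_prodUp_of_intertwine fun i h1 h2 => (h.comm i j h1 (by omega) hj).symm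

lemma BraidSeq.comm_prodDown (h : BraidSeq k x) {m j : ℕ} (hm : m + 1 < j) (hj : j < k) :
    x j * prodDown x m = prodDown x m * x j :=
  mul_prodDown_of_intertwine fun i h1 h2 => (h.comm i j h1 (by omega) hj).symm

/-- The factor `x_i` passes the letters of index above `i + 1`, turns into `x_{i+1}` by one braid
relation, and then passes `x_1, …, x_{i-1}`. -/
lemma BraidSeq.prodUp_mul (h : BraidSeq k x) {m i : ℕ} (hm : m < k) (h1 : 1 ≤ i) (hi : i < m) :
    prodUp x m * x i = x (i + 1) * prodUp x m := by
  induction m with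
  | zero => omega
  | succ m ih =>
    rcases Nat.lt_or_ge i m with him | him
    · rw [prodUp_succ, mul_assoc, ← h.comm i (m + 1) h1 (by omega) hm, ← mul_assoc,
        ih (by omega) him, mul_assoc]
    · obtain rfl : i = m := by omega
      obtain ⟨j, rfl⟩ : ∃ j, i = j + 1 := ⟨i - 1, by omega⟩
      rw [prodUp_succ, prodUp_succ]
      calc _ = prodUp x j * (x (j + 1) * x (j + 1 + 1) * x (j + 1)) := by simp only [mul_assoc]
        _ = prodUp x j * x (j + 1 + 1) * (x (j + 1) * x (j + 1 + 1)) := by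
          rw [h.braid _ h1 hm]; simp only [mul_assoc]
        _ = _ := by rw [← h.comm_prodUp (by omega) hm]; simp only [mul_assoc]

lemma BraidSeq.mul_prodDown (h : BraidSeq k x) {m i : ℕ} (hm : m < k) (h1 : 1 ≤ i) (hi : i < m) :
    x i * prodDown x m = prodDown x m * x (i + 1) := by
  induction m with
  | zero => omega
  | succ m ih =>
    rcases Nat.lt_or_ge i m with him | him
    · rw [prodDown_succ, ← mul_assoc, h.comm i (m + 1) h1 (by omega) hm, mul_assoc,
        ih (by omega) him, mul_assoc]
    · obtain rfl : i = m := by omega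
      obtain ⟨j, rfl⟩ : ∃ j, i = j + 1 := ⟨i - 1, by omega⟩
      rw [prodDown_succ, prodDown_succ]
      calc _ = x (j + 1) * x (j + 1 + 1) * x (j + 1) * prodDown x j := by simp only [mul_assoc]
        _ = x (j + 1 + 1) * x (j + 1) * (x (j + 1 + 1) * prodDown x j) := by
          rw [h.braid _ h1 hm]; simp only [mul_assoc]
        _ = _ := by rw [h.comm_prodDown (by omega) hm]; simp only [mul_assoc]

lemma BraidSeq.prodUp_mul_prodUp (h : BraidSeq k x) {m n : ℕ} (hn : n < k) (hm : m < n) :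
    prodUp x n * prodUp x m = prodUp (fun j => x (j + 1)) m * prodUp x n :=
  mul_prodUp_of_intertwine fun _ h1 h2 => h.prodUp_mul hn h1 (by omega)

lemma BraidSeq.prodDown_mul_prodDown (h : BraidSeq k x) {m n : ℕ} (hn : n < k) (hm : m < n) :
    prodDown x m * prodDown x n = prodDown x n * prodDown (fun j => x (j + 1)) m :=
  (mul_prodDown_of_intertwine fun _ h1 h2 => (h.mul_prodDown hn h1 (by omega)).symm).symm

/-- `x_1 ⋅ (x_1 ⋯ x_n) (x_1 ⋯ x_{n-1}) = (x_1 ⋯ x_n) (x_1 ⋯ x_n)`. -/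
lemma BraidSeq.mul_prodUp_mul_prodUp (h : BraidSeq k x) {n : ℕ} (hn : n + 1 < k) :
    x 1 * (prodUp x (n + 1) * prodUp x n) = prodUp x (n + 1) * prodUp x (n + 1) := by
  rw [h.prodUp_mul_prodUp hn (Nat.lt_succ_self n), ← mul_assoc, ← prodUp_succ']

end Words

/-! ### Hecke algebras at the vertices -/

section Hecke

variable {K F : Type*} [Field K] [Ring F] [Algebra K F]

/-- `T k 1, …, T k (k-1)` generate an image of a Hecke algebra with unit the idempotent `e k`,
and `Ti k i` is the inverse of `T k i`. -/
structure HeckeSystem (q : K) (e : ℕ → F) (T Ti : ℕ → ℕ → F) : Prop where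
  e_e : ∀ k, e k * e k = e k
  e_T : ∀ k i, 1 ≤ i → i < k → e k * T k i = T k i
  T_e : ∀ k i, 1 ≤ i → i < k → T k i * e k = T k i
  Ti_eq : ∀ k i, 1 ≤ i → i < k → Ti k i = q⁻¹ • (T k i + (q - 1) • e k)
  T_T : ∀ k i, 1 ≤ i → i < k → T k i * T k i = q • e k - (q - 1) • T k i
  braidSeq : ∀ k, BraidSeq k (T k)

variable {q : K} {e : ℕ → F} {T Ti : ℕ → ℕ → F}

lemma HeckeSystem.e_Ti (H : HeckeSystem q e T Ti) {k i : ℕ} (h1 : 1 ≤ i) (h2 : i < k) :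
    e k * Ti k i = Ti k i := by
  rw [H.Ti_eq k i h1 h2, mul_smul_comm, mul_add, H.e_T k i h1 h2, mul_smul_comm, H.e_e]

lemma HeckeSystem.Ti_e (H : HeckeSystem q e T Ti) {k i : ℕ} (h1 : 1 ≤ i) (h2 : i < k) :
    Ti k i * e k = Ti k i := by
  rw [H.Ti_eq k i h1 h2, smul_mul_assoc, add_mul, H.T_e k i h1 h2, smul_mul_assoc, H.e_e]

lemma HeckeSystem.T_Ti (H : HeckeSystem q e T Ti) (hq : q ≠ 0) {k i : ℕ} (h1 : 1 ≤ i)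
    (h2 : i < k) : T k i * Ti k i = e k := by
  rw [H.Ti_eq k i h1 h2, mul_smul_comm, mul_add, mul_smul_comm, H.T_e k i h1 h2, H.T_T k i h1 h2,
    sub_add_cancel, smul_smul, inv_mul_cancel₀ hq, one_smul]

lemma HeckeSystem.Ti_T (H : HeckeSystem q e T Ti) (hq : q ≠ 0) {k i : ℕ} (h1 : 1 ≤ i)
    (h2 : i < k) : Ti k i * T k i = e k := by
  rw [H.Ti_eq k i h1 h2, smul_mul_assoc, add_mul, smul_mul_assoc, H.e_T k i h1 h2,
    H.T_T k i h1 h2, sub_add_cancel, smul_smul, inv_mul_cancel₀ hq, one_smul]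

/-- An element intertwining `T k i` and `T l j` intertwines their inverses. -/
lemma HeckeSystem.intertwine (H : HeckeSystem q e T Ti) {k i l j : ℕ} (h1 : 1 ≤ i) (h2 : i < k)
    (h3 : 1 ≤ j) (h4 : j < l) {x : F} (hx : x * T k i = T l j * x) (he : x * e k = e l * x) :
    x * Ti k i = Ti l j * x := by
  rw [H.Ti_eq k i h1 h2, H.Ti_eq l j h3 h4, mul_smul_comm, mul_add, mul_smul_comm, hx, he,
    smul_mul_assoc, add_mul, smul_mul_assoc]

lemma HeckeSystem.T_Ti_comm (H : HeckeSystem q e T Ti) {k i j : ℕ} (h1 : 1 ≤ i)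
    (hij : i + 1 < j) (hj : j < k) : T k i * Ti k j = Ti k j * T k i :=
  H.intertwine (by omega) hj (by omega) hj ((H.braidSeq k).comm i j h1 hij hj)
    (by rw [H.T_e k i h1 (by omega), H.e_T k i h1 (by omega)])

lemma HeckeSystem.T_Ti_comm' (H : HeckeSystem q e T Ti) {k i j : ℕ} (h1 : 1 ≤ i)
    (hij : i + 1 < j) (hj : j < k) : T k j * Ti k i = Ti k i * T k j :=
  H.intertwine h1 (by omega) h1 (by omega) ((H.braidSeq k).comm i j h1 hij hj).symm
    (by rw [H.T_e k j (by omega) hj, H.e_T k j (by omega) hj])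

lemma HeckeSystem.Ti_Ti_comm (H : HeckeSystem q e T Ti) {k i j : ℕ} (h1 : 1 ≤ i)
    (hij : i + 1 < j) (hj : j < k) : Ti k i * Ti k j = Ti k j * Ti k i :=
  H.intertwine (by omega) hj (by omega) hj (H.T_Ti_comm' h1 hij hj).symm
    (by rw [H.Ti_e h1 (by omega), H.e_Ti h1 (by omega)])

/-- `T_{i+1} T_i⁻¹ T_{i+1}⁻¹ = T_i⁻¹ T_{i+1}⁻¹ T_i`. -/
lemma HeckeSystem.T_Ti_Ti (H : HeckeSystem q e T Ti) (hq : q ≠ 0) {k i : ℕ} (h1 : 1 ≤ i)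
    (h2 : i + 1 < k) :
    T k (i + 1) * Ti k i * Ti k (i + 1) = Ti k i * Ti k (i + 1) * T k i := by
  have h3 : i < k := by omega
  have h4 : 1 ≤ i + 1 := by omega
  have hb := (H.braidSeq k).braid i h1 h2
  calc T k (i + 1) * Ti k i * Ti k (i + 1)
      = Ti k i * Ti k (i + 1) * (T k (i + 1) * T k i * T k (i + 1)) * Ti k i * Ti k (i + 1) := by
        have e1 : Ti k i * Ti k (i + 1) * (T k (i + 1) * T k i * T k (i + 1))
            = T k (i + 1) := by
          calc _ = Ti k i * (Ti k (i + 1) * T k (i + 1)) * T k i * T k (i + 1) := by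
                simp only [mul_assoc]
            _ = T k (i + 1) := by
              rw [H.Ti_T hq h4 h2, H.Ti_e h1 h3, H.Ti_T hq h1 h3, H.e_T _ _ h4 h2]
        rw [e1]
    _ = Ti k i * Ti k (i + 1) * T k i * (T k (i + 1) * (T k i * Ti k i) * Ti k (i + 1)) := by
        rw [← hb]; simp only [mul_assoc]
    _ = _ := by
        rw [H.T_Ti hq h1 h3, H.T_e _ _ h4 h2, H.T_Ti hq h4 h2, mul_assoc, H.T_e _ _ h1 h3]

/-- `T_i T_{i+1} T_i⁻¹ = T_{i+1}⁻¹ T_i T_{i+1}`. -/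
lemma HeckeSystem.T_T_Ti (H : HeckeSystem q e T Ti) (hq : q ≠ 0) {k i : ℕ} (h1 : 1 ≤ i)
    (h2 : i + 1 < k) :
    T k i * T k (i + 1) * Ti k i = Ti k (i + 1) * T k i * T k (i + 1) := by
  have h3 : i < k := by omega
  have h4 : 1 ≤ i + 1 := by omega
  have hb := (H.braidSeq k).braid i h1 h2
  calc T k i * T k (i + 1) * Ti k i
      = Ti k (i + 1) * (T k (i + 1) * T k i * T k (i + 1)) * Ti k i := by
        rw [← mul_assoc, ← mul_assoc, H.Ti_T hq h4 h2, H.e_T _ _ h1 h3]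
    _ = Ti k (i + 1) * T k i * (T k (i + 1) * (T k i * Ti k i)) := by
        rw [← hb]; simp only [mul_assoc]
    _ = _ := by rw [H.T_Ti hq h1 h3, H.T_e _ _ h4 h2]

/-- This symmetry lets every statement about the `𝔸_q` half be reused for the `𝔸_{q⁻¹}` half, where
`T_i⁻¹` plays the role of `T_i`. -/
lemma HeckeSystem.symm (H : HeckeSystem q e T Ti) (hq : q ≠ 0) : HeckeSystem q⁻¹ e Ti T where
  e_e := H.e_e
  e_T _ _ h1 h2 := H.e_Ti h1 h2
  T_e _ _ h1 h2 := H.Ti_e h1 h2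
  Ti_eq k i h1 h2 := by
    rw [H.Ti_eq k i h1 h2]
    match_scalars <;> field_simp
    ring
  T_T k i h1 h2 := by
    have h : Ti k i * Ti k i = q⁻¹ • (e k + (q - 1) • Ti k i) := by
      conv_lhs => rw [H.Ti_eq k i h1 h2]
      rw [smul_mul_assoc, add_mul, ← H.Ti_eq k i h1 h2, H.T_Ti hq h1 h2, smul_mul_assoc,
        H.e_Ti h1 h2]
    rw [h]
    match_scalars <;> field_simp
    ring
  braidSeq k :=
    { braid := fun i h1 h2 => by
        have h3 : i < k := by omega
        have h4 : 1 ≤ i + 1 := by omega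
        have hb := H.T_Ti_Ti hq h1 h2
        calc Ti k i * Ti k (i + 1) * Ti k i
            = Ti k (i + 1) * (T k (i + 1) * Ti k i * Ti k (i + 1)) * Ti k i := by
              rw [← mul_assoc, ← mul_assoc, H.Ti_T hq h4 h2, H.e_Ti h1 h3]
          _ = Ti k (i + 1) * Ti k i * (Ti k (i + 1) * (T k i * Ti k i)) := by
              rw [hb]; simp only [mul_assoc]
          _ = _ := by rw [H.T_Ti hq h1 h3, H.Ti_e h4 h2]
      comm := fun _ _ h1 h2 h3 => H.Ti_Ti_comm h1 h2 h3 }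

/-- `T_i T_{i+1}⁻¹ T_i⁻¹ = T_{i+1}⁻¹ T_i⁻¹ T_{i+1}`. -/
lemma HeckeSystem.T_Ti_Ti' (H : HeckeSystem q e T Ti) (hq : q ≠ 0) {k i : ℕ} (h1 : 1 ≤ i)
    (h2 : i + 1 < k) :
    T k i * Ti k (i + 1) * Ti k i = Ti k (i + 1) * Ti k i * T k (i + 1) := by
  have h3 : i < k := by omega
  have h4 : 1 ≤ i + 1 := by omega
  have hb := ((H.symm hq).braidSeq k).braid i h1 h2
  calc T k i * Ti k (i + 1) * Ti k i
      = T k i * (Ti k (i + 1) * Ti k i * Ti k (i + 1)) * T k (i + 1) := by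
        simp only [mul_assoc]; rw [H.Ti_T hq h4 h2, H.Ti_e h1 h3]
    _ = (T k i * Ti k i) * Ti k (i + 1) * Ti k i * T k (i + 1) := by
        rw [← hb]; simp only [mul_assoc]
    _ = _ := by rw [H.T_Ti hq h1 h3, H.e_Ti h4 h2]

/-- If `T_i y_{i+1} T_i = q y_i` with `y_{i+1}` in the corner of `e k`, then
`y_{i+1} = q T_i⁻¹ y_i T_i⁻¹`. -/
lemma HeckeSystem.eq_smul_conj (H : HeckeSystem q e T Ti) (hq : q ≠ 0) {k i : ℕ} (h1 : 1 ≤ i)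
    (h2 : i < k) {y y' : F} (he : e k * y' = y') (he' : y' * e k = y')
    (h : T k i * y' * T k i = q • y) : y' = q • (Ti k i * y * Ti k i) := by
  rw [← smul_mul_assoc, ← mul_smul_comm, ← h, ← mul_assoc, ← mul_assoc, H.Ti_T hq h1 h2, he,
    mul_assoc, H.T_Ti hq h1 h2, he']

lemma HeckeSystem.conj_mul (H : HeckeSystem q e T Ti) (hq : q ≠ 0) {k i : ℕ} (h1 : 1 ≤ i)
    (h2 : i < k) {y y' : F} (he : e k * y = y) (he' : y * e k = y)
    (h : y' = q • (Ti k i * y * Ti k i)) : T k i * y' * T k i = q • y := by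
  rw [h, mul_smul_comm, smul_mul_assoc, mul_assoc, mul_assoc, mul_assoc, H.Ti_T hq h1 h2, he',
    ← mul_assoc, H.T_Ti hq h1 h2, he]

/-- `y_{i+1} = q T_i⁻¹ y_i T_i⁻¹` implies `y_{i+1} T_i = q T_i⁻¹ y_i`. -/
lemma HeckeSystem.conj_mul_T (H : HeckeSystem q e T Ti) (hq : q ≠ 0) {k i : ℕ} (h1 : 1 ≤ i)
    (h2 : i < k) {y y' : F} (he' : y * e k = y)
    (h : y' = q • (Ti k i * y * Ti k i)) : y' * T k i = q • (Ti k i * y) := by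
  rw [h, smul_mul_assoc, mul_assoc, H.Ti_T hq h1 h2, mul_assoc, he']

lemma HeckeSystem.T_mul_conj (H : HeckeSystem q e T Ti) (hq : q ≠ 0) {k i : ℕ} (h1 : 1 ≤ i)
    (h2 : i < k) {y y' : F} (he : e k * y = y)
    (h : y' = q • (Ti k i * y * Ti k i)) : T k i * y' = q • (y * Ti k i) := by
  rw [h, mul_smul_comm, ← mul_assoc, ← mul_assoc, H.T_Ti hq h1 h2, he]

lemma HeckeSystem.commute_e_prodUp (H : HeckeSystem q e T Ti) {k m : ℕ} (hm : m < k) :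
    e k * prodUp (T k) m = prodUp (T k) m * e k :=
  mul_prodUp_of_intertwine fun j h1 h2 => by
    rw [H.e_T k j h1 (by omega), H.T_e k j h1 (by omega)]

lemma HeckeSystem.commute_e_prodDown (H : HeckeSystem q e T Ti) {k m : ℕ} (hm : m < k) :
    e k * prodDown (T k) m = prodDown (T k) m * e k :=
  mul_prodDown_of_intertwine fun j h1 h2 => by
    rw [H.e_T k j h1 (by omega), H.T_e k j h1 (by omega)]

/-- The words cancel only up to the idempotent `e k`, which is not the unit of the ambient ring; the
assumption on `x` absorbs it. -/
lemma HeckeSystem.prodUp_mul_prodDown_inv (H : HeckeSystem q e T Ti) (hq : q ≠ 0) {k m : ℕ}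
    (hm : m < k) {x : F} (hx : e k * x = x) : prodUp (T k) m * (prodDown (Ti k) m * x) = x := by
  induction m with
  | zero => simp [prodUp_zero, prodDown_zero]
  | succ m ih =>
    have h : e k * (prodDown (Ti k) m * x) = prodDown (Ti k) m * x := by
      rw [← mul_assoc, (H.symm hq).commute_e_prodDown (by omega), mul_assoc, hx]
    rw [prodUp_succ, prodDown_succ, mul_assoc, mul_assoc, ← mul_assoc (T k (m + 1)),
      H.T_Ti hq (by omega) hm, h, ih (by omega)]

lemma HeckeSystem.prodDown_mul_prodUp_inv (H : HeckeSystem q e T Ti) (hq : q ≠ 0) {k m : ℕ}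
    (hm : m < k) {x : F} (hx : e k * x = x) : prodDown (Ti k) m * (prodUp (T k) m * x) = x := by
  have H' := H.symm hq
  induction m generalizing x with
  | zero => simp [prodUp_zero, prodDown_zero]
  | succ m ih =>
    have h : e k * (T k (m + 1) * x) = T k (m + 1) * x := by
      rw [← mul_assoc, H.e_T k _ (by omega) hm]
    rw [prodUp_succ, prodDown_succ, mul_assoc, mul_assoc, ih (by omega) h, ← mul_assoc,
      H.Ti_T hq (by omega) hm, hx]

lemma HeckeSystem.mul_prodDown_mul_prodUp_inv (H : HeckeSystem q e T Ti) (hq : q ≠ 0) {k m : ℕ}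
    (hm : m < k) {x : F} (hx : x * e k = x) : x * prodDown (T k) m * prodUp (Ti k) m = x := by
  induction m generalizing x with
  | zero => simp [prodUp_zero, prodDown_zero]
  | succ m ih =>
    have h : x * T k (m + 1) * e k = x * T k (m + 1) := by
      rw [mul_assoc, H.T_e k _ (by omega) hm]
    rw [prodUp_succ, prodDown_succ, ← mul_assoc, ← mul_assoc, ih (by omega) h, mul_assoc,
      H.T_Ti hq (by omega) hm, hx]

end Hecke

/-! ### Affine Hecke relations generated from `y_1` -/

section Affine

variable {K F : Type*} [Field K] [Ring F] [Algebra K F]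
  {q : K} {e : ℕ → F} {T Ti : ℕ → ℕ → F}

/-- Elements `y 1, …, y k` of the corner of `e k` with `y (i+1) = q T_i⁻¹ (y i) T_i⁻¹`. -/
structure ConjSeq (q : K) (e : ℕ → F) (Ti : ℕ → ℕ → F) (k : ℕ) (y : ℕ → F) : Prop where
  e_y : ∀ i, 1 ≤ i → i ≤ k → e k * y i = y i
  y_e : ∀ i, 1 ≤ i → i ≤ k → y i * e k = y i
  succ : ∀ i, 1 ≤ i → i < k → y (i + 1) = q • (Ti k i * y i * Ti k i)

/-- Only `y_1` has to be checked to lie in the corner, since each later `y_i` begins and ends with a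
`T_{i-1}⁻¹`. -/
lemma ConjSeq.of_one {k : ℕ} {y : ℕ → F} (H : HeckeSystem q e T Ti)
    (h1 : 1 ≤ k → e k * y 1 = y 1) (h2 : 1 ≤ k → y 1 * e k = y 1)
    (hs : ∀ i, 1 ≤ i → i < k → y (i + 1) = q • (Ti k i * y i * Ti k i)) :
    ConjSeq q e Ti k y where
  e_y i hi1 hi2 := by
    obtain ⟨i, rfl⟩ : ∃ j, i = j + 1 := ⟨i - 1, by omega⟩
    cases i with
    | zero => exact h1 hi2
    | succ i =>
      rw [hs _ (by omega) hi2, mul_smul_comm, ← mul_assoc, ← mul_assoc,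
        H.e_Ti (by omega) hi2]
  y_e i hi1 hi2 := by
    obtain ⟨i, rfl⟩ : ∃ j, i = j + 1 := ⟨i - 1, by omega⟩
    cases i with
    | zero => exact h2 hi2
    | succ i =>
      rw [hs _ (by omega) hi2, smul_mul_assoc, mul_assoc, H.Ti_e (by omega) hi2]
  succ := hs

lemma ConjSeq.T_y_T (H : HeckeSystem q e T Ti) (hq : q ≠ 0) {k : ℕ} {y : ℕ → F}
    (hy : ConjSeq q e Ti k y) {i : ℕ} (h1 : 1 ≤ i) (h2 : i < k) :
    T k i * y (i + 1) * T k i = q • y i :=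
  H.conj_mul hq h1 h2 (hy.e_y i h1 h2.le) (hy.y_e i h1 h2.le) (hy.succ i h1 h2)

/-- The elements commuting with `y_1` and with `T_i⁻¹` intertwine the other `y_i`. -/
lemma ConjSeq.intertwine {k l : ℕ} {y y' : ℕ → F}
    (hy : ConjSeq q e Ti k y) (hy' : ConjSeq q e Ti l y') {x : F} {r m : ℕ}
    (hx1 : 1 ≤ m → x * y 1 = y' (r + 1) * x)
    (hm : m ≤ k) (hml : m + r ≤ l)
    (hx : ∀ i, 1 ≤ i → i < m → x * Ti k i = Ti l (i + r) * x) {i : ℕ} (h1 : 1 ≤ i)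
    (h2 : i ≤ m) : x * y i = y' (i + r) * x := by
  induction i, h1 using Nat.le_induction with
  | base => rw [hx1 h2, add_comm]
  | succ i h1 ih =>
    have e1 : i + 1 + r = i + r + 1 := by omega
    rw [hy.succ i h1 (by omega), e1, hy'.succ (i + r) (by omega) (by omega), mul_smul_comm,
      smul_mul_assoc]
    congr 1
    have h := hx i h1 (by omega)
    calc x * (Ti k i * y i * Ti k i) = (x * Ti k i) * y i * Ti k i := by simp only [mul_assoc]
      _ = Ti l (i + r) * (x * y i) * Ti k i := by rw [h]; simp only [mul_assoc]
      _ = Ti l (i + r) * y' (i + r) * (x * Ti k i) := by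
        rw [ih (by omega)]; simp only [mul_assoc]
      _ = _ := by rw [h]; simp only [mul_assoc]

/-- If `i < j`, then `T_j` commutes with everything from which `y_i` is built. If `i ≥ j + 2`, the
essential case is `y_{j+2} = q² T_{j+1}⁻¹T_j⁻¹ y_j T_j⁻¹T_{j+1}⁻¹`: by the braid relation `T_j`
crosses the left factors as `T_{j+1}`, commutes with `y_j`, and leaves the right factors as `T_j`
again. -/
lemma ConjSeq.commute_T (H : HeckeSystem q e T Ti) (hq : q ≠ 0) {k : ℕ} {y : ℕ → F}
    (hy : ConjSeq q e Ti k y) (hT : ∀ j, 2 ≤ j → j < k → y 1 * T k j = T k j * y 1)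
    {i j : ℕ} (hi : 1 ≤ i ∧ i ≤ k) (hj : 1 ≤ j ∧ j < k) (hij : i ≠ j ∧ i ≠ j + 1) :
    y i * T k j = T k j * y i := by
  have HS := H.symm hq
  rcases Nat.lt_or_ge i j with h | h
  · refine (hy.intertwine (r := 0) (m := j - 1) hy (x := T k j) (fun _ => (hT j (by omega) hj.2).symm)
      (by omega) (by omega) (fun l h1 h2 => ?_) hi.1 (by omega)).symm
    exact H.T_Ti_comm' h1 (by omega) hj.2
  · obtain ⟨n, rfl⟩ : ∃ n, i = n + 2 := ⟨i - 2, by omega⟩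
    have hjn : j ≤ n := by omega
    clear h hij
    induction n, hjn using Nat.le_induction with
    | base =>
      have hj2 : j + 1 < k := by omega
      have hc : T k (j + 1) * y j = y j * T k (j + 1) :=
        hy.intertwine (r := 0) (m := j) hy (fun _ => (hT _ (by omega) hj2).symm) (by omega)
          (by omega) (fun l h1 h2 => H.T_Ti_comm' h1 (by omega) hj2) hj.1 le_rfl
      rw [hy.succ (j + 1) (by omega) hj2, hy.succ j hj.1 hj.2]
      simp only [mul_smul_comm, smul_mul_assoc]
      congr 2
      symm
      calc T k j * (Ti k (j + 1) * (Ti k j * y j * Ti k j) * Ti k (j + 1))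
          = (T k j * Ti k (j + 1) * Ti k j) * y j * Ti k j * Ti k (j + 1) := by
            simp only [mul_assoc]
        _ = Ti k (j + 1) * Ti k j * (T k (j + 1) * y j) * Ti k j * Ti k (j + 1) := by
            rw [H.T_Ti_Ti' hq hj.1 hj2]; simp only [mul_assoc]
        _ = Ti k (j + 1) * Ti k j * y j * (T k (j + 1) * Ti k j * Ti k (j + 1)) := by
            rw [hc]; simp only [mul_assoc]
        _ = _ := by rw [H.T_Ti_Ti hq hj.1 hj2]; simp only [mul_assoc]
    | succ n hn ih =>
      have h := H.T_Ti_comm (k := k) (i := j) (j := n + 2) hj.1 (by omega) (by omega)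
      -- Beyond `j + 2` the conjugating `T_{n+2}⁻¹` commutes with `T_j`, so the property is
      -- inherited.
      rw [hy.succ (n + 2) (by omega) (by omega), mul_smul_comm, smul_mul_assoc]
      congr 1
      calc Ti k (n + 2) * y (n + 2) * Ti k (n + 2) * T k j
          = Ti k (n + 2) * (y (n + 2) * T k j) * Ti k (n + 2) := by
            rw [mul_assoc, ← h]; simp only [mul_assoc]
        _ = _ := by
            rw [ih (by omega), ← mul_assoc, ← h]; simp only [mul_assoc]

/-- All commutations propagate from `y_1 y_2 = y_2 y_1`: an element that commutes with `y_n` and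
with `T_n⁻¹` commutes with `y_{n+1}`. The first index stays `1` while the second grows, and then the
first is raised. -/
lemma ConjSeq.commute (H : HeckeSystem q e T Ti) (hq : q ≠ 0) {k : ℕ} {y : ℕ → F}
    (hy : ConjSeq q e Ti k y) (hT : ∀ j, 2 ≤ j → j < k → y 1 * T k j = T k j * y 1)
    (h12 : 2 ≤ k → y 1 * y 2 = y 2 * y 1) {i j : ℕ} (hi : 1 ≤ i ∧ i ≤ k)
    (hj : 1 ≤ j ∧ j ≤ k) : y i * y j = y j * y i := by
  have hTi : ∀ {i j}, 1 ≤ i ∧ i ≤ k → 1 ≤ j ∧ j < k → i ≠ j ∧ i ≠ j + 1 →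
      y i * Ti k j = Ti k j * y i := fun {i j} hi hj hij =>
    H.intertwine hj.1 hj.2 hj.1 hj.2 (hy.commute_T H hq hT hi hj hij)
      (by rw [hy.y_e _ hi.1 hi.2, hy.e_y _ hi.1 hi.2])
  have step : ∀ {x : F} {n : ℕ}, 1 ≤ n → n < k → x * y n = y n * x → x * Ti k n = Ti k n * x →
      x * y (n + 1) = y (n + 1) * x := by
    intro x n h1 h2 hx hx'
    rw [hy.succ n h1 h2, mul_smul_comm, smul_mul_assoc]
    congr 1
    calc x * (Ti k n * y n * Ti k n) = (x * Ti k n) * y n * Ti k n := by simp only [mul_assoc]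
      _ = Ti k n * (x * y n) * Ti k n := by rw [hx']; simp only [mul_assoc]
      _ = Ti k n * y n * (x * Ti k n) := by rw [hx]; simp only [mul_assoc]
      _ = _ := by rw [hx']; simp only [mul_assoc]
  have one : ∀ j, 1 ≤ j → j ≤ k → y 1 * y j = y j * y 1 := by
    intro j h1
    induction j, h1 using Nat.le_induction with
    | base => intro _; rfl
    | succ j h1 ih =>
      intro h2
      rcases eq_or_ne j 1 with rfl | h3
      · exact h12 h2
      · exact step h1 h2 (ih (by omega)) (hTi ⟨le_rfl, by omega⟩ ⟨h1, h2⟩ ⟨by omega, by omega⟩)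
  have lt : ∀ i, 1 ≤ i → ∀ j, i < j → j ≤ k → y j * y i = y i * y j := by
    intro i h1
    induction i, h1 using Nat.le_induction with
    | base => intro j h1 h2; exact (one j (by omega) h2).symm
    | succ i h1 ih =>
      intro j h2 h3
      exact step h1 (by omega) (ih j (by omega) h3)
        (hTi ⟨by omega, h3⟩ ⟨h1, by omega⟩ ⟨by omega, by omega⟩)
  rcases lt_trichotomy i j with h | rfl | h
  · exact (lt i hi.1 j h hj.2).symm
  · rfl
  · exact lt j hj.1 i h hi.2

/-- Each letter contributes `T_i y_{i+1} = q y_i T_i⁻¹`, which lowers the index of `y` by one. -/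
lemma ConjSeq.prodUp_mul (H : HeckeSystem q e T Ti) (hq : q ≠ 0) {k : ℕ} {y : ℕ → F}
    (hy : ConjSeq q e Ti k y) {m : ℕ} (hm : m < k) :
    prodUp (T k) m * y (m + 1) = q ^ m • (y 1 * prodUp (Ti k) m) := by
  induction m with
  | zero => simp [prodUp_zero]
  | succ m ih =>
    rw [prodUp_succ, prodUp_succ, mul_assoc,
      H.T_mul_conj hq (by omega) hm (hy.e_y _ (by omega) (by omega)) (hy.succ _ (by omega) hm),
      mul_smul_comm, ← mul_assoc, ih (by omega), smul_mul_assoc, smul_smul, mul_assoc, pow_succ']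

end Affine

/-! ### The algebra `𝔸_q` presented without the `y_i` -/

section Dyck

variable {K F : Type*} [Field K] [Ring F] [Algebra K F]

/-- `(q - 1)⁻¹ (d_+ d_- - d_- d_+)` at vertex `n + 1`. -/
def phiOf (q : K) (dp dm : ℕ → F) (n : ℕ) : F :=
  (q - 1)⁻¹ • (dp n * dm n - dm (n + 1) * dp (n + 1))

/-- The presentation of `𝔸_q` without the `y_i`. -/
structure DyckSystem (q : K) (e dp dm : ℕ → F) (T Ti : ℕ → ℕ → F) : Prop
    extends HeckeSystem q e T Ti where
  e_dp : ∀ k, e (k + 1) * dp k = dp k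
  dp_e : ∀ k, dp k * e k = dp k
  e_dm : ∀ k, e k * dm k = dm k
  dm_e : ∀ k, dm k * e (k + 1) = dm k
  dm_dm_T : ∀ n, dm n * dm (n + 1) * T (n + 2) (n + 1) = dm n * dm (n + 1)
  dm_T : ∀ k i, 1 ≤ i → i < k → dm k * T (k + 1) i = T k i * dm k
  T_dp_dp : ∀ k, T (k + 2) 1 * dp (k + 1) * dp k = dp (k + 1) * dp k
  dp_T : ∀ k i, 1 ≤ i → i < k → dp k * T k i = T (k + 1) (i + 1) * dp k
  phi_dm : ∀ n, q • (phiOf q dp dm n * dm (n + 1))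
    = dm (n + 1) * phiOf q dp dm (n + 1) * T (n + 2) (n + 1)
  phi_dp : ∀ n, T (n + 2) 1 * phiOf q dp dm (n + 1) * dp (n + 1)
    = q • (dp (n + 1) * phiOf q dp dm n)

variable {q : K} {e dp dm : ℕ → F} {T Ti : ℕ → ℕ → F}

lemma DyckSystem.dm_Ti (D : DyckSystem q e dp dm T Ti) {k i : ℕ} (h1 : 1 ≤ i) (h2 : i < k) :
    dm k * Ti (k + 1) i = Ti k i * dm k :=
  D.intertwine h1 (by omega) h1 h2 (D.dm_T k i h1 h2) (by rw [D.dm_e, D.e_dm])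

lemma DyckSystem.dp_Ti (D : DyckSystem q e dp dm T Ti) {k i : ℕ} (h1 : 1 ≤ i) (h2 : i < k) :
    dp k * Ti k i = Ti (k + 1) (i + 1) * dp k :=
  D.intertwine h1 h2 (by omega) (by omega) (D.dp_T k i h1 h2) (by rw [D.dp_e, D.e_dp])

lemma phiOf_e (dp_e : ∀ k, dp k * e k = dp k) (dm_e : ∀ k, dm k * e (k + 1) = dm k) (n : ℕ) :
    phiOf q dp dm n * e (n + 1) = phiOf q dp dm n := by
  rw [phiOf, smul_mul_assoc, sub_mul, mul_assoc, mul_assoc, dp_e, dm_e]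

lemma e_phiOf (e_dp : ∀ k, e (k + 1) * dp k = dp k) (e_dm : ∀ k, e k * dm k = dm k) (n : ℕ) :
    e (n + 1) * phiOf q dp dm n = phiOf q dp dm n := by
  rw [phiOf, mul_smul_comm, mul_sub, ← mul_assoc, ← mul_assoc, e_dp, e_dm]

/-- In both products `d_-` keeps the index of `T` and `d_+` raises it by one. Only these two
relations are assumed, so the lemma also applies to `d_+^*` together with `T` in place of `T⁻¹`. -/
lemma phiOf_mul_T (dm_T : ∀ k i, 1 ≤ i → i < k → dm k * T (k + 1) i = T k i * dm k)
    (dp_T : ∀ k i, 1 ≤ i → i < k → dp k * T k i = T (k + 1) (i + 1) * dp k) {n i : ℕ}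
    (h1 : 1 ≤ i) (h2 : i < n) :
    phiOf q dp dm n * T (n + 1) i = T (n + 1) (i + 1) * phiOf q dp dm n := by
  rw [phiOf, smul_mul_assoc, mul_smul_comm, sub_mul, mul_sub]
  congr 2
  · rw [mul_assoc, dm_T n i h1 h2, ← mul_assoc, dp_T n i h1 h2, mul_assoc]
  · rw [mul_assoc, dp_T (n + 1) i h1 (by omega), ← mul_assoc,
      dm_T (n + 1) (i + 1) (by omega) (by omega), mul_assoc]

lemma sub_one_smul_phiOf (hq1 : q ≠ 1) (n : ℕ) :
    (q - 1) • phiOf q dp dm n = dp n * dm n - dm (n + 1) * dp (n + 1) := by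
  rw [phiOf, smul_smul, mul_inv_cancel₀ (sub_ne_zero.mpr hq1), one_smul]

lemma DyckSystem.e_phi (D : DyckSystem q e dp dm T Ti) (n : ℕ) :
    e (n + 1) * phiOf q dp dm n = phiOf q dp dm n := e_phiOf D.e_dp D.e_dm n

lemma DyckSystem.phi_e (D : DyckSystem q e dp dm T Ti) (n : ℕ) :
    phiOf q dp dm n * e (n + 1) = phiOf q dp dm n := phiOf_e D.dp_e D.dm_e n

lemma DyckSystem.phi_T (D : DyckSystem q e dp dm T Ti) {n i : ℕ} (h1 : 1 ≤ i) (h2 : i < n) :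
    phiOf q dp dm n * T (n + 1) i = T (n + 1) (i + 1) * phiOf q dp dm n :=
  phiOf_mul_T D.dm_T D.dp_T h1 h2

/-- `φ² T_{k-1} = T_1 φ²`. -/
lemma DyckSystem.phi_sq_mul_T (D : DyckSystem q e dp dm T Ti) (hq : q ≠ 0) (hq1 : q ≠ 1)
    (n : ℕ) :
    phiOf q dp dm (n + 1) * phiOf q dp dm (n + 1) * T (n + 2) (n + 1)
      = T (n + 2) 1 * (phiOf q dp dm (n + 1) * phiOf q dp dm (n + 1)) := by
  have hs := sub_one_smul_phiOf (dp := dp) (dm := dm) hq1 (n + 1)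
  -- Both parts of the commutator are carried past `φ` separately; each uses `phi_dm` and `phi_dp`
  -- once, and their factors `q` and `q⁻¹` cancel.
  have h1 : dp (n + 1) * dm (n + 1) * phiOf q dp dm (n + 1) * T (n + 2) (n + 1)
      = T (n + 2) 1 * phiOf q dp dm (n + 1) * (dp (n + 1) * dm (n + 1)) := by
    calc _ = dp (n + 1) * (dm (n + 1) * phiOf q dp dm (n + 1) * T (n + 2) (n + 1)) := by
          simp only [mul_assoc]
      _ = q • (dp (n + 1) * phiOf q dp dm n) * dm (n + 1) := by
          rw [← D.phi_dm, mul_smul_comm, smul_mul_assoc, mul_assoc]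
      _ = _ := by rw [← D.phi_dp, mul_assoc]
  have h2 : dm (n + 2) * dp (n + 2) * phiOf q dp dm (n + 1) * T (n + 2) (n + 1)
      = T (n + 2) 1 * phiOf q dp dm (n + 1) * (dm (n + 2) * dp (n + 2)) := by
    have e1 : dp (n + 2) * phiOf q dp dm (n + 1)
        = q⁻¹ • (T (n + 3) 1 * phiOf q dp dm (n + 2) * dp (n + 2)) := by
      rw [D.phi_dp, smul_smul, inv_mul_cancel₀ hq, one_smul]
    have e2 : dm (n + 2) * phiOf q dp dm (n + 2) * T (n + 3) (n + 2)
        = q • (phiOf q dp dm (n + 1) * dm (n + 2)) := (D.phi_dm _).symm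
    calc _ = dm (n + 2) * (dp (n + 2) * phiOf q dp dm (n + 1)) * T (n + 2) (n + 1) := by
          simp only [mul_assoc]
      _ = q⁻¹ • ((dm (n + 2) * T (n + 3) 1) * phiOf q dp dm (n + 2)
            * (dp (n + 2) * T (n + 2) (n + 1))) := by
          rw [e1, mul_smul_comm, smul_mul_assoc]; simp only [mul_assoc]
      _ = q⁻¹ • (T (n + 2) 1 * (dm (n + 2) * phiOf q dp dm (n + 2) * T (n + 3) (n + 2))
            * dp (n + 2)) := by
          rw [D.dm_T _ 1 le_rfl (by omega), D.dp_T _ (n + 1) (by omega) (by omega)]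
          simp only [mul_assoc]
      _ = _ := by
          rw [e2, mul_smul_comm, smul_mul_assoc, smul_smul, inv_mul_cancel₀ hq, one_smul]
          simp only [mul_assoc]
  have h3 : (q - 1) • (phiOf q dp dm (n + 1) * phiOf q dp dm (n + 1) * T (n + 2) (n + 1))
      = (q - 1) • (T (n + 2) 1 * (phiOf q dp dm (n + 1) * phiOf q dp dm (n + 1))) := by
    rw [mul_assoc, ← smul_mul_assoc, hs, sub_mul, ← mul_assoc, ← mul_assoc, h1, h2, ← mul_sub,
      ← hs, mul_smul_comm, mul_assoc]
  exact smul_right_injective F (sub_ne_zero.mpr hq1) h3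

/-- The family `y k i` of the presentation with the `y_i`, in terms of `φ`. -/
structure IsYFamily (q : K) (dp dm : ℕ → F) (T Ti : ℕ → ℕ → F) (y : ℕ → ℕ → F) : Prop where
  one : ∀ n, y (n + 1) 1 = (q ^ n)⁻¹ • (phiOf q dp dm n * prodDown (T (n + 1)) n)
  succ : ∀ k i, 1 ≤ i → i < k → y k (i + 1) = q • (Ti k i * y k i * Ti k i)

variable {y : ℕ → ℕ → F}

lemma DyckSystem.conjSeq (D : DyckSystem q e dp dm T Ti) (hY : IsYFamily q dp dm T Ti y) (k : ℕ) :
    ConjSeq q e Ti k (y k) := by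
  refine ConjSeq.of_one D.toHeckeSystem (fun h => ?_) (fun h => ?_) (hY.succ k)
  · obtain ⟨n, rfl⟩ : ∃ n, k = n + 1 := ⟨k - 1, by omega⟩
    rw [hY.one, mul_smul_comm, ← mul_assoc, D.e_phi]
  · obtain ⟨n, rfl⟩ : ∃ n, k = n + 1 := ⟨k - 1, by omega⟩
    rw [hY.one, smul_mul_assoc, mul_assoc, ← D.commute_e_prodDown (Nat.lt_succ_self n),
      ← mul_assoc, D.phi_e]

/-- Up to a scalar `y_1 = φ T_{k-1} ⋯ T_1`; the index of `T_j` drops by one in crossing the word and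
rises by one in crossing `φ`. -/
lemma DyckSystem.y_one_mul_T (D : DyckSystem q e dp dm T Ti) (hY : IsYFamily q dp dm T Ti y)
    {k j : ℕ} (h1 : 2 ≤ j) (h2 : j < k) : y k 1 * T k j = T k j * y k 1 := by
  obtain ⟨n, rfl⟩ : ∃ n, k = n + 1 := ⟨k - 1, by omega⟩
  obtain ⟨j, rfl⟩ : ∃ i, j = i + 1 := ⟨j - 1, by omega⟩
  rw [hY.one, smul_mul_assoc, mul_smul_comm, mul_assoc,
    ← (D.braidSeq _).mul_prodDown (Nat.lt_succ_self n) (by omega) (by omega), ← mul_assoc,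
    D.phi_T (by omega) (by omega), mul_assoc]

/-- With `P = φ` and `D' = T_{k-1} ⋯ T_2`, up to scalars `y_1 = P D' T_1` and `y_2 = T_1⁻¹ P D'`.
They commute as soon as `T_1` commutes with `(P D')² = P² (T_{k-2} ⋯ T_1) D'`, which follows from
`P² T_{k-1} = T_1 P²` and a braid word identity. -/
lemma DyckSystem.y_one_mul_y_two (D : DyckSystem q e dp dm T Ti)
    (hY : IsYFamily q dp dm T Ti y) (hq : q ≠ 0) (hq1 : q ≠ 1) {k : ℕ} (h : 2 ≤ k) :
    y k 1 * y k 2 = y k 2 * y k 1 := by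
  obtain ⟨n, rfl⟩ : ∃ n, k = n + 2 := ⟨k - 2, by omega⟩
  have hlt : 1 < n + 2 := by omega
  set P := phiOf q dp dm (n + 1) with hP
  set D' := prodDown (fun j => T (n + 2) (j + 1)) n with hD'
  have hDn : prodDown (T (n + 2)) (n + 1) = D' * T (n + 2) 1 := prodDown_succ' _ _
  have hPe : P * e (n + 2) = P := D.phi_e (n + 1)
  have hDe : D' * e (n + 2) = e (n + 2) * D' :=
    (mul_prodDown_of_intertwine fun j h1 h2 => by
      rw [D.e_T _ _ (by omega) (by omega), D.T_e _ _ (by omega) (by omega)]).symm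
  have hPDe : P * D' * e (n + 2) = P * D' := by rw [mul_assoc, hDe, ← mul_assoc, hPe]
  have ePD : e (n + 2) * (P * D') = P * D' := by rw [← mul_assoc, D.e_phi]
  have hDP : D' * P = P * prodDown (T (n + 2)) n :=
    (mul_prodDown_of_intertwine fun j h1 h2 => D.phi_T h1 (by omega)).symm
  have hsq : T (n + 2) 1 * ((P * D') * (P * D')) = (P * D') * (P * D') * T (n + 2) 1 := by
    have e1 : (P * D') * (P * D') = P * P * (prodDown (T (n + 2)) n * D') := by
      calc _ = P * (D' * P) * D' := by simp only [mul_assoc]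
        _ = _ := by rw [hDP]; simp only [mul_assoc]
    rw [e1, ← mul_assoc, ← D.phi_sq_mul_T hq hq1]
    calc P * P * T (n + 2) (n + 1) * (prodDown (T (n + 2)) n * D')
        = P * P * (prodDown (T (n + 2)) (n + 1) * D') := by
          rw [prodDown_succ]; simp only [mul_assoc]
      _ = P * P * (prodDown (T (n + 2)) n * (D' * T (n + 2) 1)) := by
          rw [hD', ← (D.braidSeq _).prodDown_mul_prodDown (Nat.lt_succ_self _)
            (Nat.lt_succ_self _), hDn]
      _ = _ := by simp only [mul_assoc]
  have hy1 : y (n + 2) 1 = (q ^ (n + 1))⁻¹ • (P * D' * T (n + 2) 1) := by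
    rw [hY.one, hDn, mul_assoc]
  have hy2 : y (n + 2) 2 = (q * (q ^ (n + 1))⁻¹) • (Ti (n + 2) 1 * (P * D')) := by
    rw [hY.succ _ 1 le_rfl hlt, hy1, mul_smul_comm, smul_mul_assoc, smul_smul, mul_assoc,
      mul_assoc, D.T_Ti hq le_rfl hlt, hPDe]
  have h12 : P * D' * T (n + 2) 1 * (Ti (n + 2) 1 * (P * D'))
      = Ti (n + 2) 1 * (P * D') * (P * D' * T (n + 2) 1) := by
    calc _ = P * D' * (T (n + 2) 1 * Ti (n + 2) 1) * (P * D') := by simp only [mul_assoc]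
      _ = e (n + 2) * (P * D' * (P * D')) := by
          rw [D.T_Ti hq le_rfl hlt, hPDe, ← mul_assoc (e _), ePD]
      _ = Ti (n + 2) 1 * (T (n + 2) 1 * (P * D' * (P * D'))) := by
          rw [← mul_assoc (Ti _ _), D.Ti_T hq le_rfl hlt]
      _ = _ := by rw [hsq]; simp only [mul_assoc]
  rw [hy1, hy2, smul_mul_smul_comm, smul_mul_smul_comm, h12, mul_comm (q * _)]

/-- `T_1 ⋯ T_{k-1} y_k = φ`. -/
lemma DyckSystem.prodUp_mul_y (D : DyckSystem q e dp dm T Ti) (hY : IsYFamily q dp dm T Ti y)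
    (hq : q ≠ 0) (n : ℕ) : prodUp (T (n + 1)) n * y (n + 1) (n + 1) = phiOf q dp dm n := by
  rw [(D.conjSeq hY (n + 1)).prodUp_mul D.toHeckeSystem hq (Nat.lt_succ_self n), hY.one,
    smul_mul_assoc, smul_smul, mul_inv_cancel₀ (pow_ne_zero n hq), one_smul,
    D.mul_prodDown_mul_prodUp_inv hq (Nat.lt_succ_self n) (D.phi_e n)]

/-- Since `d_-` intertwines the `T_i⁻¹`, only `y_1` matters, and there the claim is the relation `q
φ d_- = d_- φ T_{k-1}` multiplied by a word in the `T_i`. -/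
lemma DyckSystem.dm_y (D : DyckSystem q e dp dm T Ti) (hY : IsYFamily q dp dm T Ti y)
    (hq : q ≠ 0) {k i : ℕ} (h1 : 1 ≤ i) (h2 : i ≤ k) :
    dm k * y (k + 1) i = y k i * dm k := by
  refine (D.conjSeq hY (k + 1)).intertwine (r := 0) (m := k) (D.conjSeq hY k) (fun h => ?_)
    (by omega) (by omega) (fun i h1 h2 => D.dm_Ti h1 h2) h1 h2
  obtain ⟨n, rfl⟩ : ∃ n, k = n + 1 := ⟨k - 1, by omega⟩
  rw [hY.one, hY.one, prodDown_succ, mul_smul_comm, smul_mul_assoc, ← mul_assoc, ← mul_assoc,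
    ← D.phi_dm, smul_mul_assoc, smul_smul, mul_assoc,
    mul_prodDown_of_intertwine (x' := T (n + 1)) fun j h1 h2 => D.dm_T (n + 1) j h1 (by omega),
    mul_assoc]
  congr 1
  field_simp
  ring

/-- For `i = 1` this is `T_1 φ d_+ = q d_+ φ` in disguise. The induction conjugates by `T_i⁻¹`,
which `d_+` turns into `T_{i+1}⁻¹`. -/
lemma DyckSystem.dp_y (D : DyckSystem q e dp dm T Ti) (hY : IsYFamily q dp dm T Ti y)
    (hq : q ≠ 0) {k i : ℕ} (h1 : 1 ≤ i) (h2 : i ≤ k) :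
    dp k * y k i
      = prodUp (T (k + 1)) i * y (k + 1) i * prodDown (Ti (k + 1)) i * dp k := by
  have H := D.toHeckeSystem
  induction i, h1 using Nat.le_induction with
  | base =>
    obtain ⟨n, rfl⟩ : ∃ n, k = n + 1 := ⟨k - 1, by omega⟩
    have hU : prodUp (T (n + 1 + 1)) 1 = T (n + 2) 1 := by simp [prodUp]
    have hD : prodDown (Ti (n + 1 + 1)) 1 = Ti (n + 2) 1 := by simp [prodDown]
    rw [hU, hD, hY.one, hY.one, prodDown_succ']
    have e1 : dp (n + 1) * phiOf q dp dm n
        = q⁻¹ • (T (n + 2) 1 * phiOf q dp dm (n + 1) * dp (n + 1)) := by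
      rw [D.phi_dp, smul_smul, inv_mul_cancel₀ hq, one_smul]
    have e2 : dp (n + 1) * prodDown (T (n + 1)) n
        = prodDown (fun j => T (n + 1 + 1) (j + 1)) n * dp (n + 1) :=
      mul_prodDown_of_intertwine fun j h1 h2 => D.dp_T (n + 1) j h1 (by omega)
    have e3 : T (n + 1 + 1) 1 * (Ti (n + 2) 1 * dp (n + 1)) = dp (n + 1) := by
      rw [← mul_assoc, H.T_Ti hq le_rfl (by omega), D.e_dp]
    calc _ = (q ^ n)⁻¹ • (dp (n + 1) * phiOf q dp dm n * prodDown (T (n + 1)) n) := by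
          rw [mul_smul_comm, mul_assoc]
      _ = ((q ^ n)⁻¹ * q⁻¹) • (T (n + 2) 1 * phiOf q dp dm (n + 1)
            * (dp (n + 1) * prodDown (T (n + 1)) n)) := by
          rw [e1, smul_mul_assoc, smul_smul, mul_assoc]
      _ = ((q ^ n)⁻¹ * q⁻¹) • (T (n + 2) 1 * phiOf q dp dm (n + 1)
            * (prodDown (fun j => T (n + 1 + 1) (j + 1)) n
              * (T (n + 1 + 1) 1 * (Ti (n + 2) 1 * dp (n + 1))))) := by rw [e2, e3]
      _ = _ := by
          rw [pow_succ, mul_inv]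
          simp only [mul_smul_comm, smul_mul_assoc, mul_assoc]
  | succ i h1 ih =>
    have C := D.conjSeq hY (k + 1)
    have Ck := D.conjSeq hY k
    obtain ⟨j, rfl⟩ : ∃ j, i = j + 1 := ⟨i - 1, by omega⟩
    have hj : j + 1 < k + 1 := by omega
    have hj2 : j + 1 + 1 < k + 1 := by omega
    have c1 : T (k + 1) (j + 1 + 1) * y (k + 1) (j + 1) = y (k + 1) (j + 1) * T (k + 1) (j + 1 + 1) :=
      (C.commute_T H hq (fun _ h1 h2 => D.y_one_mul_T hY h1 h2) ⟨h1, by omega⟩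
        ⟨by omega, hj2⟩ ⟨by omega, by omega⟩).symm
    have c2 : prodUp (T (k + 1)) j * Ti (k + 1) (j + 1 + 1)
        = Ti (k + 1) (j + 1 + 1) * prodUp (T (k + 1)) j :=
      (mul_prodUp_of_intertwine fun l h1 h2 =>
        (H.T_Ti_comm h1 (by omega) hj2).symm).symm
    have c3 : Ti (k + 1) (j + 1 + 1) * prodDown (Ti (k + 1)) j
        = prodDown (Ti (k + 1)) j * Ti (k + 1) (j + 1 + 1) :=
      ((H.symm hq).braidSeq _).comm_prodDown (by omega) hj2
    have b1 := H.T_T_Ti hq h1 hj2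
    have b2 := H.T_Ti_Ti hq h1 hj2
    -- Conjugating the formula for one index by the next `T⁻¹` gives the formula for the following
    -- index: the braid relation `b1` brings `T_{j+2}⁻¹` to the left, `T_{j+2}` passes `y_{j+1}`,
    -- and `b2` together with `c3` restores the right half.
    have key : q • (Ti (k + 1) (j + 1 + 1) * (prodUp (T (k + 1)) (j + 1) * y (k + 1) (j + 1)
          * prodDown (Ti (k + 1)) (j + 1)) * Ti (k + 1) (j + 1 + 1))
        = prodUp (T (k + 1)) (j + 1 + 1) * y (k + 1) (j + 1 + 1)
          * prodDown (Ti (k + 1)) (j + 1 + 1) := by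
      rw [prodUp_succ _ (j + 1), prodDown_succ _ (j + 1), C.succ (j + 1) h1 hj, prodUp_succ,
        prodDown_succ]
      simp only [mul_smul_comm, smul_mul_assoc]
      congr 1
      generalize y (k + 1) (j + 1) = Y at c1 ⊢
      symm
      calc _ = prodUp (T (k + 1)) j * (T (k + 1) (j + 1) * T (k + 1) (j + 1 + 1)
            * Ti (k + 1) (j + 1)) * Y * (Ti (k + 1) (j + 1) * Ti (k + 1) (j + 1 + 1))
            * (Ti (k + 1) (j + 1) * prodDown (Ti (k + 1)) j) := by simp only [mul_assoc]
        _ = (prodUp (T (k + 1)) j * Ti (k + 1) (j + 1 + 1)) * T (k + 1) (j + 1)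
            * (T (k + 1) (j + 1 + 1) * Y) * (Ti (k + 1) (j + 1) * Ti (k + 1) (j + 1 + 1))
            * (Ti (k + 1) (j + 1) * prodDown (Ti (k + 1)) j) := by
          rw [b1]; simp only [mul_assoc]
        _ = Ti (k + 1) (j + 1 + 1) * prodUp (T (k + 1)) j * T (k + 1) (j + 1) * Y
            * (T (k + 1) (j + 1 + 1) * Ti (k + 1) (j + 1) * Ti (k + 1) (j + 1 + 1))
            * (Ti (k + 1) (j + 1) * prodDown (Ti (k + 1)) j) := by
          rw [c2, c1]; simp only [mul_assoc]
        _ = Ti (k + 1) (j + 1 + 1) * prodUp (T (k + 1)) j * T (k + 1) (j + 1) * Y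
            * Ti (k + 1) (j + 1) * (Ti (k + 1) (j + 1 + 1) * (T (k + 1) (j + 1)
            * Ti (k + 1) (j + 1))) * prodDown (Ti (k + 1)) j := by
          rw [b2]; simp only [mul_assoc]
        _ = _ := by
          rw [H.T_Ti hq h1 hj, H.Ti_e (by omega) hj2, mul_assoc _ _ (prodDown _ j), c3]
          simp only [mul_assoc]
    rw [Ck.succ (j + 1) h1 (by omega), ← key, mul_smul_comm, smul_mul_assoc]
    congr 1
    calc dp k * (Ti k (j + 1) * y k (j + 1) * Ti k (j + 1))
        = (dp k * Ti k (j + 1)) * y k (j + 1) * Ti k (j + 1) := by simp only [mul_assoc]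
      _ = Ti (k + 1) (j + 1 + 1) * (dp k * y k (j + 1)) * Ti k (j + 1) := by
          rw [D.dp_Ti h1 (by omega)]; simp only [mul_assoc]
      _ = Ti (k + 1) (j + 1 + 1) * (prodUp (T (k + 1)) (j + 1) * y (k + 1) (j + 1)
            * prodDown (Ti (k + 1)) (j + 1)) * (dp k * Ti k (j + 1)) := by
          rw [ih (by omega)]; simp only [mul_assoc]
      _ = _ := by rw [D.dp_Ti h1 (by omega)]; simp only [mul_assoc]

lemma HeckeSystem.hecke {q : K} {e : ℕ → F} {T Ti : ℕ → ℕ → F} (H : HeckeSystem q e T Ti)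
    {k i : ℕ} (h1 : 1 ≤ i) (h2 : i < k) :
    (T k i - e k) * (T k i + q • e k) = 0 := by
  rw [sub_mul, mul_add, mul_add, mul_smul_comm, mul_smul_comm, H.e_T k i h1 h2, H.T_e k i h1 h2,
    H.e_e, H.T_T k i h1 h2]
  module

/-- The presentation of `𝔸_q` without the `y_i` implies the relations of `𝔸_q`. -/
theorem DyckSystem.aqRel (D : DyckSystem q e dp dm T Ti) (hY : IsYFamily q dp dm T Ti y)
    (hq : q ≠ 0) (hq1 : q ≠ 1) {a b : F} (h : AqRel q e dp dm T Ti y a b) : a = b := by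
  have H := D.toHeckeSystem
  have hT : ∀ k j, 2 ≤ j → j < k → y k 1 * T k j = T k j * y k 1 := fun _ _ h1 h2 =>
    D.y_one_mul_T hY h1 h2
  cases h with
  | hecke k i h => exact H.hecke h.1 h.2
  | braid k i h => exact (H.braidSeq k).braid i h.1 h.2
  | T_comm k i j h => exact (H.braidSeq k).comm i j h.1 h.2.1 h.2.2
  | T_y_T k i h => exact (D.conjSeq hY k).T_y_T H hq h.1 h.2
  | y_T k i j hi hj hij => exact (D.conjSeq hY k).commute_T H hq (hT k) hi hj hij
  | y_comm k i j hi hj =>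
    exact (D.conjSeq hY k).commute H hq (hT k) (D.y_one_mul_y_two hY hq hq1) hi hj
  | dm_dm_T n => exact D.dm_dm_T n
  | dm_T k i h => exact D.dm_T k i h.1 h.2
  | dm_y k i h => exact D.dm_y hY hq h.1 h.2
  | T_dp_dp k => exact D.T_dp_dp k
  | dp_T k i h => exact D.dp_T k i h.1 h.2
  | dp_y k i h => exact D.dp_y hY hq h.1 h.2
  | commutator n => rw [D.prodUp_mul_y hY hq, sub_one_smul_phiOf hq1]

end Dyck

/-! ### The relations of `𝔸_{q,t}` inside `𝔹_{q,t}` -/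

section BSystem

variable {K F : Type*} [Field K] [Ring F] [Algebra K F]

/-- The relations of `𝔹_{q,t}`. -/
structure BSystem (q t : K) (e dp dm : ℕ → F) (T Ti z : ℕ → ℕ → F) : Prop
    extends DyckSystem q e dp dm T Ti where
  e_z : ∀ k i, 1 ≤ i → i ≤ k → e k * z k i = z k i
  z_e : ∀ k i, 1 ≤ i → i ≤ k → z k i * e k = z k i
  T_z_T : ∀ k i, 1 ≤ i → i < k → Ti k i * z k (i + 1) * Ti k i = q⁻¹ • z k i
  z_T : ∀ k i j, 1 ≤ i ∧ i ≤ k → 1 ≤ j ∧ j < k → i ≠ j ∧ i ≠ j + 1 →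
    z k i * T k j = T k j * z k i
  z_comm : ∀ k i j, 1 ≤ i ∧ i ≤ k → 1 ≤ j ∧ j ≤ k → z k i * z k j = z k j * z k i
  z_dm : ∀ k i, 1 ≤ i → i ≤ k → z k i * dm k = dm k * z (k + 1) i
  dp_z : ∀ k i, 1 ≤ i → i ≤ k → dp k * z k i = z (k + 1) (i + 1) * dp k
  z_comm_z : ∀ n, z (n + 1) 1 * (q • (dp n * dm n) - dm (n + 1) * dp (n + 1))
    = (q * t) • ((dp n * dm n - dm (n + 1) * dp (n + 1)) * z (n + 1) (n + 1))

variable {q t : K} {e dp dm : ℕ → F} {T Ti z y : ℕ → ℕ → F}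

lemma BSystem.conjSeq_z (S : BSystem q t e dp dm T Ti z) (hq : q ≠ 0) (k : ℕ) :
    ConjSeq q⁻¹ e T k (z k) where
  e_y := S.e_z k
  y_e := S.z_e k
  succ i h1 h2 := (S.toHeckeSystem.symm hq).eq_smul_conj (inv_ne_zero hq) h1 h2
    (S.e_z k _ (by omega) h2) (S.z_e k _ (by omega) h2) (S.T_z_T k i h1 h2)

lemma BSystem.z_Ti (S : BSystem q t e dp dm T Ti z) {k i j : ℕ} (hi : 1 ≤ i ∧ i ≤ k)
    (hj : 1 ≤ j ∧ j < k) (hij : i ≠ j ∧ i ≠ j + 1) : z k i * Ti k j = Ti k j * z k i :=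
  S.toHeckeSystem.intertwine hj.1 hj.2 hj.1 hj.2 (S.z_T k i j hi hj hij)
    (by rw [S.z_e k i hi.1 hi.2, S.e_z k i hi.1 hi.2])

/-- `z_i T_i = q T_i⁻¹ z_{i+1}`. -/
lemma BSystem.z_mul_T (S : BSystem q t e dp dm T Ti z) (hq : q ≠ 0) {k i : ℕ} (h1 : 1 ≤ i)
    (h2 : i < k) : z k i * T k i = q • (Ti k i * z k (i + 1)) := by
  rw [(S.toHeckeSystem.symm hq).T_mul_conj (inv_ne_zero hq) h1 h2 (S.e_z k i h1 h2.le)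
    ((S.conjSeq_z hq k).succ i h1 h2), smul_smul, mul_inv_cancel₀ hq, one_smul]

/-- `z_{i+1} T_i⁻¹ = q⁻¹ T_i z_i`. -/
lemma BSystem.z_succ_mul_Ti (S : BSystem q t e dp dm T Ti z) (hq : q ≠ 0) {k i : ℕ} (h1 : 1 ≤ i)
    (h2 : i < k) : z k (i + 1) * Ti k i = q⁻¹ • (T k i * z k i) :=
  (S.toHeckeSystem.symm hq).conj_mul_T (inv_ne_zero hq) h1 h2 (S.z_e k i h1 h2.le)
    ((S.conjSeq_z hq k).succ i h1 h2)

/-- The element `q^{-k} z_1 d_+`. -/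
def starOf (q : K) (dp : ℕ → F) (z : ℕ → ℕ → F) (k : ℕ) : F :=
  (q ^ k)⁻¹ • (z (k + 1) 1 * dp k)

/-- As with `T_i`, the factor `d_-` keeps the index of `z` and `d_+` raises it. -/
lemma BSystem.phi_z (S : BSystem q t e dp dm T Ti z) {n i : ℕ} (h1 : 1 ≤ i) (h2 : i ≤ n) :
    phiOf q dp dm n * z (n + 1) i = z (n + 1) (i + 1) * phiOf q dp dm n := by
  rw [phiOf, smul_mul_assoc, mul_smul_comm, sub_mul, mul_sub]
  congr 2
  · rw [mul_assoc, ← S.z_dm n i h1 h2, ← mul_assoc, S.dp_z n i h1 h2, mul_assoc]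
  · rw [mul_assoc, S.dp_z (n + 1) i h1 (by omega), ← mul_assoc,
      ← S.z_dm (n + 1) (i + 1) (by omega) (by omega), mul_assoc]

/-- The powers `q^{-k}` at neighbouring vertices differ by a factor `q`. After `z_1` is pulled in
front of `d_-`, the commutator is therefore a multiple of `z_1(q d_+d_- - d_-d_+)`, the left side of
the last relation of `𝔹_{q,t}`. This is what that relation is for. -/
lemma BSystem.phiOf_star (S : BSystem q t e dp dm T Ti z) (hq : q ≠ 0) (hq1 : q ≠ 1) (n : ℕ) :
    phiOf q⁻¹ (starOf q dp z) dm n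
      = (-(q * t) * (q ^ n)⁻¹) • (phiOf q dp dm n * z (n + 1) (n + 1)) := by
  have h : starOf q dp z n * dm n - dm (n + 1) * starOf q dp z (n + 1)
      = (q ^ (n + 1))⁻¹ • (z (n + 1) 1 * (q • (dp n * dm n) - dm (n + 1) * dp (n + 1))) := by
    rw [starOf, starOf, mul_smul_comm, smul_mul_assoc, ← mul_assoc (dm _),
      ← S.z_dm (n + 1) 1 le_rfl (by omega), mul_sub, mul_smul_comm, mul_assoc, mul_assoc]
    match_scalars <;> field_simp
    ring
  have hq' := sub_ne_zero.mpr hq1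
  have hq'' : q⁻¹ - 1 ≠ 0 := sub_ne_zero.mpr fun h => hq1 (inv_eq_one.mp h)
  rw [phiOf, h, S.z_comm_z, ← sub_one_smul_phiOf hq1]
  simp only [smul_mul_assoc, smul_smul]
  congr 1
  have : q⁻¹ - 1 = -((q - 1) * q⁻¹) := by field_simp; ring
  rw [this]
  field_simp
  ring

/-- The elements `q^{-k} z_1 d_+`, `d_-`, `T_i⁻¹` satisfy the relations of `𝔸_{q⁻¹}`. -/
lemma BSystem.dyckSystem_star (S : BSystem q t e dp dm T Ti z) (hq : q ≠ 0) (hq1 : q ≠ 1) :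
    DyckSystem q⁻¹ e (starOf q dp z) dm Ti T := by
  have H := S.toHeckeSystem
  have H' := H.symm hq
  refine { H' with
    e_dp := fun k => ?_, dp_e := fun k => ?_, e_dm := S.e_dm, dm_e := S.dm_e,
    dm_dm_T := fun n => ?_, dm_T := fun k i h1 h2 => S.dm_Ti h1 h2, T_dp_dp := fun k => ?_,
    dp_T := fun k i h1 h2 => ?_, phi_dm := fun n => ?_, phi_dp := fun n => ?_ }
  · rw [starOf, mul_smul_comm, ← mul_assoc, S.e_z _ _ le_rfl (by omega)]
  · rw [starOf, smul_mul_assoc, mul_assoc, S.dp_e]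
  · conv_lhs => rw [← S.dm_dm_T n]
    rw [mul_assoc, H.T_Ti hq (by omega) (by omega), mul_assoc, S.dm_e]
  · have e1 : starOf q dp z (k + 1) * starOf q dp z k
        = ((q ^ (k + 1))⁻¹ * (q ^ k)⁻¹) • (z (k + 2) 1 * z (k + 2) 2 * (dp (k + 1) * dp k)) := by
      rw [starOf, starOf, smul_mul_smul_comm, mul_assoc, ← mul_assoc (dp (k + 1)),
        S.dp_z _ 1 le_rfl (by omega)]
      simp only [mul_assoc]
    -- The product `z_1 z_2` is central for `T_1`, as in an affine Hecke algebra, so `T_1⁻¹` can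
    -- reach `d_+²`, where it is absorbed.
    have e2 : Ti (k + 2) 1 * (z (k + 2) 1 * z (k + 2) 2)
        = z (k + 2) 1 * z (k + 2) 2 * Ti (k + 2) 1 := by
      have h2 : 1 < k + 2 := by omega
      rw [S.z_comm _ 1 2 ⟨le_rfl, by omega⟩ ⟨by omega, by omega⟩]
      have a1 : Ti (k + 2) 1 * z (k + 2) 2 = q⁻¹ • (z (k + 2) 1 * T (k + 2) 1) := by
        rw [S.z_mul_T hq le_rfl h2, smul_smul, inv_mul_cancel₀ hq, one_smul]
      have a2 : T (k + 2) 1 * z (k + 2) 1 = q • (z (k + 2) 2 * Ti (k + 2) 1) := by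
        rw [S.z_succ_mul_Ti hq le_rfl h2, smul_smul, mul_inv_cancel₀ hq, one_smul]
      rw [← mul_assoc, a1, smul_mul_assoc, mul_assoc, a2, mul_smul_comm, smul_smul,
        inv_mul_cancel₀ hq, one_smul, ← mul_assoc,
        S.z_comm _ 1 2 ⟨le_rfl, by omega⟩ ⟨by omega, by omega⟩]
    have e3 : Ti (k + 2) 1 * (dp (k + 1) * dp k) = dp (k + 1) * dp k := by
      conv_lhs => rw [← S.T_dp_dp k]
      rw [mul_assoc, ← mul_assoc, H.Ti_T hq le_rfl (by omega), ← mul_assoc, S.e_dp]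
    rw [mul_assoc, e1, mul_smul_comm, ← mul_assoc, e2, mul_assoc (z _ _ * z _ _), e3]
  · rw [starOf, smul_mul_assoc, mul_smul_comm, mul_assoc, S.dp_Ti h1 h2, ← mul_assoc, ← mul_assoc,
      S.z_Ti ⟨le_rfl, by omega⟩ ⟨by omega, by omega⟩ ⟨by omega, by omega⟩]
  -- The new commutator is a multiple of `φ z_k`, and `z_{k-1}` crosses `d_-`; moving the top `z`
  -- through `T_{k-1}⁻¹` leaves the original relation `phi_dm`.
  · rw [S.phiOf_star hq hq1, S.phiOf_star hq hq1]
    have e1 : phiOf q dp dm n * z (n + 1) (n + 1) * dm (n + 1)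
        = dm (n + 1) * (phiOf q dp dm (n + 1) * z (n + 2) (n + 2)) * Ti (n + 2) (n + 1) := by
      have h : n + 1 < n + 2 := by omega
      rw [mul_assoc, S.z_dm _ _ (by omega) le_rfl, ← mul_assoc, mul_assoc (dm _), mul_assoc _ (z _ _),
        S.z_succ_mul_Ti hq (by omega) h, mul_smul_comm, mul_smul_comm, ← mul_assoc _ (T _ _),
        ← mul_assoc (dm _), ← mul_assoc (dm _), ← S.phi_dm, smul_mul_assoc, smul_smul,
        inv_mul_cancel₀ hq, one_smul]
    rw [smul_mul_assoc, e1, mul_smul_comm, smul_mul_assoc, smul_smul]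
    congr 1
    rw [pow_succ, mul_inv]
    ring
  · rw [S.phiOf_star hq hq1, S.phiOf_star hq hq1]
    have hlt : 1 < n + 2 := by omega
    have e1 : dp (n + 1) * phiOf q dp dm n
        = q⁻¹ • (T (n + 2) 1 * phiOf q dp dm (n + 1) * dp (n + 1)) := by
      rw [S.phi_dp, smul_smul, inv_mul_cancel₀ hq, one_smul]
    -- Here `phi_dp` produces `z_1 T_1 = q T_1⁻¹ z_2`; then `z_2` crosses `φ` and becomes `z_1`, and
    -- it commutes with the last `z`.
    have e2 : z (n + 2) 1 * dp (n + 1) * (phiOf q dp dm n * z (n + 1) (n + 1))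
        = Ti (n + 2) 1 * (phiOf q dp dm (n + 1) * z (n + 2) (n + 2)) * (z (n + 2) 1 * dp (n + 1)) := by
      calc _ = z (n + 2) 1 * (dp (n + 1) * phiOf q dp dm n) * z (n + 1) (n + 1) := by
            simp only [mul_assoc]
        _ = q⁻¹ • ((z (n + 2) 1 * T (n + 2) 1) * phiOf q dp dm (n + 1)
              * (dp (n + 1) * z (n + 1) (n + 1))) := by
            rw [e1, mul_smul_comm, smul_mul_assoc]; simp only [mul_assoc]
        _ = Ti (n + 2) 1 * (z (n + 2) (1 + 1) * phiOf q dp dm (n + 1))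
              * (z (n + 2) (n + 2) * dp (n + 1)) := by
            rw [S.z_mul_T hq le_rfl hlt, S.dp_z _ _ (by omega) le_rfl, smul_mul_assoc,
              smul_mul_assoc, smul_smul, inv_mul_cancel₀ hq, one_smul]
            simp only [mul_assoc]
        _ = Ti (n + 2) 1 * phiOf q dp dm (n + 1) * (z (n + 2) 1 * z (n + 2) (n + 2))
              * dp (n + 1) := by
            rw [← S.phi_z le_rfl (by omega)]; simp only [mul_assoc]
        _ = _ := by
            rw [S.z_comm _ 1 _ ⟨le_rfl, by omega⟩ ⟨by omega, le_rfl⟩]; simp only [mul_assoc]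
    rw [starOf]
    simp only [mul_smul_comm, smul_mul_assoc, smul_smul, e2]
    congr 1
    rw [pow_succ, mul_inv]
    field_simp

variable {zs : ℕ → ℕ → F}

/-- For the presentation of `𝔸_{q⁻¹}` by `q^{-k} z_1 d_+`, `d_-`, `T_i⁻¹`, the first of the
elements denoted `y_i` in `𝔸_q` is `- q t y_1 z_1`. -/
lemma BSystem.star_y_one (S : BSystem q t e dp dm T Ti z) (hq : q ≠ 0) (hq1 : q ≠ 1)
    (hZ : IsYFamily q⁻¹ (starOf q dp z) dm Ti T zs) (n : ℕ) :
    zs (n + 1) 1 = -(q * t) • ((q ^ n)⁻¹ • (phiOf q dp dm n * prodDown (T (n + 1)) n)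
      * z (n + 1) 1) := by
  -- Each `T_i⁻¹` lowers the index of `z` and reappears as `q⁻¹ T_i` on the left, so the word of
  -- inverses becomes the word that defines `y_1`.
  have key : ∀ m, m ≤ n → z (n + 1) (m + 1) * prodDown (Ti (n + 1)) m
      = (q ^ m)⁻¹ • (prodDown (T (n + 1)) m * z (n + 1) 1) := by
    intro m hm
    induction m with
    | zero => simp [prodDown_zero]
    | succ m ih =>
      rw [prodDown_succ, prodDown_succ, ← mul_assoc, S.z_succ_mul_Ti hq (by omega) (by omega),
        smul_mul_assoc, mul_assoc, ih (by omega), mul_smul_comm, smul_smul, pow_succ', mul_inv,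
        mul_assoc]
  rw [hZ.one, S.phiOf_star hq hq1, smul_mul_assoc, mul_assoc, key n le_rfl, mul_smul_comm,
    smul_mul_assoc, mul_assoc]
  simp only [smul_smul]
  congr 1
  rw [inv_pow, inv_inv]
  field_simp

/-- `d_+ z_i = z_{i+1} d_+` in `𝔸_{q,t}`. -/
lemma BSystem.dp_star_y (S : BSystem q t e dp dm T Ti z) (hq : q ≠ 0) (hq1 : q ≠ 1)
    (hY : IsYFamily q dp dm T Ti y) (hZ : IsYFamily q⁻¹ (starOf q dp z) dm Ti T zs) {k i : ℕ}
    (h1 : 1 ≤ i) (h2 : i ≤ k) : dp k * zs k i = zs (k + 1) (i + 1) * dp k := by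
  have D := S.toDyckSystem
  have H := S.toHeckeSystem
  have D' := S.dyckSystem_star hq hq1
  -- By conjugation only the first element matters. It is `-qt y_1 z_1`, so the claim combines `d_+
  -- y_1 = T_1 y_1 T_1⁻¹ d_+` with `d_+ z_1 = z_2 d_+`.
  refine (D'.conjSeq hZ k).intertwine (r := 1) (m := k) (D'.conjSeq hZ (k + 1)) (fun h => ?_)
    le_rfl le_rfl (fun i h1 h2 => D.dp_T k i h1 h2) h1 h2
  obtain ⟨n, rfl⟩ : ∃ n, k = n + 1 := ⟨k - 1, by omega⟩
  have hlt : 1 < n + 1 + 1 := by omega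
  have hz : ∀ m, zs (m + 1) 1 = -(q * t) • (y (m + 1) 1 * z (m + 1) 1) := fun m => by
    rw [S.star_y_one hq hq1 hZ, hY.one]
  have hy := D.dp_y hY hq (k := n + 1) le_rfl h
  have hU : prodUp (T (n + 1 + 1)) 1 = T (n + 1 + 1) 1 := by simp [prodUp]
  have hD : prodDown (Ti (n + 1 + 1)) 1 = Ti (n + 1 + 1) 1 := by simp [prodDown]
  rw [hU, hD] at hy
  rw [hZ.succ _ 1 le_rfl hlt, hz, hz]
  simp only [mul_smul_comm, smul_mul_assoc, smul_smul]
  have e1 : z (n + 1 + 1) 1 * T (n + 1 + 1) 1 = q • (Ti (n + 1 + 1) 1 * z (n + 1 + 1) 2) :=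
    S.z_mul_T hq le_rfl hlt
  calc _ = -(q * t) • (dp (n + 1) * y (n + 1) 1 * z (n + 1) 1) := by rw [mul_assoc]
    _ = -(q * t) • (T (n + 1 + 1) 1 * y (n + 1 + 1) 1 * Ti (n + 1 + 1) 1
          * (dp (n + 1) * z (n + 1) 1)) := by rw [hy]; simp only [mul_assoc]
    _ = (-(q * t) * q⁻¹) • (T (n + 1 + 1) 1 * y (n + 1 + 1) 1
          * (q • (Ti (n + 1 + 1) 1 * z (n + 1 + 1) 2)) * dp (n + 1)) := by
        rw [S.dp_z _ 1 le_rfl h, mul_smul_comm, smul_mul_assoc, smul_smul, mul_assoc (-(q * t)),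
          inv_mul_cancel₀ hq, mul_one]
        simp only [mul_assoc]
    _ = _ := by
        rw [← e1, mul_comm (-(q * t))]
        simp only [mul_assoc]

/-- `d_+^* y_i = y_{i+1} d_+^*` in `𝔸_{q,t}`. -/
lemma BSystem.star_y (S : BSystem q t e dp dm T Ti z) (hq : q ≠ 0) (hq1 : q ≠ 1)
    (hY : IsYFamily q dp dm T Ti y) {k i : ℕ} (h1 : 1 ≤ i) (h2 : i ≤ k) :
    starOf q dp z k * y k i = y (k + 1) (i + 1) * starOf q dp z k := by
  have D := S.toDyckSystem
  have H := S.toHeckeSystem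
  have D' := S.dyckSystem_star hq hq1
  refine (D.conjSeq hY k).intertwine (r := 1) (m := k) (D.conjSeq hY (k + 1)) (fun h => ?_)
    le_rfl le_rfl (fun i h1 h2 => D'.dp_T k i h1 h2) h1 h2
  obtain ⟨n, rfl⟩ : ∃ n, k = n + 1 := ⟨k - 1, by omega⟩
  have hlt : 1 < n + 1 + 1 := by omega
  have hy := D.dp_y hY hq (k := n + 1) le_rfl h
  have hU : prodUp (T (n + 1 + 1)) 1 = T (n + 1 + 1) 1 := by simp [prodUp]
  have hD : prodDown (Ti (n + 1 + 1)) 1 = Ti (n + 1 + 1) 1 := by simp [prodDown]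
  rw [hU, hD] at hy
  -- `z_2 y_1 = y_1 T_1⁻¹ z_1 T_1`
  have e1 : z (n + 1 + 1) 2 * y (n + 1 + 1) 1
      = y (n + 1 + 1) 1 * Ti (n + 1 + 1) 1 * z (n + 1 + 1) 1 * T (n + 1 + 1) 1 := by
    have ePD : phiOf q dp dm (n + 1) * prodDown (fun j => T (n + 1 + 1) (j + 1)) n * e (n + 1 + 1)
        = phiOf q dp dm (n + 1) * prodDown (fun j => T (n + 1 + 1) (j + 1)) n := by
      rw [mul_assoc, ← mul_prodDown_of_intertwine (d := e (n + 1 + 1)) fun j h1 h2 => ?_,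
        ← mul_assoc, D.phi_e]
      rw [H.e_T _ _ (by omega) (by omega), H.T_e _ _ (by omega) (by omega)]
    have ez : z (n + 1 + 1) 1 * prodDown (fun j => T (n + 1 + 1) (j + 1)) n
        = prodDown (fun j => T (n + 1 + 1) (j + 1)) n * z (n + 1 + 1) 1 :=
      mul_prodDown_of_intertwine fun j h1 h2 =>
        S.z_T _ 1 (j + 1) ⟨le_rfl, by omega⟩ ⟨by omega, by omega⟩ ⟨by omega, by omega⟩
    rw [hY.one, prodDown_succ']
    simp only [mul_smul_comm, smul_mul_assoc]
    congr 1
    calc _ = (z (n + 1 + 1) (1 + 1) * phiOf q dp dm (n + 1))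
            * prodDown (fun j => T (n + 1 + 1) (j + 1)) n * T (n + 1 + 1) 1 := by
          simp only [mul_assoc]
      _ = phiOf q dp dm (n + 1) * (z (n + 1 + 1) 1
            * prodDown (fun j => T (n + 1 + 1) (j + 1)) n) * T (n + 1 + 1) 1 := by
          rw [← S.phi_z le_rfl (by omega)]; simp only [mul_assoc]
      _ = phiOf q dp dm (n + 1) * prodDown (fun j => T (n + 1 + 1) (j + 1)) n * e (n + 1 + 1)
            * z (n + 1 + 1) 1 * T (n + 1 + 1) 1 := by
          rw [ez, ePD]; simp only [mul_assoc]
      _ = _ := by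
          rw [← H.T_Ti hq le_rfl hlt]; simp only [mul_assoc]
  rw [hY.succ _ 1 le_rfl hlt, starOf]
  simp only [mul_smul_comm, smul_mul_assoc]
  calc _ = (q ^ (n + 1))⁻¹ • (z (n + 1 + 1) 1 * (dp (n + 1) * y (n + 1) 1)) := by
        rw [mul_assoc]
    _ = (q ^ (n + 1))⁻¹ • ((z (n + 1 + 1) 1 * T (n + 1 + 1) 1) * y (n + 1 + 1) 1
          * Ti (n + 1 + 1) 1 * dp (n + 1)) := by rw [hy]; simp only [mul_assoc]
    _ = (q ^ (n + 1))⁻¹ • q • (Ti (n + 1 + 1) 1 * (z (n + 1 + 1) 2 * y (n + 1 + 1) 1)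
          * Ti (n + 1 + 1) 1 * dp (n + 1)) := by
        rw [S.z_mul_T hq le_rfl hlt]; simp only [smul_mul_assoc, mul_assoc]
    _ = (q ^ (n + 1))⁻¹ • q • (Ti (n + 1 + 1) 1 * y (n + 1 + 1) 1 * Ti (n + 1 + 1) 1
          * z (n + 1 + 1) 1 * (T (n + 1 + 1) 1 * Ti (n + 1 + 1) 1 * dp (n + 1))) := by
        rw [e1]; simp only [mul_assoc]
    _ = _ := by
        rw [H.T_Ti hq le_rfl hlt, D.e_dp]; simp only [mul_assoc]

/-- `z_1 d_+ = - t q^{k+1} y_1 d_+^*` in `𝔸_{q,t}`. -/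
lemma BSystem.star_y_one_mul_dp (S : BSystem q t e dp dm T Ti z) (hq : q ≠ 0) (hq1 : q ≠ 1)
    (hY : IsYFamily q dp dm T Ti y) (hZ : IsYFamily q⁻¹ (starOf q dp z) dm Ti T zs) (k : ℕ) :
    zs (k + 1) 1 * dp k = -(t * q ^ (k + 1)) • (y (k + 1) 1 * starOf q dp z k) := by
  rw [S.star_y_one hq hq1 hZ, ← hY.one, starOf, mul_smul_comm, smul_mul_assoc, smul_smul, mul_assoc]
  congr 1
  field_simp
  ring

end BSystem

/-! ### The relations of `𝔹_{q,t}` inside `𝔸_{q,t}` -/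

section ASystem

variable {K F : Type*} [Field K] [Ring F] [Algebra K F]

/-- The relations of `𝔸_{q,t}`. -/
structure ASystem (q t : K) (e dp dps dm : ℕ → F) (T Ti y z : ℕ → ℕ → F) : Prop
    extends HeckeSystem q e T Ti where
  e_dp : ∀ k, e (k + 1) * dp k = dp k
  dp_e : ∀ k, dp k * e k = dp k
  e_dm : ∀ k, e k * dm k = dm k
  dm_e : ∀ k, dm k * e (k + 1) = dm k
  e_y : ∀ k i, 1 ≤ i → i ≤ k → e k * y k i = y k i
  y_e : ∀ k i, 1 ≤ i → i ≤ k → y k i * e k = y k i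
  e_z : ∀ k i, 1 ≤ i → i ≤ k → e k * z k i = z k i
  z_e : ∀ k i, 1 ≤ i → i ≤ k → z k i * e k = z k i
  left : ∀ a b, AqRel q e dp dm T Ti y a b → a = b
  right : ∀ a b, AqRel q⁻¹ e dps dm Ti T z a b → a = b
  dp_z : ∀ k i, 1 ≤ i → i ≤ k → dp k * z k i = z (k + 1) (i + 1) * dp k
  dps_y : ∀ k i, 1 ≤ i → i ≤ k → dps k * y k i = y (k + 1) (i + 1) * dps k
  z_dp : ∀ k, z (k + 1) 1 * dp k = -(t * q ^ (k + 1)) • (y (k + 1) 1 * dps k)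

variable {q t : K} {e dp dps dm : ℕ → F} {T Ti y z : ℕ → ℕ → F}

lemma ASystem.conjSeq (S : ASystem q t e dp dps dm T Ti y z) (hq : q ≠ 0) (k : ℕ) :
    ConjSeq q e Ti k (y k) where
  e_y := S.e_y k
  y_e := S.y_e k
  succ i h1 h2 := S.toHeckeSystem.eq_smul_conj hq h1 h2
    (S.e_y k _ (by omega) h2) (S.y_e k _ (by omega) h2) (S.left _ _ (.T_y_T k i ⟨h1, h2⟩))

lemma ASystem.phi_eq (S : ASystem q t e dp dps dm T Ti y z) (hq1 : q ≠ 1) (n : ℕ) :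
    phiOf q dp dm n = prodUp (T (n + 1)) n * y (n + 1) (n + 1) := by
  rw [phiOf, S.left _ _ (.commutator n), smul_smul, inv_mul_cancel₀ (sub_ne_zero.mpr hq1),
    one_smul]

/-- With `φ = T_1 ⋯ T_{k-1} y_k` this is `T_{k-1} y_k T_{k-1} = q y_{k-1}`, after `d_-` has been
moved through the remaining letters and `y_{k-1}`. -/
lemma ASystem.phi_dm (S : ASystem q t e dp dps dm T Ti y z) (hq1 : q ≠ 1) (n : ℕ) :
    q • (phiOf q dp dm n * dm (n + 1))
      = dm (n + 1) * phiOf q dp dm (n + 1) * T (n + 2) (n + 1) := by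
  have e1 : dm (n + 1) * prodUp (T (n + 2)) n = prodUp (T (n + 1)) n * dm (n + 1) :=
    mul_prodUp_of_intertwine fun j h1 h2 => S.left _ _ (.dm_T (n + 1) j ⟨h1, by omega⟩)
  have e2 := S.left _ _ (.T_y_T (n + 2) (n + 1) ⟨by omega, by omega⟩)
  have e3 := S.left _ _ (.dm_y (n + 1) (n + 1) ⟨by omega, le_rfl⟩)
  rw [S.phi_eq hq1, S.phi_eq hq1, prodUp_succ]
  calc _ = q • (prodUp (T (n + 1)) n * (y (n + 1) (n + 1) * dm (n + 1))) := by rw [mul_assoc]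
    _ = (dm (n + 1) * prodUp (T (n + 2)) n) * (q • y (n + 2) (n + 1)) := by
      rw [← e3, e1, mul_smul_comm, mul_assoc]
    _ = _ := by rw [← e2]; simp only [mul_assoc]

/-- Moving `d_+` through `T_1 ⋯ T_{k-1} y_k` shifts the word and conjugates `y_k`. What remains is
the identity `T_1 (T_1 ⋯ T_k)(T_1 ⋯ T_{k-1}) = (T_1 ⋯ T_k)²`, followed by a cancellation of inverse
words. -/
lemma ASystem.phi_dp (S : ASystem q t e dp dps dm T Ti y z) (hq : q ≠ 0) (hq1 : q ≠ 1) (n : ℕ) :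
    T (n + 2) 1 * phiOf q dp dm (n + 1) * dp (n + 1) = q • (dp (n + 1) * phiOf q dp dm n) := by
  have H := S.toHeckeSystem
  have e1 : dp (n + 1) * prodUp (T (n + 1)) n
      = prodUp (fun j => T (n + 2) (j + 1)) n * dp (n + 1) :=
    mul_prodUp_of_intertwine fun j h1 h2 => S.left _ _ (.dp_T (n + 1) j ⟨h1, by omega⟩)
  have e2 : T (n + 2) (n + 1) * y (n + 2) (n + 2) = q • (y (n + 2) (n + 1) * Ti (n + 2) (n + 1)) :=
    H.T_mul_conj hq (by omega) (by omega) (S.e_y _ _ (by omega) (by omega))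
      ((S.conjSeq hq _).succ _ (by omega) (by omega))
  have e3 := S.left _ _ (.dp_y (n + 1) (n + 1) ⟨by omega, le_rfl⟩)
  have e4 : y (n + 2) (n + 2) * prodDown (Ti (n + 2)) n
      = prodDown (Ti (n + 2)) n * y (n + 2) (n + 2) :=
    mul_prodDown_of_intertwine fun j h1 h2 =>
      H.intertwine h1 (by omega) h1 (by omega)
        (S.left _ _ (.y_T (n + 2) (n + 2) j ⟨by omega, le_rfl⟩ ⟨h1, by omega⟩
          ⟨by omega, by omega⟩))
        (by rw [S.y_e _ _ (by omega) le_rfl, S.e_y _ _ (by omega) le_rfl])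
  have e5 := (H.braidSeq (n + 2)).prodUp_mul_prodUp (m := n) (n := n + 1) (by omega) (by omega)
  have e6 := (H.braidSeq (n + 2)).mul_prodUp_mul_prodUp (n := n) (by omega)
  have e7 := H.prodUp_mul_prodDown_inv hq (k := n + 2) (m := n) (by omega)
    (x := y (n + 2) (n + 2) * dp (n + 1)) (by rw [← mul_assoc, S.e_y _ _ (by omega) le_rfl])
  rw [S.phi_eq hq1, S.phi_eq hq1]
  symm
  calc q • (dp (n + 1) * (prodUp (T (n + 1)) n * y (n + 1) (n + 1)))
      = q • (prodUp (fun j => T (n + 2) (j + 1)) n * (dp (n + 1) * y (n + 1) (n + 1))) := by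
        rw [← mul_assoc, e1, mul_assoc]
    _ = (prodUp (fun j => T (n + 2) (j + 1)) n * prodUp (T (n + 2)) (n + 1))
          * (q • (y (n + 2) (n + 1) * Ti (n + 2) (n + 1))) * prodDown (Ti (n + 2)) n
          * dp (n + 1) := by
        rw [e3, prodDown_succ]
        simp only [mul_smul_comm, smul_mul_assoc, mul_assoc]
    _ = prodUp (T (n + 2)) (n + 1) * prodUp (T (n + 2)) (n + 1)
          * (y (n + 2) (n + 2) * prodDown (Ti (n + 2)) n) * dp (n + 1) := by
        rw [← e2, ← e5]
        conv_rhs => rw [prodUp_succ (T (n + 2)) n]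
        rw [prodUp_succ (T (n + 2)) n]
        simp only [mul_assoc]
    _ = T (n + 2) 1 * prodUp (T (n + 2)) (n + 1) * (prodUp (T (n + 2)) n
          * (prodDown (Ti (n + 2)) n * (y (n + 2) (n + 2) * dp (n + 1)))) := by
        rw [e4, ← e6]; simp only [mul_assoc]
    _ = _ := by rw [e7]; simp only [mul_assoc]

lemma ASystem.dyckSystem (S : ASystem q t e dp dps dm T Ti y z) (hq : q ≠ 0) (hq1 : q ≠ 1) :
    DyckSystem q e dp dm T Ti :=
  { S.toHeckeSystem with
    e_dp := S.e_dp, dp_e := S.dp_e, e_dm := S.e_dm, dm_e := S.dm_e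
    dm_dm_T := fun n => S.left _ _ (.dm_dm_T n)
    dm_T := fun k i h1 h2 => S.left _ _ (.dm_T k i ⟨h1, h2⟩)
    T_dp_dp := fun k => S.left _ _ (.T_dp_dp k)
    dp_T := fun k i h1 h2 => S.left _ _ (.dp_T k i ⟨h1, h2⟩)
    phi_dm := S.phi_dm hq1, phi_dp := S.phi_dp hq hq1 }

/-- The relations of `𝔹_{q,t}` hold in `𝔸_{q,t}`. -/
lemma ASystem.bSystem (S : ASystem q t e dp dps dm T Ti y z) (hq : q ≠ 0) (hq1 : q ≠ 1) :
    BSystem q t e dp dm T Ti z := by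
  have H := S.toHeckeSystem
  have H' := H.symm hq
  refine { S.dyckSystem hq hq1 with
    e_z := S.e_z, z_e := S.z_e
    T_z_T := fun k i h1 h2 => S.right _ _ (.T_y_T k i ⟨h1, h2⟩)
    z_T := fun k i j hi hj hij => ?_
    z_comm := fun k i j hi hj => S.right _ _ (.y_comm k i j hi hj)
    z_dm := fun k i h1 h2 => (S.right _ _ (.dm_y k i ⟨h1, h2⟩)).symm
    dp_z := S.dp_z
    z_comm_z := fun n => ?_ }
  · exact H'.intertwine hj.1 hj.2 hj.1 hj.2 (S.right _ _ (.y_T k i j hi hj hij))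
      (by rw [S.z_e _ _ hi.1 hi.2, S.e_z _ _ hi.1 hi.2])
  · have e1 : z (n + 1) 1 * dm (n + 1) = dm (n + 1) * z (n + 2) 1 :=
      (S.right _ _ (.dm_y (n + 1) 1 ⟨le_rfl, by omega⟩)).symm
    have e2 : dm (n + 1) * y (n + 2) 1 = y (n + 1) 1 * dm (n + 1) :=
      S.left _ _ (.dm_y (n + 1) 1 ⟨le_rfl, by omega⟩)
    have e3 : dps n * dm n - dm (n + 1) * dps (n + 1)
        = (q⁻¹ - 1) • (prodUp (Ti (n + 1)) n * z (n + 1) (n + 1)) :=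
      S.right _ _ (.commutator n)
    have e4 := (S.conjSeq hq (n + 1)).prodUp_mul H hq (Nat.lt_succ_self n)
    have e5 : dp n * dm n - dm (n + 1) * dp (n + 1)
        = (q - 1) • (prodUp (T (n + 1)) n * y (n + 1) (n + 1)) := S.left _ _ (.commutator n)
    -- In both terms `z_1 d_+` is replaced by a multiple of `y_1 d_+^*`. The two multiples differ by
    -- the factor `q` of the relation, so exactly `y_1` times the commutator of `d_+^*` and `d_-`
    -- appears. Both commutators are then compared through `T_1 ⋯ T_n y_{n+1} = q^n y_1 T_1⁻¹ ⋯
    -- T_n⁻¹`.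
    have a1 : z (n + 1) 1 * (dp n * dm n)
        = -(t * q ^ (n + 1)) • (y (n + 1) 1 * (dps n * dm n)) := by
      rw [← mul_assoc, S.z_dp, smul_mul_assoc, mul_assoc]
    have a2 : z (n + 1) 1 * (dm (n + 1) * dp (n + 1))
        = -(t * q ^ (n + 2)) • (y (n + 1) 1 * (dm (n + 1) * dps (n + 1))) := by
      rw [← mul_assoc, e1, mul_assoc, S.z_dp, mul_smul_comm, ← mul_assoc, e2, mul_assoc]
    have a3 : q • (z (n + 1) 1 * (dp n * dm n)) - z (n + 1) 1 * (dm (n + 1) * dp (n + 1))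
        = -(t * q ^ (n + 2)) • (y (n + 1) 1 * (dps n * dm n - dm (n + 1) * dps (n + 1))) := by
      rw [a1, a2, mul_sub, smul_sub, smul_smul]
      congr 2
      ring
    rw [mul_sub, mul_smul_comm, a3, e3, e5, e4]
    simp only [mul_smul_comm, smul_mul_assoc, smul_smul, mul_assoc]
    congr 1
    field_simp
    ring

end ASystem

/-! ### Transport of the relations along algebra homomorphisms -/

section Map

variable {K F G : Type*} [Field K] [Ring F] [Algebra K F] [Ring G] [Algebra K G]

lemma map_heckeInv (f : F →ₐ[K] G) (q : K) (e T : F) :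
    f (heckeInv q e T) = heckeInv q (f e) (f T) := by
  simp [heckeInv]

lemma AqRel.map {q : K} {e dp dm : ℕ → F} {T Ti y : ℕ → ℕ → F}
    {e' dp' dm' : ℕ → G} {T' Ti' y' : ℕ → ℕ → G} (f : F →ₐ[K] G)
    (he : ∀ k, f (e k) = e' k) (hdp : ∀ k, f (dp k) = dp' k) (hdm : ∀ k, f (dm k) = dm' k)
    (hT : ∀ k i, 1 ≤ i → i < k → f (T k i) = T' k i)
    (hTi : ∀ k i, 1 ≤ i → i < k → f (Ti k i) = Ti' k i)
    (hy : ∀ k i, 1 ≤ i → i ≤ k → f (y k i) = y' k i) {a b : F}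
    (h : AqRel q e dp dm T Ti y a b) : AqRel q e' dp' dm' T' Ti' y' (f a) (f b) := by
  have hU : ∀ k m, m < k → f (prodUp (T k) m) = prodUp (T' k) m := fun k m hm => by
    rw [map_prodUp]
    exact prodUp_congr fun j h1 h2 => hT k j h1 (by omega)
  have hD : ∀ k m, m < k → f (prodDown (Ti k) m) = prodDown (Ti' k) m := fun k m hm => by
    rw [map_prodDown]
    exact prodDown_congr fun j h1 h2 => hTi k j h1 (by omega)
  cases h with
  | hecke k i h =>
    simp only [map_mul, map_sub, map_add, map_smul, map_zero, hT k i h.1 h.2, he]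
    exact .hecke k i h
  | braid k i h =>
    simp only [map_mul, hT k i h.1 (by omega), hT k (i + 1) (by omega) h.2]
    exact .braid k i h
  | T_comm k i j h =>
    simp only [map_mul, hT k i h.1 (by omega), hT k j (by omega) h.2.2]
    exact .T_comm k i j h
  | T_y_T k i h =>
    simp only [map_mul, map_smul, hT k i h.1 h.2, hy k i h.1 (by omega),
      hy k (i + 1) (by omega) (by omega)]
    exact .T_y_T k i h
  | y_T k i j hi hj hij =>
    simp only [map_mul, hT k j hj.1 hj.2, hy k i hi.1 hi.2]
    exact .y_T k i j hi hj hij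
  | y_comm k i j hi hj =>
    simp only [map_mul, hy k i hi.1 hi.2, hy k j hj.1 hj.2]
    exact .y_comm k i j hi hj
  | dm_dm_T n =>
    simp only [map_mul, hT (n + 2) (n + 1) (by omega) (by omega), hdm]
    exact .dm_dm_T n
  | dm_T k i h =>
    simp only [map_mul, hT k i h.1 h.2, hT (k + 1) i h.1 (by omega), hdm]
    exact .dm_T k i h
  | dm_y k i h =>
    simp only [map_mul, hy k i h.1 h.2, hy (k + 1) i h.1 (by omega), hdm]
    exact .dm_y k i h
  | T_dp_dp k =>
    simp only [map_mul, hT (k + 2) 1 (by omega) (by omega), hdp]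
    exact .T_dp_dp k
  | dp_T k i h =>
    simp only [map_mul, hT k i h.1 h.2, hT (k + 1) (i + 1) (by omega) (by omega), hdp]
    exact .dp_T k i h
  | dp_y k i h =>
    simp only [map_mul, hy k i h.1 h.2, hy (k + 1) i h.1 (by omega), hU (k + 1) i (by omega),
      hD (k + 1) i (by omega), hdp]
    exact .dp_y k i h
  | commutator n =>
    simp only [map_mul, map_sub, map_smul, hU (n + 1) n (by omega),
      hy (n + 1) (n + 1) (by omega) le_rfl, hdp, hdm]
    exact .commutator n

/-- The relations of the presented algebra are imposed in the free algebra; this turns a relation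
between the images of the generators back into one of those that were imposed. -/
lemma AqRel.exists_of_map {q : K} {e dp dm : ℕ → F} {T Ti y : ℕ → ℕ → F}
    (f : F →ₐ[K] G) {a b : G}
    (h : AqRel q (fun k => f (e k)) (fun k => f (dp k)) (fun k => f (dm k))
      (fun k i => f (T k i)) (fun k i => f (Ti k i)) (fun k i => f (y k i)) a b) :
    ∃ a' b', AqRel q e dp dm T Ti y a' b' ∧ f a' = a ∧ f b' = b := by
  cases h with
  | hecke k i h => exact ⟨_, _, .hecke k i h, by simp, by simp⟩
  | braid k i h => exact ⟨_, _, .braid k i h, by simp, by simp⟩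
  | T_comm k i j h => exact ⟨_, _, .T_comm k i j h, by simp, by simp⟩
  | T_y_T k i h => exact ⟨_, _, .T_y_T k i h, by simp, by simp⟩
  | y_T k i j hi hj hij => exact ⟨_, _, .y_T k i j hi hj hij, by simp, by simp⟩
  | y_comm k i j hi hj => exact ⟨_, _, .y_comm k i j hi hj, by simp, by simp⟩
  | dm_dm_T n => exact ⟨_, _, .dm_dm_T n, by simp, by simp⟩
  | dm_T k i h => exact ⟨_, _, .dm_T k i h, by simp, by simp⟩
  | dm_y k i h => exact ⟨_, _, .dm_y k i h, by simp, by simp⟩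
  | T_dp_dp k => exact ⟨_, _, .T_dp_dp k, by simp, by simp⟩
  | dp_T k i h => exact ⟨_, _, .dp_T k i h, by simp, by simp⟩
  | dp_y k i h =>
    exact ⟨_, _, .dp_y k i h, by simp, by simp [map_prodUp, map_prodDown]⟩
  | commutator n => exact ⟨_, _, .commutator n, by simp, by simp [map_prodUp]⟩

lemma HeckeSystem.of_heckeInv {q : K} {e : ℕ → F} {T : ℕ → ℕ → F}
    (e_e : ∀ k, e k * e k = e k)
    (e_T : ∀ k i, 1 ≤ i → i < k → e k * T k i = T k i)
    (T_e : ∀ k i, 1 ≤ i → i < k → T k i * e k = T k i)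
    (hecke : ∀ k i, 1 ≤ i → i < k → (T k i - e k) * (T k i + q • e k) = 0)
    (braidSeq : ∀ k, BraidSeq k (T k)) :
    HeckeSystem q e T fun k i => heckeInv q (e k) (T k i) where
  e_e := e_e
  e_T := e_T
  T_e := T_e
  Ti_eq _ _ _ _ := rfl
  T_T k i h1 h2 := by
    have h := hecke k i h1 h2
    rw [sub_mul, mul_add, mul_add, mul_smul_comm, mul_smul_comm, e_T k i h1 h2, T_e k i h1 h2,
      e_e] at h
    rw [← sub_eq_zero, ← h]
    module
  braidSeq := braidSeq

end Map

/-! ### Universal properties of the two presentations -/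

section Lift

variable {K F : Type*} [Field K] [Ring F] [Algebra K F]

/-- The values of the generators of `𝔸_{q,t}` for given families of elements of an algebra. -/
def aValue (e dp dps dm : ℕ → F) (T y z : ℕ → ℕ → F) : AGen → F
  | .idem k => e k
  | .dPlus k => dp k
  | .dPlusStar k => dps k
  | .dMinus k => dm k
  | .T k i => if 1 ≤ i ∧ i < k then T k i else 0
  | .y k i => if 1 ≤ i ∧ i ≤ k then y k i else 0
  | .z k i => if 1 ≤ i ∧ i ≤ k then z k i else 0

/-- The values of the generators of `𝔹_{q,t}` for given families of elements of an algebra. -/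
def bValue (e dp dm : ℕ → F) (T z : ℕ → ℕ → F) : BGen → F
  | .idem k => e k
  | .dPlus k => dp k
  | .dMinus k => dm k
  | .T k i => if 1 ≤ i ∧ i < k then T k i else 0
  | .z k i => if 1 ≤ i ∧ i ≤ k then z k i else 0

variable {q t : K} {e dp dps dm : ℕ → F} {T Ti y z : ℕ → ℕ → F}

/-- Orthogonality of the idempotents and the source and target of `d_+^*` are not part of `ASystem`,
so they enter separately. -/
lemma ASystem.exists_lift (S : ASystem q t e dp dps dm T Ti y z) (hq : q ≠ 0)
    (orth : ∀ j k, j ≠ k → e j * e k = 0)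
    (e_dps : ∀ k, e (k + 1) * dps k = dps k) (dps_e : ∀ k, dps k * e k = dps k) :
    ∃ f : AAlg K q t →ₐ[K] F, (∀ k, f (aGen K q t (.idem k)) = e k) ∧
      (∀ k, f (aGen K q t (.dPlus k)) = dp k) ∧ (∀ k, f (aGen K q t (.dPlusStar k)) = dps k) ∧
      (∀ k, f (aGen K q t (.dMinus k)) = dm k) ∧
      (∀ k i, 1 ≤ i → i < k → f (aGen K q t (.T k i)) = T k i) ∧
      (∀ k i, 1 ≤ i → i ≤ k → f (aGen K q t (.y k i)) = y k i) ∧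
      (∀ k i, 1 ≤ i → i ≤ k → f (aGen K q t (.z k i)) = z k i) := by
  have H := S.toHeckeSystem
  have H' := H.symm hq
  set f₀ : FreeAlgebra K AGen →ₐ[K] F := FreeAlgebra.lift K (aValue e dp dps dm T y z) with hf₀
  have hg : ∀ g, f₀ (aFree K g) = aValue e dp dps dm T y z g := fun g => by
    simp [hf₀, aFree]
  have hT : ∀ k i, 1 ≤ i → i < k → f₀ (aFree K (.T k i)) = T k i := fun k i h1 h2 => by
    simp [hg, aValue, h1, h2]
  have hTi : ∀ k i, 1 ≤ i → i < k → f₀ (aFreeTInv K q k i) = Ti k i := fun k i h1 h2 => by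
    rw [aFreeTInv, map_heckeInv, hT k i h1 h2, hg, H.Ti_eq k i h1 h2]
    rfl
  have hy : ∀ k i, 1 ≤ i → i ≤ k → f₀ (aFree K (.y k i)) = y k i := fun k i h1 h2 => by
    simp [hg, aValue, h1, h2]
  have hz : ∀ k i, 1 ≤ i → i ≤ k → f₀ (aFree K (.z k i)) = z k i := fun k i h1 h2 => by
    simp [hg, aValue, h1, h2]
  have hrel : ∀ ⦃a b⦄, ARel K q t a b → f₀ a = f₀ b := by
    intro a b h
    cases h with
    | idem_idem k => rw [map_mul, hg]; exact S.e_e k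
    | idem_orth j k h => rw [map_mul, hg, hg, map_zero]; exact orth j k h
    | source g =>
      rw [map_mul, hg, hg]
      cases g <;> simp only [aValue, AGen.src]
      case idem k => exact S.e_e k
      case dPlus k => exact S.dp_e k
      case dPlusStar k => exact dps_e k
      case dMinus k => exact S.dm_e k
      case T k i => split_ifs with h; exacts [S.T_e k i h.1 h.2, zero_mul _]
      case y k i => split_ifs with h; exacts [S.y_e k i h.1 h.2, zero_mul _]
      case z k i => split_ifs with h; exacts [S.z_e k i h.1 h.2, zero_mul _]
    | target g =>
      rw [map_mul, hg, hg]
      cases g <;> simp only [aValue, AGen.tgt]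
      case idem k => exact S.e_e k
      case dPlus k => exact S.e_dp k
      case dPlusStar k => exact e_dps k
      case dMinus k => exact S.e_dm k
      case T k i => split_ifs with h; exacts [S.e_T k i h.1 h.2, mul_zero _]
      case y k i => split_ifs with h; exacts [S.e_y k i h.1 h.2, mul_zero _]
      case z k i => split_ifs with h; exacts [S.e_z k i h.1 h.2, mul_zero _]
    | outOfRange g h =>
      rw [hg, map_zero]
      cases g <;> simp_all [aValue, AGen.InRange]
    | left a b h =>
      exact S.left _ _ (h.map f₀ (fun k => hg _) (fun k => hg _) (fun k => hg _) hT hTi hy)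
    | right a b h =>
      exact S.right _ _ (h.map f₀ (fun k => hg _) (fun k => hg _) (fun k => hg _) hTi hT hz)
    | dPlus_z k i h =>
      rw [map_mul, map_mul, hz k i h.1 h.2, hz (k + 1) (i + 1) (by omega) (by omega), hg]
      exact S.dp_z k i h.1 h.2
    | dPlusStar_y k i h =>
      rw [map_mul, map_mul, hy k i h.1 h.2, hy (k + 1) (i + 1) (by omega) (by omega), hg]
      exact S.dps_y k i h.1 h.2
    | z_dPlus k =>
      rw [map_mul, map_smul, map_mul, hy (k + 1) 1 le_rfl (by omega),
        hz (k + 1) 1 le_rfl (by omega), hg, hg]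
      exact S.z_dp k
  have hf : ∀ g, RingQuot.liftAlgHom K ⟨f₀, hrel⟩ (aGen K q t g) = f₀ (aFree K g) := fun g =>
    RingQuot.liftAlgHom_mkAlgHom_apply K f₀ hrel _
  exact ⟨RingQuot.liftAlgHom K ⟨f₀, hrel⟩, fun k => (hf _).trans (hg _),
    fun k => (hf _).trans (hg _), fun k => (hf _).trans (hg _), fun k => (hf _).trans (hg _),
    fun k i h1 h2 => (hf _).trans (hT k i h1 h2), fun k i h1 h2 => (hf _).trans (hy k i h1 h2),
    fun k i h1 h2 => (hf _).trans (hz k i h1 h2)⟩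

lemma BSystem.exists_lift (S : BSystem q t e dp dm T Ti z)
    (orth : ∀ j k, j ≠ k → e j * e k = 0) :
    ∃ f : BAlg K q t →ₐ[K] F, (∀ k, f (bGen K q t (.idem k)) = e k) ∧
      (∀ k, f (bGen K q t (.dPlus k)) = dp k) ∧ (∀ k, f (bGen K q t (.dMinus k)) = dm k) ∧
      (∀ k i, 1 ≤ i → i < k → f (bGen K q t (.T k i)) = T k i) ∧
      (∀ k i, 1 ≤ i → i ≤ k → f (bGen K q t (.z k i)) = z k i) := by
  have H := S.toHeckeSystem
  set f₀ : FreeAlgebra K BGen →ₐ[K] F := FreeAlgebra.lift K (bValue e dp dm T z) with hf₀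
  have hg : ∀ g, f₀ (bFree K g) = bValue e dp dm T z g := fun g => by
    simp [hf₀, bFree]
  have he : ∀ k, f₀ (bFree K (.idem k)) = e k := fun k => hg _
  have hdp : ∀ k, f₀ (bFree K (.dPlus k)) = dp k := fun k => hg _
  have hdm : ∀ k, f₀ (bFree K (.dMinus k)) = dm k := fun k => hg _
  have hT : ∀ k i, 1 ≤ i → i < k → f₀ (bFree K (.T k i)) = T k i := fun k i h1 h2 => by
    simp [hg, bValue, h1, h2]
  have hTi : ∀ k i, 1 ≤ i → i < k → f₀ (bFreeTInv K q k i) = Ti k i := fun k i h1 h2 => by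
    rw [bFreeTInv, map_heckeInv, hT k i h1 h2, hg, H.Ti_eq k i h1 h2]
    rfl
  have hz : ∀ k i, 1 ≤ i → i ≤ k → f₀ (bFree K (.z k i)) = z k i := fun k i h1 h2 => by
    simp [hg, bValue, h1, h2]
  have hphi : ∀ n, f₀ (bFreePhi K q n) = phiOf q dp dm n := fun n => by
    simp [bFreePhi, bFreeComm, phiOf, hdp, hdm]
  have hrel : ∀ ⦃a b⦄, BRel K q t a b → f₀ a = f₀ b := by
    intro a b h
    cases h with
    | idem_idem k => rw [map_mul, hg]; exact S.e_e k
    | idem_orth j k h => rw [map_mul, hg, hg, map_zero]; exact orth j k h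
    | source g =>
      rw [map_mul, hg, hg]
      cases g <;> simp only [bValue, BGen.src]
      case idem k => exact S.e_e k
      case dPlus k => exact S.dp_e k
      case dMinus k => exact S.dm_e k
      case T k i => split_ifs with h; exacts [S.T_e k i h.1 h.2, zero_mul _]
      case z k i => split_ifs with h; exacts [S.z_e k i h.1 h.2, zero_mul _]
    | target g =>
      rw [map_mul, hg, hg]
      cases g <;> simp only [bValue, BGen.tgt]
      case idem k => exact S.e_e k
      case dPlus k => exact S.e_dp k
      case dMinus k => exact S.e_dm k
      case T k i => split_ifs with h; exacts [S.e_T k i h.1 h.2, mul_zero _]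
      case z k i => split_ifs with h; exacts [S.e_z k i h.1 h.2, mul_zero _]
    | outOfRange g h =>
      rw [hg, map_zero]
      cases g <;> simp_all [bValue, BGen.InRange]
    | hecke k i h =>
      simp only [map_mul, map_sub, map_add, map_smul, map_zero, hT k i h.1 h.2, he]
      exact H.hecke h.1 h.2
    | braid k i h =>
      simp only [map_mul, hT k i h.1 (by omega), hT k (i + 1) (by omega) h.2]
      exact (H.braidSeq k).braid i h.1 h.2
    | T_comm k i j h =>
      simp only [map_mul, hT k i h.1 (by omega), hT k j (by omega) h.2.2]
      exact (H.braidSeq k).comm i j h.1 h.2.1 h.2.2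
    | T_z_T k i h =>
      simp only [map_mul, map_smul, hTi k i h.1 h.2, hz k i h.1 (by omega),
        hz k (i + 1) (by omega) (by omega)]
      exact S.T_z_T k i h.1 h.2
    | z_T k i j hi hj hij =>
      simp only [map_mul, hT k j hj.1 hj.2, hz k i hi.1 hi.2]
      exact S.z_T k i j hi hj hij
    | z_comm k i j hi hj =>
      simp only [map_mul, hz k i hi.1 hi.2, hz k j hj.1 hj.2]
      exact S.z_comm k i j hi hj
    | dm_dm_T n =>
      simp only [map_mul, hT (n + 2) (n + 1) (by omega) (by omega), hdm]
      exact S.dm_dm_T n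
    | dm_T k i h =>
      simp only [map_mul, hT k i h.1 h.2, hT (k + 1) i h.1 (by omega), hdm]
      exact S.dm_T k i h.1 h.2
    | T_dp_dp k =>
      simp only [map_mul, hT (k + 2) 1 (by omega) (by omega), hdp]
      exact S.T_dp_dp k
    | dp_T k i h =>
      simp only [map_mul, hT k i h.1 h.2, hT (k + 1) (i + 1) (by omega) (by omega), hdp]
      exact S.dp_T k i h.1 h.2
    | phi_dm n =>
      simp only [map_mul, map_smul, hphi, hdm, hT (n + 2) (n + 1) (by omega) (by omega)]
      exact S.phi_dm n
    | phi_dp n =>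
      simp only [map_mul, map_smul, hphi, hdp, hT (n + 2) 1 (by omega) (by omega)]
      exact S.phi_dp n
    | z_dm k i h =>
      simp only [map_mul, hz k i h.1 h.2, hz (k + 1) i h.1 (by omega), hdm]
      exact S.z_dm k i h.1 h.2
    | dp_z k i h =>
      simp only [map_mul, hz k i h.1 h.2, hz (k + 1) (i + 1) (by omega) (by omega), hdp]
      exact S.dp_z k i h.1 h.2
    | z_comm_z n =>
      simp only [bFreeComm, map_mul, map_sub, map_smul, hz (n + 1) 1 le_rfl (by omega),
        hz (n + 1) (n + 1) (by omega) le_rfl, hdp, hdm]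
      exact S.z_comm_z n
  have hf : ∀ g, RingQuot.liftAlgHom K ⟨f₀, hrel⟩ (bGen K q t g) = f₀ (bFree K g) := fun g =>
    RingQuot.liftAlgHom_mkAlgHom_apply K f₀ hrel _
  exact ⟨RingQuot.liftAlgHom K ⟨f₀, hrel⟩, fun k => (hf _).trans (hg _),
    fun k => (hf _).trans (hg _), fun k => (hf _).trans (hg _),
    fun k i h1 h2 => (hf _).trans (hT k i h1 h2), fun k i h1 h2 => (hf _).trans (hz k i h1 h2)⟩

end Lift

/-! ### The homomorphisms `α` and `β` -/

section Universal

variable (K : Type*) [Field K] (q t : K)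

/-- The inverses of the `T_i` in `𝔸_{q,t}`. -/
def aTInv (k i : ℕ) : AAlg K q t := heckeInv q (aGen K q t (.idem k)) (aGen K q t (.T k i))

/-- The inverses of the `T_i` in `𝔹_{q,t}`. -/
def bTInv (k i : ℕ) : BAlg K q t := heckeInv q (bGen K q t (.idem k)) (bGen K q t (.T k i))

lemma mkAlgHom_aFree (g : AGen) :
    RingQuot.mkAlgHom K (ARel K q t) (aFree K g) = aGen K q t g := rfl

lemma mkAlgHom_bFree (g : BGen) :
    RingQuot.mkAlgHom K (BRel K q t) (bFree K g) = bGen K q t g := rfl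

lemma aGen_rel {a b : FreeAlgebra K AGen} (h : ARel K q t a b) :
    RingQuot.mkAlgHom K (ARel K q t) a = RingQuot.mkAlgHom K (ARel K q t) b :=
  RingQuot.mkAlgHom_rel K h

lemma bGen_rel {a b : FreeAlgebra K BGen} (h : BRel K q t a b) :
    RingQuot.mkAlgHom K (BRel K q t) a = RingQuot.mkAlgHom K (BRel K q t) b :=
  RingQuot.mkAlgHom_rel K h

lemma aGen_target (g : AGen) : aGen K q t (.idem g.tgt) * aGen K q t g = aGen K q t g := by
  simpa only [mkAlgHom_aFree, mkAlgHom_bFree, bTInv, map_mul] using aGen_rel K q t (.target g)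

lemma aGen_source (g : AGen) : aGen K q t g * aGen K q t (.idem g.src) = aGen K q t g := by
  simpa only [mkAlgHom_aFree, mkAlgHom_bFree, bTInv, map_mul] using aGen_rel K q t (.source g)

lemma bGen_target (g : BGen) : bGen K q t (.idem g.tgt) * bGen K q t g = bGen K q t g := by
  simpa only [mkAlgHom_aFree, mkAlgHom_bFree, bTInv, map_mul] using bGen_rel K q t (.target g)

lemma bGen_source (g : BGen) : bGen K q t g * bGen K q t (.idem g.src) = bGen K q t g := by
  simpa only [mkAlgHom_aFree, mkAlgHom_bFree, bTInv, map_mul] using bGen_rel K q t (.source g)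

lemma aGen_orth (j k : ℕ) (h : j ≠ k) : aGen K q t (.idem j) * aGen K q t (.idem k) = 0 := by
  simpa only [mkAlgHom_aFree, mkAlgHom_bFree, bTInv, map_mul, map_zero] using aGen_rel K q t (.idem_orth j k h)

lemma bGen_orth (j k : ℕ) (h : j ≠ k) : bGen K q t (.idem j) * bGen K q t (.idem k) = 0 := by
  simpa only [mkAlgHom_aFree, mkAlgHom_bFree, bTInv, map_mul, map_zero] using bGen_rel K q t (.idem_orth j k h)

/-- The symbols with index out of range are zero in the quotient, so only genuine generators have to
be tested. -/
lemma bAlg_algHom_mem {F : Type*} [Ring F] [Algebra K F] (f : BAlg K q t →ₐ[K] F)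
    (s : Subalgebra K F) (h : ∀ g, g.InRange → f (bGen K q t g) ∈ s) (a : BAlg K q t) :
    f a ∈ s := by
  obtain ⟨a, rfl⟩ := RingQuot.mkAlgHom_surjective K (BRel K q t) a
  induction a using FreeAlgebra.induction with
  | grade0 r => rw [AlgHom.commutes, AlgHom.commutes]; exact s.algebraMap_mem r
  | grade1 x =>
    by_cases hx : x.InRange
    · exact h x hx
    · have h0 := bGen_rel K q t (.outOfRange x hx)
      rw [map_zero] at h0
      change f (RingQuot.mkAlgHom K (BRel K q t) (bFree K x)) ∈ s
      rw [h0, map_zero]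
      exact s.zero_mem
  | mul a b ha hb => rw [map_mul, map_mul]; exact s.mul_mem ha hb
  | add a b ha hb => rw [map_add, map_add]; exact s.add_mem ha hb

lemma bAlg_heckeSystem : HeckeSystem q (fun k => bGen K q t (.idem k))
    (fun k i => bGen K q t (.T k i)) (bTInv K q t) := by
  refine HeckeSystem.of_heckeInv (fun k => bGen_target K q t (.idem k))
    (fun k i _ _ => bGen_target K q t (.T k i)) (fun k i _ _ => bGen_source K q t (.T k i))
    (fun k i h1 h2 => ?_) (fun k => ⟨fun i h1 h2 => ?_, fun i j h1 h2 h3 => ?_⟩)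
  · simpa only [mkAlgHom_aFree, mkAlgHom_bFree, bTInv, map_mul, map_sub, map_add, map_smul, map_zero]
      using bGen_rel K q t (.hecke k i ⟨h1, h2⟩)
  · simpa only [mkAlgHom_aFree, mkAlgHom_bFree, bTInv, map_mul] using bGen_rel K q t (.braid k i ⟨h1, h2⟩)
  · simpa only [mkAlgHom_aFree, mkAlgHom_bFree, bTInv, map_mul] using bGen_rel K q t (.T_comm k i j ⟨h1, h2, h3⟩)

lemma mkAlgHom_bFreePhi (n : ℕ) : RingQuot.mkAlgHom K (BRel K q t) (bFreePhi K q n)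
    = phiOf q (fun k => bGen K q t (.dPlus k)) (fun k => bGen K q t (.dMinus k)) n := by
  simp only [bFreePhi, bFreeComm, phiOf, map_smul, map_sub, map_mul]
  rfl

lemma bAlg_bSystem : BSystem q t (fun k => bGen K q t (.idem k))
    (fun k => bGen K q t (.dPlus k)) (fun k => bGen K q t (.dMinus k))
    (fun k i => bGen K q t (.T k i)) (bTInv K q t) (fun k i => bGen K q t (.z k i)) := by
  refine { bAlg_heckeSystem K q t with
    e_dp := fun k => bGen_target K q t (.dPlus k)
    dp_e := fun k => bGen_source K q t (.dPlus k)
    e_dm := fun k => bGen_target K q t (.dMinus k)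
    dm_e := fun k => bGen_source K q t (.dMinus k)
    e_z := fun k i _ _ => bGen_target K q t (.z k i)
    z_e := fun k i _ _ => bGen_source K q t (.z k i)
    dm_dm_T := fun n => ?_, dm_T := fun k i h1 h2 => ?_, T_dp_dp := fun k => ?_,
    dp_T := fun k i h1 h2 => ?_, phi_dm := fun n => ?_, phi_dp := fun n => ?_,
    T_z_T := fun k i h1 h2 => ?_, z_T := fun k i j hi hj hij => ?_,
    z_comm := fun k i j hi hj => ?_, z_dm := fun k i h1 h2 => ?_, dp_z := fun k i h1 h2 => ?_,
    z_comm_z := fun n => ?_ }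
  · simpa only [mkAlgHom_aFree, mkAlgHom_bFree, bTInv, map_mul] using bGen_rel K q t (.dm_dm_T n)
  · simpa only [mkAlgHom_aFree, mkAlgHom_bFree, bTInv, map_mul] using bGen_rel K q t (.dm_T k i ⟨h1, h2⟩)
  · simpa only [mkAlgHom_aFree, mkAlgHom_bFree, bTInv, map_mul] using bGen_rel K q t (.T_dp_dp k)
  · simpa only [mkAlgHom_aFree, mkAlgHom_bFree, bTInv, map_mul] using bGen_rel K q t (.dp_T k i ⟨h1, h2⟩)
  · simpa only [mkAlgHom_aFree, mkAlgHom_bFree, bTInv, map_mul, map_smul, mkAlgHom_bFreePhi] using bGen_rel K q t (.phi_dm n)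
  · simpa only [mkAlgHom_aFree, mkAlgHom_bFree, bTInv, map_mul, map_smul, mkAlgHom_bFreePhi] using bGen_rel K q t (.phi_dp n)
  · simpa only [mkAlgHom_aFree, mkAlgHom_bFree, bTInv, map_mul, map_smul, bFreeTInv, map_heckeInv] using bGen_rel K q t (.T_z_T k i ⟨h1, h2⟩)
  · simpa only [mkAlgHom_aFree, mkAlgHom_bFree, bTInv, map_mul] using bGen_rel K q t (.z_T k i j hi hj hij)
  · simpa only [mkAlgHom_aFree, mkAlgHom_bFree, bTInv, map_mul] using bGen_rel K q t (.z_comm k i j hi hj)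
  · simpa only [mkAlgHom_aFree, mkAlgHom_bFree, bTInv, map_mul] using bGen_rel K q t (.z_dm k i ⟨h1, h2⟩)
  · simpa only [mkAlgHom_aFree, mkAlgHom_bFree, bTInv, map_mul] using bGen_rel K q t (.dp_z k i ⟨h1, h2⟩)
  · simpa only [mkAlgHom_aFree, mkAlgHom_bFree, bTInv, map_mul, map_smul, map_sub, bFreeComm] using bGen_rel K q t (.z_comm_z n)

lemma aAlg_left {x y : AAlg K q t} (h : AqRel q (fun k => aGen K q t (.idem k))
    (fun k => aGen K q t (.dPlus k)) (fun k => aGen K q t (.dMinus k))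
    (fun k i => aGen K q t (.T k i)) (aTInv K q t) (fun k i => aGen K q t (.y k i)) x y) :
    x = y := by
  have hTi : aTInv K q t = fun k i => RingQuot.mkAlgHom K (ARel K q t) (aFreeTInv K q k i) :=
    funext₂ fun k i => (map_heckeInv _ _ _ _).symm
  rw [hTi] at h
  obtain ⟨a, b, hab, rfl, rfl⟩ := AqRel.exists_of_map (RingQuot.mkAlgHom K (ARel K q t)) h
  exact aGen_rel K q t (.left _ _ hab)

lemma aAlg_right {x y : AAlg K q t} (h : AqRel q⁻¹ (fun k => aGen K q t (.idem k))
    (fun k => aGen K q t (.dPlusStar k)) (fun k => aGen K q t (.dMinus k))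
    (aTInv K q t) (fun k i => aGen K q t (.T k i)) (fun k i => aGen K q t (.z k i)) x y) :
    x = y := by
  have hTi : aTInv K q t = fun k i => RingQuot.mkAlgHom K (ARel K q t) (aFreeTInv K q k i) :=
    funext₂ fun k i => (map_heckeInv _ _ _ _).symm
  rw [hTi] at h
  obtain ⟨a, b, hab, rfl, rfl⟩ := AqRel.exists_of_map (RingQuot.mkAlgHom K (ARel K q t)) h
  exact aGen_rel K q t (.right _ _ hab)

lemma aAlg_aSystem : ASystem q t (fun k => aGen K q t (.idem k))
    (fun k => aGen K q t (.dPlus k)) (fun k => aGen K q t (.dPlusStar k))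
    (fun k => aGen K q t (.dMinus k)) (fun k i => aGen K q t (.T k i)) (aTInv K q t)
    (fun k i => aGen K q t (.y k i)) (fun k i => aGen K q t (.z k i)) where
  toHeckeSystem := HeckeSystem.of_heckeInv (fun k => aGen_target K q t (.idem k))
    (fun k i _ _ => aGen_target K q t (.T k i)) (fun k i _ _ => aGen_source K q t (.T k i))
    (fun k i h1 h2 => aAlg_left K q t (.hecke k i ⟨h1, h2⟩))
    (fun k => ⟨fun i h1 h2 => aAlg_left K q t (.braid k i ⟨h1, h2⟩),
      fun i j h1 h2 h3 => aAlg_left K q t (.T_comm k i j ⟨h1, h2, h3⟩)⟩)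
  e_dp k := aGen_target K q t (.dPlus k)
  dp_e k := aGen_source K q t (.dPlus k)
  e_dm k := aGen_target K q t (.dMinus k)
  dm_e k := aGen_source K q t (.dMinus k)
  e_y k i _ _ := aGen_target K q t (.y k i)
  y_e k i _ _ := aGen_source K q t (.y k i)
  e_z k i _ _ := aGen_target K q t (.z k i)
  z_e k i _ _ := aGen_source K q t (.z k i)
  left _ _ h := aAlg_left K q t h
  right _ _ h := aAlg_right K q t h
  dp_z k i h1 h2 := by
    simpa only [mkAlgHom_aFree, map_mul] using aGen_rel K q t (.dPlus_z k i ⟨h1, h2⟩)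
  dps_y k i h1 h2 := by
    simpa only [mkAlgHom_aFree, map_mul] using aGen_rel K q t (.dPlusStar_y k i ⟨h1, h2⟩)
  z_dp k := by
    simpa only [mkAlgHom_aFree, map_mul, map_smul] using aGen_rel K q t (.z_dPlus k)

variable {K q t}

/-- The elements `y_1, y_2 = q T_1⁻¹ y_1 T_1⁻¹, …`. -/
def conjFamily {F : Type*} [Ring F] [Algebra K F] (q : K) (Ti : ℕ → ℕ → F) (y : ℕ → F) (k : ℕ) :
    ℕ → F
  | 0 => 0
  | 1 => y k
  | i + 2 => q • (Ti k (i + 1) * conjFamily q Ti y k (i + 1) * Ti k (i + 1))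

lemma exists_isYFamily {F : Type*} [Ring F] [Algebra K F] (q : K) (dp dm : ℕ → F)
    (T Ti : ℕ → ℕ → F) : ∃ y, IsYFamily q dp dm T Ti y := by
  refine ⟨conjFamily q Ti fun k =>
    (q ^ (k - 1))⁻¹ • (phiOf q dp dm (k - 1) * prodDown (T k) (k - 1)), fun n => rfl,
    fun k i h1 h2 => ?_⟩
  obtain ⟨j, rfl⟩ : ∃ j, i = j + 1 := ⟨i - 1, by omega⟩
  rfl

theorem exists_alpha (hq : q ≠ 0) (hq1 : q ≠ 1) :
    ∃ α : BAlg K q t →ₐ[K] AAlg K q t, IsAlpha α := by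
  obtain ⟨α, h1, h2, h3, h4, h5⟩ :=
    ((aAlg_aSystem K q t).bSystem hq hq1).exists_lift (aGen_orth K q t)
  exact ⟨α, h1, h2, h3, h4, h5⟩

/-- The images of the `y_i` and `z_i` are forced by the commutators of `d_-` with `d_+` and with
`q^{-k} z_1 d_+`. Each half of the relations is an instance of `DyckSystem.aqRel`, and the cross
relations are `BSystem.dp_star_y`, `BSystem.star_y` and `BSystem.star_y_one_mul_dp`. -/
theorem exists_beta (hq : q ≠ 0) (hq1 : q ≠ 1) :
    ∃ β : AAlg K q t →ₐ[K] BAlg K q t, IsBeta β := by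
  have S := bAlg_bSystem K q t
  have D := S.dyckSystem_star hq hq1
  have hqi : q⁻¹ ≠ 0 := inv_ne_zero hq
  have hqi1 : q⁻¹ ≠ 1 := fun h => hq1 (inv_eq_one.mp h)
  obtain ⟨y, hY⟩ := exists_isYFamily q (fun k => bGen K q t (.dPlus k))
    (fun k => bGen K q t (.dMinus k)) (fun k i => bGen K q t (.T k i)) (bTInv K q t)
  obtain ⟨z, hZ⟩ := exists_isYFamily q⁻¹
    (starOf q (fun k => bGen K q t (.dPlus k)) (fun k i => bGen K q t (.z k i)))
    (fun k => bGen K q t (.dMinus k)) (bTInv K q t) (fun k i => bGen K q t (.T k i))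
  have A : ASystem q t (fun k => bGen K q t (.idem k)) (fun k => bGen K q t (.dPlus k))
      (starOf q (fun k => bGen K q t (.dPlus k)) (fun k i => bGen K q t (.z k i)))
      (fun k => bGen K q t (.dMinus k)) (fun k i => bGen K q t (.T k i)) (bTInv K q t) y z :=
    { bAlg_heckeSystem K q t with
      e_dp := S.e_dp, dp_e := S.dp_e, e_dm := S.e_dm, dm_e := S.dm_e
      e_y := fun k => (S.conjSeq hY k).e_y
      y_e := fun k => (S.conjSeq hY k).y_e
      e_z := fun k => (D.conjSeq hZ k).e_y
      z_e := fun k => (D.conjSeq hZ k).y_e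
      left := fun _ _ h => S.aqRel hY hq hq1 h
      right := fun _ _ h => D.aqRel hZ hqi hqi1 h
      dp_z := fun _ _ h1 h2 => S.dp_star_y hq hq1 hY hZ h1 h2
      dps_y := fun _ _ h1 h2 => S.star_y hq hq1 hY h1 h2
      z_dp := fun k => S.star_y_one_mul_dp hq hq1 hY hZ k }
  obtain ⟨β, h1, h2, h3, h4, h5, -, h7⟩ :=
    A.exists_lift hq (bGen_orth K q t) D.e_dp D.dp_e
  refine ⟨β, h1, h5, h4, h2, h3, fun n => ?_⟩
  rw [h7 _ _ le_rfl (by omega), S.star_y_one hq hq1 hZ, bYOne, mkAlgHom_bFreePhi]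

/-- `αβ` fixes the elements `y_i`. -/
theorem alpha_beta_y (hq : q ≠ 0) {α : BAlg K q t →ₐ[K] AAlg K q t}
    {β : AAlg K q t →ₐ[K] BAlg K q t} (hα : IsAlpha α) (hβ : IsBeta β) {k i : ℕ} (h1 : 1 ≤ i)
    (h2 : i ≤ k) (hq1 : q ≠ 1) : α (β (aGen K q t (.y k i))) = aGen K q t (.y k i) := by
  have S := aAlg_aSystem K q t
  have H := S.toHeckeSystem
  set f : AAlg K q t →ₐ[K] AAlg K q t := α.comp β with hf
  change f _ = _
  have he : ∀ k, f (aGen K q t (.idem k)) = aGen K q t (.idem k) := fun k => by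
    simp [hf, hβ.idem, hα.idem]
  have hdp : ∀ k, f (aGen K q t (.dPlus k)) = aGen K q t (.dPlus k) := fun k => by
    simp [hf, hβ.dPlus, hα.dPlus]
  have hdm : ∀ k, f (aGen K q t (.dMinus k)) = aGen K q t (.dMinus k) := fun k => by
    simp [hf, hβ.dMinus, hα.dMinus]
  have hT : ∀ k i, 1 ≤ i → i < k → f (aGen K q t (.T k i)) = aGen K q t (.T k i) :=
    fun k i h1 h2 => by simp [hf, hβ.T k i h1 h2, hα.T k i h1 h2]
  obtain ⟨n, rfl⟩ : ∃ n, k = n + 1 := ⟨k - 1, by omega⟩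
  -- The commutator of `d_+` and `d_-` is fixed by `αβ` and equals `(q-1) T_1 ⋯ T_n y_{n+1}`; the
  -- word can be cancelled, which determines the last `y`.
  have top : f (aGen K q t (.y (n + 1) (n + 1))) = aGen K q t (.y (n + 1) (n + 1)) := by
    have hU : f (prodUp (fun i => aGen K q t (.T (n + 1) i)) n)
        = prodUp (fun i => aGen K q t (.T (n + 1) i)) n := by
      rw [map_prodUp]
      exact prodUp_congr fun j h1 h2 => hT _ _ h1 (by omega)
    have c := S.left _ _ (.commutator n)
    have c' := congrArg f c
    simp only [map_sub, map_mul, map_smul, hdp, hdm, hU] at c'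
    rw [c] at c'
    have c'' := smul_right_injective _ (sub_ne_zero.mpr hq1) c'
    have e1 := H.prodDown_mul_prodUp_inv hq (Nat.lt_succ_self n)
      (S.e_y (n + 1) (n + 1) (by omega) le_rfl)
    have e2 := H.prodDown_mul_prodUp_inv hq (Nat.lt_succ_self n)
      (x := f (aGen K q t (.y (n + 1) (n + 1)))) (by
        have := congrArg f (S.e_y (n + 1) (n + 1) (by omega) le_rfl)
        rwa [map_mul, he] at this)
    rw [← e2, ← c'', e1]
  -- The remaining ones follow by descending induction, because `T_i y_{i+1} T_i = q y_i` and `q` is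
  -- invertible.
  obtain ⟨d, hd⟩ : ∃ d, d + i = n + 1 := ⟨n + 1 - i, by omega⟩
  induction d generalizing i with
  | zero => obtain rfl : i = n + 1 := by omega
            exact top
  | succ d ih =>
    have h := ih (i := i + 1) (by omega) (by omega) (by omega)
    have c := S.left _ _ (.T_y_T (n + 1) i ⟨h1, by omega⟩)
    have c' := congrArg f c
    simp only [map_mul, map_smul, hT _ _ h1 (show i < n + 1 by omega), h] at c'
    rw [c] at c'
    exact (smul_right_injective _ hq c').symm

/-- `αβ(d_+^*) = - t q y_1 d_+^*`. -/
theorem alpha_beta_dPlusStar (hq : q ≠ 0) {α : BAlg K q t →ₐ[K] AAlg K q t}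
    {β : AAlg K q t →ₐ[K] BAlg K q t} (hα : IsAlpha α) (hβ : IsBeta β) (k : ℕ) :
    α (β (aGen K q t (.dPlusStar k)))
      = -(q * t) • (aGen K q t (.y (k + 1) 1) * aGen K q t (.dPlusStar k)) := by
  have h := (aAlg_aSystem K q t).z_dp k
  rw [hβ.dPlusStar, map_smul, map_mul, hα.z _ _ le_rfl (by omega), hα.dPlus, h, smul_smul]
  congr 1
  field_simp
  ring

end Universal

/-! ### From operator identities to the relations of `𝔸_{q,t}` -/

section OpSystem

variable {K F : Type*} [Field K] [Ring F] [Algebra K F]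

/-- The relations between the operators `tau k : F ↦ F[X + (q - 1) y_{k+1}]`, `d_-`, `d_+^*`,
`T_i`, `y_i` from which those of `𝔸_{q,t}` follow for `d_+ = T_1 ⋯ T_k tau k`. -/
structure OpSystem (q t : K) (e tau dps dm : ℕ → F) (T Ti y : ℕ → ℕ → F) : Prop
    extends HeckeSystem q e T Ti where
  e_tau : ∀ k, e (k + 1) * tau k = tau k
  tau_e : ∀ k, tau k * e k = tau k
  e_dps : ∀ k, e (k + 1) * dps k = dps k
  dps_e : ∀ k, dps k * e k = dps k
  e_dm : ∀ k, e k * dm k = dm k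
  dm_e : ∀ k, dm k * e (k + 1) = dm k
  e_y : ∀ k i, 1 ≤ i → i ≤ k → e k * y k i = y k i
  y_e : ∀ k i, 1 ≤ i → i ≤ k → y k i * e k = y k i
  T_y_T : ∀ k i, 1 ≤ i → i < k → T k i * y k (i + 1) * T k i = q • y k i
  y_T : ∀ k i j, 1 ≤ i ∧ i ≤ k → 1 ≤ j ∧ j < k → i ≠ j ∧ i ≠ j + 1 →
    y k i * T k j = T k j * y k i
  y_comm : ∀ k i j, 1 ≤ i ∧ i ≤ k → 1 ≤ j ∧ j ≤ k → y k i * y k j = y k j * y k i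
  dm_y : ∀ k i, 1 ≤ i → i ≤ k → dm k * y (k + 1) i = y k i * dm k
  tau_y : ∀ k i, 1 ≤ i → i ≤ k → tau k * y k i = y (k + 1) i * tau k
  tau_T : ∀ k i, 1 ≤ i → i < k → tau k * T k i = T (k + 1) i * tau k
  T_tau_tau : ∀ k, T (k + 2) (k + 1) * (tau (k + 1) * tau k) = tau (k + 1) * tau k
  dm_T : ∀ k i, 1 ≤ i → i < k → dm k * T (k + 1) i = T k i * dm k
  dm_dm_T : ∀ n, dm n * dm (n + 1) * T (n + 2) (n + 1) = dm n * dm (n + 1)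
  tau_dm : ∀ n, tau n * dm n - dm (n + 1) * (T (n + 2) (n + 1) * tau (n + 1))
    = (q - 1) • y (n + 1) (n + 1)
  dps_T : ∀ k i, 1 ≤ i → i < k → dps k * T k i = T (k + 1) (i + 1) * dps k
  dps_y : ∀ k i, 1 ≤ i → i ≤ k → dps k * y k i = y (k + 1) (i + 1) * dps k
  T_dps_dps : ∀ k, T (k + 2) 1 * (dps (k + 1) * dps k) = dps (k + 1) * dps k
  phi_dm_T : ∀ n, phiOf q⁻¹ dps dm n * dm (n + 1) * T (n + 2) (n + 1)
    = q • (dm (n + 1) * phiOf q⁻¹ dps dm (n + 1))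
  T_dps_phi : ∀ n, T (n + 2) 1 * (dps (n + 1) * phiOf q⁻¹ dps dm n)
    = q • (phiOf q⁻¹ dps dm (n + 1) * dps (n + 1))
  phi_T_tau : ∀ n, phiOf q⁻¹ dps dm (n + 1) * (T (n + 2) (n + 1) * tau (n + 1))
    = tau (n + 1) * phiOf q⁻¹ dps dm n
  phi_tau : ∀ k, phiOf q⁻¹ dps dm k * tau k = -(q * t) • (y (k + 1) 1 * dps k)

variable {q t : K} {e tau dps dm : ℕ → F} {T Ti y zs : ℕ → ℕ → F}

/-- `d_+ = T_1 ⋯ T_k tau k`. -/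
def dpOf (tau : ℕ → F) (T : ℕ → ℕ → F) (k : ℕ) : F := prodUp (T (k + 1)) k * tau k

lemma OpSystem.e_dp (S : OpSystem q t e tau dps dm T Ti y) (k : ℕ) :
    e (k + 1) * dpOf tau T k = dpOf tau T k := by
  rw [dpOf, ← mul_assoc, S.commute_e_prodUp (Nat.lt_succ_self k), mul_assoc, S.e_tau]

lemma OpSystem.dp_e (S : OpSystem q t e tau dps dm T Ti y) (k : ℕ) :
    dpOf tau T k * e k = dpOf tau T k := by
  rw [dpOf, mul_assoc, S.tau_e]

lemma OpSystem.dp_T (S : OpSystem q t e tau dps dm T Ti y) {k i : ℕ} (h1 : 1 ≤ i) (h2 : i < k) :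
    dpOf tau T k * T k i = T (k + 1) (i + 1) * dpOf tau T k := by
  rw [dpOf, mul_assoc, S.tau_T k i h1 h2, ← mul_assoc,
    (S.braidSeq (k + 1)).prodUp_mul (Nat.lt_succ_self k) h1 h2, mul_assoc]

/-- All `T_i` can be collected to the left of `τ²`. The extra `T_1` then turns `(T_1 ⋯ T_{k+1})(T_1
⋯ T_k)` into `(T_1 ⋯ T_{k+1})²`, which has one more `T_{k+1}` at its right end, and `τ²` absorbs it.
-/
lemma OpSystem.T_dp_dp (S : OpSystem q t e tau dps dm T Ti y) (k : ℕ) :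
    T (k + 2) 1 * dpOf tau T (k + 1) * dpOf tau T k = dpOf tau T (k + 1) * dpOf tau T k := by
  have e1 : tau (k + 1) * prodUp (T (k + 1)) k = prodUp (T (k + 2)) k * tau (k + 1) :=
    mul_prodUp_of_intertwine fun j h1 h2 => S.tau_T (k + 1) j h1 (by omega)
  have e2 := (S.braidSeq (k + 2)).mul_prodUp_mul_prodUp (n := k) (by omega)
  have e3 : dpOf tau T (k + 1) * dpOf tau T k
      = prodUp (T (k + 2)) (k + 1) * prodUp (T (k + 2)) k * (tau (k + 1) * tau k) := by
    calc _ = prodUp (T (k + 2)) (k + 1) * (tau (k + 1) * prodUp (T (k + 1)) k) * tau k := by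
          simp only [dpOf, mul_assoc]
      _ = _ := by rw [e1]; simp only [mul_assoc]
  rw [mul_assoc, e3, ← mul_assoc, e2]
  conv_lhs => rw [prodUp_succ (T (k + 2)) k]
  conv_rhs => rw [← S.T_tau_tau k, prodUp_succ (T (k + 2)) k]
  simp only [mul_assoc]

lemma OpSystem.dp_y (S : OpSystem q t e tau dps dm T Ti y) (hq : q ≠ 0) {k i : ℕ} (h1 : 1 ≤ i)
    (h2 : i ≤ k) : dpOf tau T k * y k i
      = prodUp (T (k + 1)) i * y (k + 1) i * prodDown (Ti (k + 1)) i * dpOf tau T k := by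
  -- The tail `r = T_{i+1} ⋯ T_m` commutes with `y_i`, so only `T_1 ⋯ T_i` conjugates it.
  have key : ∀ m, i ≤ m → m ≤ k → ∃ r, prodUp (T (k + 1)) m = prodUp (T (k + 1)) i * r ∧
      r * y (k + 1) i = y (k + 1) i * r ∧ e (k + 1) * r = r * e (k + 1) := by
    intro m hm
    induction m, hm using Nat.le_induction with
    | base => exact fun _ => ⟨1, by simp, by simp, by simp⟩
    | succ m hm ih =>
      intro hmk
      obtain ⟨r, hr1, hr2, hr3⟩ := ih (by omega)
      refine ⟨r * T (k + 1) (m + 1), ?_, ?_, ?_⟩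
      · rw [prodUp_succ, hr1, mul_assoc]
      · rw [mul_assoc, ← S.y_T (k + 1) i (m + 1) ⟨h1, by omega⟩ ⟨by omega, by omega⟩
          ⟨by omega, by omega⟩, ← mul_assoc, hr2, mul_assoc]
      · rw [← mul_assoc, hr3, mul_assoc, mul_assoc, S.e_T _ _ (by omega) (by omega),
          S.T_e _ _ (by omega) (by omega)]
  obtain ⟨r, hr1, hr2, hr3⟩ := key k h2 le_rfl
  have hx : e (k + 1) * (r * tau k) = r * tau k := by
    rw [← mul_assoc, hr3, mul_assoc, S.e_tau]
  have e1 := S.prodDown_mul_prodUp_inv hq (show i < k + 1 by omega) hx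
  calc dpOf tau T k * y k i = prodUp (T (k + 1)) i * (r * y (k + 1) i) * tau k := by
        rw [dpOf, mul_assoc, S.tau_y k i h1 h2, hr1]; simp only [mul_assoc]
    _ = prodUp (T (k + 1)) i * y (k + 1) i
          * (prodDown (Ti (k + 1)) i * (prodUp (T (k + 1)) i * (r * tau k))) := by
        rw [hr2, e1]; simp only [mul_assoc]
    _ = _ := by rw [dpOf, hr1]; simp only [mul_assoc]

/-- Since `d_-` commutes with `T_1, …, T_n`, the common word factors out on the left and leaves
`tau_dm`. -/
lemma OpSystem.commutator (S : OpSystem q t e tau dps dm T Ti y) (n : ℕ) :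
    dpOf tau T n * dm n - dm (n + 1) * dpOf tau T (n + 1)
      = (q - 1) • (prodUp (T (n + 1)) n * y (n + 1) (n + 1)) := by
  have e1 : dm (n + 1) * prodUp (T (n + 2)) n = prodUp (T (n + 1)) n * dm (n + 1) :=
    mul_prodUp_of_intertwine fun j h1 h2 => S.dm_T (n + 1) j h1 (by omega)
  rw [← mul_smul_comm, ← S.tau_dm, mul_sub, ← mul_assoc _ (dm (n + 1)), ← e1, dpOf, dpOf,
    prodUp_succ]
  simp only [mul_assoc]

lemma OpSystem.left (S : OpSystem q t e tau dps dm T Ti y) (hq : q ≠ 0) {a b : F}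
    (h : AqRel q e (dpOf tau T) dm T Ti y a b) : a = b := by
  have H := S.toHeckeSystem
  cases h with
  | hecke k i h => exact H.hecke h.1 h.2
  | braid k i h => exact (H.braidSeq k).braid i h.1 h.2
  | T_comm k i j h => exact (H.braidSeq k).comm i j h.1 h.2.1 h.2.2
  | T_y_T k i h => exact S.T_y_T k i h.1 h.2
  | y_T k i j hi hj hij => exact S.y_T k i j hi hj hij
  | y_comm k i j hi hj => exact S.y_comm k i j hi hj
  | dm_dm_T n => exact S.dm_dm_T n
  | dm_T k i h => exact S.dm_T k i h.1 h.2
  | dm_y k i h => exact S.dm_y k i h.1 h.2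
  | T_dp_dp k => exact S.T_dp_dp k
  | dp_T k i h => exact S.dp_T h.1 h.2
  | dp_y k i h => exact S.dp_y hq h.1 h.2
  | commutator n => exact S.commutator n

lemma OpSystem.dyckSystem (S : OpSystem q t e tau dps dm T Ti y) (hq : q ≠ 0) :
    DyckSystem q⁻¹ e dps dm Ti T := by
  have H := S.toHeckeSystem
  have H' := H.symm hq
  refine { H' with
    e_dp := S.e_dps, dp_e := S.dps_e, e_dm := S.e_dm, dm_e := S.dm_e,
    dm_dm_T := fun n => ?_, dm_T := fun k i h1 h2 => ?_, T_dp_dp := fun k => ?_,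
    dp_T := fun k i h1 h2 => ?_, phi_dm := fun n => ?_, phi_dp := fun n => ?_ }
  · conv_lhs => rw [← S.dm_dm_T n]
    rw [mul_assoc, H.T_Ti hq (by omega) (by omega), mul_assoc, S.dm_e]
  · exact H.intertwine h1 (by omega) h1 h2 (S.dm_T k i h1 h2) (by rw [S.dm_e, S.e_dm])
  · conv_lhs => rw [mul_assoc, ← S.T_dps_dps k]
    rw [← mul_assoc, H.Ti_T hq le_rfl (by omega), ← mul_assoc, S.e_dps]
  · exact H.intertwine h1 h2 (by omega) (by omega) (S.dps_T k i h1 h2) (by rw [S.dps_e, S.e_dps])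
  · have h : n + 1 < n + 2 := by omega
    have e1 : dm (n + 1) * phiOf q⁻¹ dps dm (n + 1)
        = q⁻¹ • (phiOf q⁻¹ dps dm n * dm (n + 1) * T (n + 2) (n + 1)) := by
      rw [S.phi_dm_T, smul_smul, inv_mul_cancel₀ hq, one_smul]
    rw [e1, smul_mul_assoc, mul_assoc _ (T _ _), H.T_Ti hq (by omega) h, mul_assoc, S.dm_e]
  · have h : 1 < n + 2 := by omega
    have e1 : phiOf q⁻¹ dps dm (n + 1) * dps (n + 1)
        = q⁻¹ • (T (n + 2) 1 * (dps (n + 1) * phiOf q⁻¹ dps dm n)) := by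
      rw [S.T_dps_phi, smul_smul, inv_mul_cancel₀ hq, one_smul]
    rw [mul_assoc, e1, mul_smul_comm, ← mul_assoc, H.Ti_T hq le_rfl h, ← mul_assoc, S.e_dps]

/-- `d_+ φ^* = T_1 φ^* d_+`. -/
lemma OpSystem.T_phi_dp (S : OpSystem q t e tau dps dm T Ti y) (n : ℕ) :
    T (n + 2) 1 * phiOf q⁻¹ dps dm (n + 1) * dpOf tau T (n + 1)
      = dpOf tau T (n + 1) * phiOf q⁻¹ dps dm n := by
  have e1 : phiOf q⁻¹ dps dm (n + 1) * prodUp (T (n + 2)) n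
      = prodUp (fun j => T (n + 2) (j + 1)) n * phiOf q⁻¹ dps dm (n + 1) :=
    mul_prodUp_of_intertwine fun j h1 h2 => phiOf_mul_T S.dm_T S.dps_T h1 (by omega)
  calc _ = T (n + 2) 1 * (phiOf q⁻¹ dps dm (n + 1) * prodUp (T (n + 2)) n)
          * (T (n + 2) (n + 1) * tau (n + 1)) := by
        rw [dpOf, prodUp_succ]; simp only [mul_assoc]
    _ = T (n + 2) 1 * prodUp (fun j => T (n + 2) (j + 1)) n
          * (phiOf q⁻¹ dps dm (n + 1) * (T (n + 2) (n + 1) * tau (n + 1))) := by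
        rw [e1]; simp only [mul_assoc]
    _ = _ := by rw [S.phi_T_tau, ← prodUp_succ', dpOf, mul_assoc]

/-- Conjugation by the `T_i` reduces this to `z_1`, a multiple of `φ^*` times a word in the `T_i⁻¹`.
There it is `T_phi_dp`; the missing `T_1⁻¹T_1` is inserted in front of `d_+`. -/
lemma OpSystem.dp_z (S : OpSystem q t e tau dps dm T Ti y) (hq : q ≠ 0)
    (hZ : IsYFamily q⁻¹ dps dm Ti T zs) {k i : ℕ} (h1 : 1 ≤ i) (h2 : i ≤ k) :
    dpOf tau T k * zs k i = zs (k + 1) (i + 1) * dpOf tau T k := by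
  have H := S.toHeckeSystem
  have D := S.dyckSystem hq
  refine (D.conjSeq hZ k).intertwine (r := 1) (m := k) (D.conjSeq hZ (k + 1)) (fun h => ?_)
    le_rfl le_rfl (fun i h1 h2 => S.dp_T h1 h2) h1 h2
  obtain ⟨n, rfl⟩ : ∃ n, k = n + 1 := ⟨k - 1, by omega⟩
  have hlt : 1 < n + 1 + 1 := by omega
  have e1 : dpOf tau T (n + 1) * prodDown (Ti (n + 1)) n
      = prodDown (fun j => Ti (n + 2) (j + 1)) n * dpOf tau T (n + 1) :=
    mul_prodDown_of_intertwine fun j h1 h2 =>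
      H.intertwine h1 (by omega) (by omega) (by omega) (S.dp_T h1 (by omega))
        (by rw [S.dp_e, S.e_dp])
  rw [hZ.succ _ 1 le_rfl hlt, hZ.one, hZ.one, prodDown_succ']
  simp only [mul_smul_comm, smul_mul_assoc, smul_smul]
  calc _ = ((q⁻¹ ^ n)⁻¹) • (T (n + 2) 1 * phiOf q⁻¹ dps dm (n + 1)
            * (dpOf tau T (n + 1) * prodDown (Ti (n + 1)) n)) := by
          rw [← mul_assoc, ← S.T_phi_dp, mul_assoc]
    _ = ((q⁻¹ ^ n)⁻¹) • (T (n + 2) 1 * phiOf q⁻¹ dps dm (n + 1)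
            * prodDown (fun j => Ti (n + 2) (j + 1)) n
            * (Ti (n + 2) 1 * T (n + 2) 1 * dpOf tau T (n + 1))) := by
          rw [e1, H.Ti_T hq le_rfl hlt, S.e_dp]; simp only [mul_assoc]
    _ = _ := by
          have : q⁻¹ * (q⁻¹ ^ (n + 1))⁻¹ = (q⁻¹ ^ n)⁻¹ := by
            rw [inv_pow, inv_pow, inv_inv, inv_inv, pow_succ']; field_simp
          rw [this]
          simp only [mul_assoc]

/-- The word of inverses in `z_1` cancels the word `T_1 ⋯ T_k` in `d_+`, leaving `φ^* τ`. -/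
lemma OpSystem.z_dp (S : OpSystem q t e tau dps dm T Ti y) (hq : q ≠ 0)
    (hZ : IsYFamily q⁻¹ dps dm Ti T zs) (k : ℕ) :
    zs (k + 1) 1 * dpOf tau T k = -(t * q ^ (k + 1)) • (y (k + 1) 1 * dps k) := by
  rw [hZ.one, smul_mul_assoc, mul_assoc, dpOf,
    S.prodDown_mul_prodUp_inv hq (Nat.lt_succ_self k) (S.e_tau k), S.phi_tau, smul_smul]
  congr 1
  rw [inv_pow, inv_inv]
  ring

/-- The relations of `𝔸_{q,t}` follow. -/
theorem OpSystem.aSystem (S : OpSystem q t e tau dps dm T Ti y) (hq : q ≠ 0) (hq1 : q ≠ 1)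
    (hZ : IsYFamily q⁻¹ dps dm Ti T zs) : ASystem q t e (dpOf tau T) dps dm T Ti y zs := by
  have D := S.dyckSystem hq
  exact { S.toHeckeSystem with
    e_dp := S.e_dp, dp_e := S.dp_e, e_dm := S.e_dm, dm_e := S.dm_e, e_y := S.e_y, y_e := S.y_e
    e_z := fun k => (D.conjSeq hZ k).e_y
    z_e := fun k => (D.conjSeq hZ k).y_e
    left := fun _ _ h => S.left hq h
    right := fun _ _ h => D.aqRel hZ (inv_ne_zero hq) (fun h => hq1 (inv_eq_one.mp h)) h
    dp_z := fun _ _ h1 h2 => S.dp_z hq hZ h1 h2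
    dps_y := S.dps_y
    z_dp := S.z_dp hq hZ }

end OpSystem

/-! ### The substitutions as algebra homomorphisms of Laurent polynomials -/

section LauHom

variable {K : Type*} [Field K]

/-- The power sum `p_{n+1}` in the ring of Laurent polynomials. -/
def pSum (n : ℕ) : Lau K := AddMonoidAlgebra.single 0 (MvPolynomial.X n)

/-- The inclusion of the symmetric functions. -/
def cst : SymFun K →ₐ[K] Lau K :=
  { AddMonoidAlgebra.singleZeroRingHom with
    commutes' := fun r => by
      simp [AddMonoidAlgebra.singleZeroRingHom, AddMonoidAlgebra.coe_algebraMap] }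

lemma cst_apply (c : SymFun K) : cst c = AddMonoidAlgebra.single 0 c := rfl

lemma cst_X (n : ℕ) : cst (MvPolynomial.X n : SymFun K) = pSum n := rfl

lemma yPow_zero (i : ℕ) : (yPow i 0 : Lau K) = 1 := by
  simp [yPow, AddMonoidAlgebra.one_def]

/-- `y_i` as a unit. -/
def yUnit (i : ℕ) : (Lau K)ˣ where
  val := yPow i 1
  inv := yPow i (-1)
  val_inv := by rw [← yPow_add]; exact yPow_zero i
  inv_val := by rw [← yPow_add]; exact yPow_zero i

lemma yUnit_zpow (i : ℕ) (m : ℤ) : ((yUnit i ^ m : (Lau K)ˣ) : Lau K) = yPow i m := by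
  induction m using Int.induction_on with
  | zero => simp [yPow_zero]
  | succ n ih => rw [zpow_add_one, Units.val_mul, ih, yPow_add]; rfl
  | pred n ih => rw [zpow_sub_one, Units.val_mul, ih, sub_eq_add_neg, yPow_add]; rfl

lemma yUnit_val (i : ℕ) : ((yUnit i : (Lau K)ˣ) : Lau K) = yVar i := rfl

variable {S : Type*} [CommRing S]

/-- The evaluation of Laurent monomials at units. -/
def monoEval (Y : ℕ → Sˣ) : Multiplicative (ℕ →₀ ℤ) →* Sˣ :=
  AddMonoidHom.toMultiplicativeLeft
    (Finsupp.liftAddHom fun i => zmultiplesHom (Additive Sˣ) (Additive.ofMul (Y i)))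

lemma monoEval_single (Y : ℕ → Sˣ) (i : ℕ) (m : ℤ) :
    monoEval Y (Multiplicative.ofAdd (Finsupp.single i m)) = Y i ^ m := by
  simp [monoEval, AddMonoidHom.toMultiplicativeLeft]

lemma monoEval_add (Y : ℕ → Sˣ) (a b : ℕ →₀ ℤ) :
    monoEval Y (Multiplicative.ofAdd (a + b))
      = monoEval Y (Multiplicative.ofAdd a) * monoEval Y (Multiplicative.ofAdd b) :=
  map_mul (monoEval Y) (Multiplicative.ofAdd a) (Multiplicative.ofAdd b)

variable [Algebra K S]

/-- The homomorphism with the given values of the `p_n` and the `y_i`. -/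
def evalHom (P : ℕ → S) (Y : ℕ → Sˣ) : Lau K →ₐ[K] S :=
  AddMonoidAlgebra.liftNCAlgHom (MvPolynomial.aeval P) ((Units.coeHom S).comp (monoEval Y))
    (fun _ _ => Commute.all _ _)

lemma evalHom_single (P : ℕ → S) (Y : ℕ → Sˣ) (a : ℕ →₀ ℤ) (c : SymFun K) :
    evalHom P Y (AddMonoidAlgebra.single a c)
      = MvPolynomial.aeval P c * (monoEval Y (Multiplicative.ofAdd a) : Sˣ) := by
  simp [evalHom]

lemma evalHom_pSum (P : ℕ → S) (Y : ℕ → Sˣ) (n : ℕ) :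
    evalHom (K := K) P Y (pSum n) = P n := by
  simp [pSum, evalHom_single]

lemma evalHom_yPow (P : ℕ → S) (Y : ℕ → Sˣ) (i : ℕ) (m : ℤ) :
    evalHom (K := K) P Y (yPow i m) = (Y i ^ m : Sˣ) := by
  simp [yPow, evalHom_single, monoEval_single]

lemma evalHom_yVar (P : ℕ → S) (Y : ℕ → Sˣ) (i : ℕ) :
    evalHom (K := K) P Y (yVar i) = Y i := by
  simp [yVar, evalHom_yPow]

lemma single_eq_cst_mul (a : ℕ →₀ ℤ) (c : SymFun K) :
    (AddMonoidAlgebra.single a c : Lau K) = cst c * AddMonoidAlgebra.single a 1 := by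
  simp [cst_apply, AddMonoidAlgebra.single_mul_single]

lemma single_eq_monoEval (a : ℕ →₀ ℤ) :
    (AddMonoidAlgebra.single a 1 : Lau K)
      = (monoEval (fun i => (yUnit i : (Lau K)ˣ)) (Multiplicative.ofAdd a) : (Lau K)ˣ) := by
  induction a using Finsupp.induction_linear with
  | zero => simp [AddMonoidAlgebra.one_def]
  | add a b ha hb =>
    rw [monoEval_add, Units.val_mul, ← ha, ← hb, AddMonoidAlgebra.single_mul_single, one_mul]
  | single i m => rw [monoEval_single, yUnit_zpow, yPow]

/-- Negative powers cause no difficulty: a homomorphism maps the unit `y_i` to a unit, whose inverse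
is determined. -/
lemma algHom_yPow_congr {f g : Lau K →ₐ[K] S} {i : ℕ} (h : f (yVar i) = g (yVar i)) (m : ℤ) :
    f (yPow i m) = g (yPow i m) := by
  have h' : Units.map (f : Lau K →* S) (yUnit i) = Units.map (g : Lau K →* S) (yUnit i) :=
    Units.ext h
  have := congrArg (fun u : Sˣ => ((u ^ m : Sˣ) : S)) h'
  simpa only [← map_zpow, Units.coe_map, yUnit_zpow, MonoidHom.coe_coe] using this

lemma algHom_cst_congr {f g : Lau K →ₐ[K] S} (hp : ∀ n, f (pSum n) = g (pSum n)) (c : SymFun K) :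
    f (cst c) = g (cst c) := by
  have : f.comp cst = g.comp cst := MvPolynomial.algHom_ext fun n => hp n
  exact DFunLike.congr_fun this c

/-- Two homomorphisms agree on the Laurent polynomials in `y_i`, `i ∈ s`, if they agree on the
power sums and these variables. -/
lemma algHom_eq_of_supp {f g : Lau K →ₐ[K] S} (hp : ∀ n, f (pSum n) = g (pSum n)) {s : Set ℕ}
    (hy : ∀ i ∈ s, f (yVar i) = g (yVar i)) {F : Lau K}
    (hF : ∀ a, F.coeff a ≠ 0 → ∀ i, a i ≠ 0 → i ∈ s) : f F = g F := by
  have hmono : ∀ a : ℕ →₀ ℤ, (∀ i, a i ≠ 0 → i ∈ s) →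
      f (AddMonoidAlgebra.single a 1) = g (AddMonoidAlgebra.single a 1) := by
    intro a
    induction a using Finsupp.induction with
    | zero => intro _; simp [← AddMonoidAlgebra.one_def]
    | single_add i m a hi hm ih =>
      intro h
      have e : (AddMonoidAlgebra.single (Finsupp.single i m + a) 1 : Lau K)
          = yPow i m * AddMonoidAlgebra.single a 1 := by
        simp [yPow, AddMonoidAlgebra.single_mul_single]
      have hi0 : a i = 0 := by simpa using hi
      rw [e, map_mul, map_mul, algHom_yPow_congr (hy i (h i (by simpa [hi0] using hm))), ih]
      intro j hj
      refine h j ?_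
      have : j ≠ i := fun h => hj (h ▸ hi0)
      simpa [Finsupp.single_apply, this.symm] using hj
  have hsum : F = F.coeff.sum fun a c => (AddMonoidAlgebra.single a c : Lau K) :=
    (AddMonoidAlgebra.sum_coeff_single F).symm
  rw [hsum, Finsupp.sum, map_sum, map_sum]
  refine Finset.sum_congr rfl fun a ha => ?_
  rw [single_eq_cst_mul, map_mul, map_mul, algHom_cst_congr hp,
    hmono a (hF a (Finsupp.mem_support_iff.mp ha))]

lemma lau_algHom_ext {f g : Lau K →ₐ[K] S} (hp : ∀ n, f (pSum n) = g (pSum n))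
    (hy : ∀ i, f (yVar i) = g (yVar i)) : f = g :=
  AlgHom.ext fun _ => algHom_eq_of_supp (s := Set.univ) hp (fun i _ => hy i)
    fun _ _ _ _ => trivial

/-- `s_i` as a homomorphism. -/
def swapHom (i : ℕ) : Lau K →ₐ[K] Lau K :=
  evalHom pSum fun j => yUnit (Equiv.swap i (i + 1) j)

/-- `F ↦ F[X + ε (q - 1) y_j]` as a homomorphism. -/
def plethHom (q ε : K) (j : ℕ) : Lau K →ₐ[K] Lau K :=
  evalHom (fun n => pSum n + (ε * (q ^ (n + 1) - 1)) • yVar j ^ (n + 1)) yUnit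

/-- `γ` as a homomorphism. -/
def gammaHom {t : K} (ht : t ≠ 0) (k : ℕ) : Lau K →ₐ[K] Lau K :=
  evalHom pSum fun i =>
    if i = k + 1 then Units.map (algebraMap K (Lau K) : K →* Lau K) (Units.mk0 t ht) * yUnit 1
    else yUnit (i + 1)

lemma aeval_pSum (c : SymFun K) : MvPolynomial.aeval (pSum : ℕ → Lau K) c = cst c := by
  have : (MvPolynomial.aeval (pSum : ℕ → Lau K)) = cst :=
    MvPolynomial.algHom_ext fun n => by simp [cst_X]
  rw [this]

lemma monoEval_mapDomain (σ : ℕ → ℕ) (a : ℕ →₀ ℤ) :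
    (monoEval (fun i => (yUnit (σ i) : (Lau K)ˣ)) (Multiplicative.ofAdd a) : (Lau K)ˣ)
      = (AddMonoidAlgebra.single (a.mapDomain σ) 1 : Lau K) := by
  induction a using Finsupp.induction_linear with
  | zero => simp [AddMonoidAlgebra.one_def]
  | add a b ha hb =>
    rw [monoEval_add, Units.val_mul, ha, hb, AddMonoidAlgebra.single_mul_single, one_mul,
      Finsupp.mapDomain_add]
  | single i m => rw [monoEval_single, yUnit_zpow, Finsupp.mapDomain_single, yPow]

lemma swapY_eq (i : ℕ) (F : Lau K) : swapY i F = swapHom i F := by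
  induction F using AddMonoidAlgebra.induction_linear with
  | zero => simp [swapY]
  | add F G hF hG => rw [swapY_add, hF, hG, map_add]
  | single a c =>
    rw [swapY_single, swapHom, evalHom_single, aeval_pSum, monoEval_mapDomain, ← single_eq_cst_mul]

lemma yVar_pow (i n : ℕ) : (yVar i ^ n : Lau K) = yPow i n := by
  rw [← yUnit_zpow, zpow_natCast, Units.val_pow_eq_pow_val, yUnit_val]

lemma pleth_eq (q ε : K) (j : ℕ) (F : Lau K) : pleth q ε j F = plethHom q ε j F := by
  induction F using AddMonoidAlgebra.induction_linear with
  | zero => simp [pleth]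
  | add F G hF hG =>
    rw [map_add, ← hF, ← hG, pleth, pleth, pleth, AddMonoidAlgebra.coeff_add,
      Finsupp.sum_add_index']
    · simp
    · intros; rw [map_add, add_mul]
  | single a c =>
    have : (fun n : ℕ => (pSum n + (ε * (q ^ (n + 1) - 1)) • yVar j ^ (n + 1) : Lau K))
        = fun n : ℕ => (AddMonoidAlgebra.single 0 (MvPolynomial.X n) : Lau K)
          + (ε * (q ^ (n + 1) - 1)) • yPow j ((n : ℤ) + 1) := by
      funext n
      rw [yVar_pow]
      rfl
    rw [plethHom, evalHom_single, this, ← single_eq_monoEval]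
    simp [pleth]

lemma gammaOp_eq {t : K} (ht : t ≠ 0) (k : ℕ) (F : Lau K) :
    gammaOp t k F = gammaHom ht k F := by
  induction F using AddMonoidAlgebra.induction_linear with
  | zero => simp [gammaOp]
  | add F G hF hG =>
    rw [map_add, ← hF, ← hG, gammaOp, gammaOp, gammaOp, AddMonoidAlgebra.coeff_add,
      Finsupp.sum_add_index']
    · simp
    · intros; rw [smul_add, AddMonoidAlgebra.single_add]
  | single a c =>
    have key : ∀ a : ℕ →₀ ℤ, ((monoEval (fun i => if i = k + 1 then
          Units.map (algebraMap K (Lau K) : K →* Lau K) (Units.mk0 t ht) * yUnit 1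
          else yUnit (i + 1)) (Multiplicative.ofAdd a) : (Lau K)ˣ) : Lau K)
        = t ^ (a (k + 1)) • (AddMonoidAlgebra.single
            (a.mapDomain fun i => if i = k + 1 then 1 else i + 1) 1 : Lau K) := by
      intro a
      induction a using Finsupp.induction_linear with
      | zero => simp [AddMonoidAlgebra.one_def]
      | add a b ha hb =>
        rw [monoEval_add, Units.val_mul, ha, hb, smul_mul_smul_comm,
          AddMonoidAlgebra.single_mul_single, one_mul, Finsupp.mapDomain_add, Finsupp.add_apply,
          zpow_add₀ ht]
      | single i m =>
        rw [monoEval_single, Finsupp.mapDomain_single]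
        split_ifs with h
        · subst h
          have h := mul_zpow (Units.map (algebraMap K (Lau K) : K →* Lau K) (Units.mk0 t ht))
            (yUnit 1) m
          refine (congrArg Units.val h).trans ?_
          rw [Units.val_mul, yUnit_zpow, ← map_zpow, Units.coe_map, Finsupp.single_eq_same]
          simp [yPow, Algebra.smul_def]
        · rw [yUnit_zpow]
          simp [h, yPow]
    rw [gammaHom, evalHom_single, aeval_pSum, key, mul_smul_comm, ← single_eq_cst_mul]
    simp [gammaOp, AddMonoidAlgebra.smul_single]

lemma plethHom_pSum (q ε : K) (j n : ℕ) : plethHom q ε j (pSum n)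
    = pSum n + (ε * (q ^ (n + 1) - 1)) • yVar j ^ (n + 1) := evalHom_pSum _ _ _

lemma plethHom_yVar (q ε : K) (j i : ℕ) : plethHom q ε j (yVar i) = yVar i := evalHom_yVar _ _ _

lemma swapHom_pSum (i n : ℕ) : swapHom i (pSum n : Lau K) = pSum n := evalHom_pSum _ _ _

lemma swapHom_yVar (i j : ℕ) :
    swapHom i (yVar j : Lau K) = yVar (Equiv.swap i (i + 1) j) := evalHom_yVar _ _ _

lemma gammaHom_pSum {t : K} (ht : t ≠ 0) (k n : ℕ) : gammaHom ht k (pSum n) = pSum n :=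
  evalHom_pSum _ _ _

lemma gammaHom_yVar {t : K} (ht : t ≠ 0) (k i : ℕ) :
    gammaHom ht k (yVar i) = if i = k + 1 then t • yVar 1 else yVar (i + 1) := by
  rw [gammaHom, evalHom_yVar]
  split_ifs
  · simp [Algebra.smul_def, yUnit_val]
  · rfl

end LauHom

/-! ### The Demazure–Lusztig operators satisfy the affine Hecke relations -/

section HeckeT

variable {K : Type*} [Field K]

lemma yVar_sub_ne_zero {i j : ℕ} (h : i ≠ j) : (yVar i - yVar j : Lau K) ≠ 0 := by
  rw [sub_ne_zero]
  intro h'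
  have h1 : (yVar i : Lau K).coeff (Finsupp.single i 1) = 1 := by simp [yVar, yPow]
  rw [h'] at h1
  have h2 : Finsupp.single j (1 : ℤ) ≠ Finsupp.single i 1 := by
    rw [Ne, Finsupp.single_left_inj one_ne_zero]
    exact h.symm
  simp [yVar, yPow, h2] at h1

lemma yPow_neg_one_mul (i : ℕ) : (yPow i (-1) * yVar i : Lau K) = 1 := (yUnit i).inv_val

lemma swapHom_swapHom (i : ℕ) (F : Lau K) : swapHom i (swapHom i F) = F := by
  have : (swapHom i).comp (swapHom i) = AlgHom.id K (Lau K) :=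
    lau_algHom_ext (fun n => by simp [swapHom_pSum]) fun j => by simp [swapHom_yVar]
  exact DFunLike.congr_fun this F

lemma swapHom_left (i : ℕ) : swapHom i (yVar i : Lau K) = yVar (i + 1) := by
  simp [swapHom_yVar]

lemma swapHom_right (i : ℕ) : swapHom i (yVar (i + 1) : Lau K) = yVar i := by
  simp [swapHom_yVar]

lemma swapHom_ne {i j : ℕ} (h1 : j ≠ i) (h2 : j ≠ i + 1) :
    swapHom i (yVar j : Lau K) = yVar j := by
  rw [swapHom_yVar, Equiv.swap_apply_of_ne_of_ne h1 h2]

lemma swapHom_braid (i : ℕ) (F : Lau K) :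
    swapHom i (swapHom (i + 1) (swapHom i F)) = swapHom (i + 1) (swapHom i (swapHom (i + 1) F)) := by
  have : (swapHom i).comp ((swapHom (i + 1)).comp (swapHom i))
      = (swapHom (i + 1)).comp ((swapHom i).comp (swapHom (i + 1) : Lau K →ₐ[K] Lau K)) :=
    lau_algHom_ext (fun n => by simp [swapHom_pSum]) fun j => by
      simp only [AlgHom.comp_apply, swapHom_yVar]
      congr 1
      simp only [Equiv.swap_apply_def]
      split_ifs <;> omega
  exact DFunLike.congr_fun this F

lemma swapHom_comm {i j : ℕ} (h : i + 1 < j) (F : Lau K) :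
    swapHom i (swapHom j F) = swapHom j (swapHom i F) := by
  have : (swapHom i).comp (swapHom j) = (swapHom j).comp (swapHom i : Lau K →ₐ[K] Lau K) :=
    lau_algHom_ext (fun n => by simp [swapHom_pSum]) fun l => by
      simp only [AlgHom.comp_apply, swapHom_yVar]
      congr 1
      simp only [Equiv.swap_apply_def]
      split_ifs <;> omega
  exact DFunLike.congr_fun this F

lemma heckeT_eq (q : K) (i : ℕ) (F : Lau K) : (yVar (i + 1) - yVar i) * heckeT q i F
    = (algebraMap K (Lau K) q - 1) * (yVar i * F)
      + (yVar (i + 1) - algebraMap K (Lau K) q * yVar i) * swapHom i F := by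
  rw [heckeT_spec, swapY_eq, Algebra.smul_def, Algebra.smul_def, map_sub, map_one]

/-- Laurent polynomials form an integral domain, so the divided difference is characterised by its
product with the denominator. The identities below are proved in this cleared form. -/
lemma heckeT_unique {q : K} {i : ℕ} {F G : Lau K} (h : (yVar (i + 1) - yVar i) * G
    = (algebraMap K (Lau K) q - 1) * (yVar i * F)
      + (yVar (i + 1) - algebraMap K (Lau K) q * yVar i) * swapHom i F) : heckeT q i F = G :=
  mul_left_cancel₀ (yVar_sub_ne_zero (by omega)) ((heckeT_eq q i F).trans h.symm)

lemma heckeT_add (q : K) (i : ℕ) (F G : Lau K) :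
    heckeT q i (F + G) = heckeT q i F + heckeT q i G :=
  heckeT_unique (by rw [mul_add, heckeT_eq, heckeT_eq, map_add]; ring)

/-- Functions invariant under `s_i` are scalars for `T_i`. -/
lemma heckeT_mul (q : K) (i : ℕ) {c : Lau K} (hc : swapHom i c = c) (F : Lau K) :
    heckeT q i (c * F) = c * heckeT q i F :=
  heckeT_unique (by rw [mul_left_comm, heckeT_eq, map_mul, hc]; ring)

lemma heckeT_smul (q : K) (i : ℕ) (c : K) (F : Lau K) :
    heckeT q i (c • F) = c • heckeT q i F := by
  rw [Algebra.smul_def, Algebra.smul_def, heckeT_mul q i (AlgHom.commutes _ _)]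

/-- `T_i` as a linear map. -/
def heckeTL (q : K) (i : ℕ) : Lau K →ₗ[K] Lau K where
  toFun := heckeT q i
  map_add' := heckeT_add q i
  map_smul' := heckeT_smul q i

lemma heckeT_one (q : K) (i : ℕ) : heckeT q i (1 : Lau K) = 1 :=
  heckeT_unique (by rw [map_one]; ring)

lemma heckeT_of_swap (q : K) (i : ℕ) {F : Lau K} (h : swapHom i F = F) : heckeT q i F = F := by
  conv_lhs => rw [← mul_one F, heckeT_mul q i h, heckeT_one, mul_one]

lemma heckeT_yVar_succ_mul (q : K) (i : ℕ) (F : Lau K) : heckeT q i (yVar (i + 1) * F)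
    = yVar i * heckeT q i F + (algebraMap K (Lau K) q - 1) * (yVar i * F) :=
  heckeT_unique (by
    rw [mul_add, mul_left_comm _ (yVar i) (heckeT q i F), heckeT_eq, map_mul, swapHom_right]
    ring)

lemma heckeT_yVar_mul (q : K) (i : ℕ) (F : Lau K) : heckeT q i (yVar i * F)
    = yVar (i + 1) * heckeT q i F - (algebraMap K (Lau K) q - 1) * (yVar i * F) :=
  heckeT_unique (by
    rw [mul_sub, mul_left_comm _ (yVar (i + 1)) (heckeT q i F), heckeT_eq, map_mul, swapHom_left]
    ring)

lemma heckeT_heckeT (q : K) (i : ℕ) (F : Lau K) :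
    heckeT q i (heckeT q i F) = q • F - (q - 1) • heckeT q i F := by
  have h1 := heckeT_eq q i F
  have h2 := heckeT_eq q i (heckeT q i F)
  have h3 := congrArg (swapHom i) h1
  simp only [map_mul, map_sub, map_add, swapHom_left, swapHom_right, swapHom_swapHom,
    AlgHom.commutes, map_one] at h3
  have h0 : (yVar (i + 1) - yVar i : Lau K) ≠ 0 := yVar_sub_ne_zero (by omega)
  rw [Algebra.smul_def, Algebra.smul_def, map_sub, map_one]
  generalize algebraMap K (Lau K) q = c at *
  -- The square involves `s_i (T_i F)`, which has a denominator of its own; `h3`, the image of `h1`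
  -- under `s_i`, removes it. Hence two cancellations.
  refine mul_left_cancel₀ h0 (mul_left_cancel₀ h0 ?_)
  linear_combination (yVar (i + 1) - yVar i) * h2
    + ((c - 1) * yVar i + (c - 1) * (yVar (i + 1) - yVar i)) * h1
    - (yVar (i + 1) - c * yVar i) * h3

lemma heckeT_y_heckeT (q : K) (i : ℕ) (F : Lau K) :
    heckeT q i (yVar (i + 1) * heckeT q i F) = q • (yVar i * F) := by
  rw [heckeT_yVar_succ_mul, heckeT_heckeT]
  simp only [Algebra.smul_def, map_sub, map_one]
  ring

/-- A homomorphism intertwining `s_i`, `s_j` intertwines `T_i`, `T_j`. -/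
lemma heckeT_algHom {q : K} {i j : ℕ} {f : Lau K →ₐ[K] Lau K} (h1 : f (yVar i) = yVar j)
    (h2 : f (yVar (i + 1)) = yVar (j + 1)) {F : Lau K}
    (hs : f (swapHom i F) = swapHom j (f F)) : heckeT q j (f F) = f (heckeT q i F) := by
  refine heckeT_unique ?_
  have h := congrArg f (heckeT_eq q i F)
  simp only [map_mul, map_sub, map_add, h1, h2, hs, AlgHom.commutes, map_one] at h
  exact h

/-- The operator `T_j` commutes with `s_i` and is linear over functions of `y_i, y_{i+1}`, so it can
be applied to the defining equation of `T_i`. -/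
lemma heckeT_comm (q : K) {i j : ℕ} (h : i + 1 < j) (F : Lau K) :
    heckeT q i (heckeT q j F) = heckeT q j (heckeT q i F) := by
  have e1 : swapHom i (heckeT q j F) = heckeT q j (swapHom i F) :=
    (heckeT_algHom (swapHom_ne (by omega) (by omega)) (swapHom_ne (by omega) (by omega))
      (swapHom_comm h F)).symm
  refine heckeT_unique ?_
  have hd : swapHom j (yVar (i + 1) - yVar i : Lau K) = yVar (i + 1) - yVar i := by
    rw [map_sub, swapHom_ne (by omega) (by omega), swapHom_ne (by omega) (by omega)]
  have hi : swapHom j ((algebraMap K (Lau K) q - 1) * yVar i)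
      = (algebraMap K (Lau K) q - 1) * yVar i := by
    rw [map_mul, map_sub, AlgHom.commutes, map_one, swapHom_ne (by omega) (by omega)]
  have hi' : swapHom j (yVar (i + 1) - algebraMap K (Lau K) q * yVar i)
      = yVar (i + 1) - algebraMap K (Lau K) q * yVar i := by
    rw [map_sub, map_mul, AlgHom.commutes, swapHom_ne (by omega) (by omega),
      swapHom_ne (by omega) (by omega)]
  rw [← heckeT_mul q j hd, heckeT_eq, heckeT_add, ← mul_assoc, heckeT_mul q j hi,
    heckeT_mul q j hi', e1, mul_assoc]

/-- `F, F1, F2, F12, F21, F0` stand for the `S_3`-orbit of a function. The hypotheses are the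
defining equations of the inner operators and their permuted copies; solving them one after another
in a field turns the braid relation into an identity of rational functions. -/
lemma braid_aux {L : Type*} [Field L] {q x y z : L} (hxy : y - x ≠ 0) (hyz : z - y ≠ 0)
    (hxz : z - x ≠ 0) {F F1 F2 F12 F21 F0 A A1 A2 A12 G G1 H B B1 B2 B21 G' G2 H' : L}
    (hA : (y - x) * A = (q - 1) * (x * F) + (y - q * x) * F1)
    (hA2 : (z - x) * A2 = (q - 1) * (x * F2) + (z - q * x) * F21)
    (hA1 : (x - y) * A1 = (q - 1) * (y * F1) + (x - q * y) * F)
    (hA12 : (z - y) * A12 = (q - 1) * (y * F12) + (z - q * y) * F0)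
    (hG : (z - y) * G = (q - 1) * (y * A) + (z - q * y) * A2)
    (hG1 : (z - x) * G1 = (q - 1) * (x * A1) + (z - q * x) * A12)
    (hH : (y - x) * H = (q - 1) * (x * G) + (y - q * x) * G1)
    (hB : (z - y) * B = (q - 1) * (y * F) + (z - q * y) * F2)
    (hB1 : (z - x) * B1 = (q - 1) * (x * F1) + (z - q * x) * F12)
    (hB2 : (y - z) * B2 = (q - 1) * (z * F2) + (y - q * z) * F)
    (hB21 : (y - x) * B21 = (q - 1) * (x * F21) + (y - q * x) * F0)
    (hG' : (y - x) * G' = (q - 1) * (x * B) + (y - q * x) * B1)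
    (hG2 : (z - x) * G2 = (q - 1) * (x * B2) + (z - q * x) * B21)
    (hH' : (z - y) * H' = (q - 1) * (y * G') + (z - q * y) * G2) : H = H' := by
  have hyx : x - y ≠ 0 := fun h => hxy (by linear_combination -h)
  have hzy : y - z ≠ 0 := fun h => hyz (by linear_combination -h)
  rw [mul_comm, ← eq_div_iff hxy] at hA hB21 hH hG'
  rw [mul_comm, ← eq_div_iff hyx] at hA1
  rw [mul_comm, ← eq_div_iff hxz] at hA2 hG1 hB1 hG2
  rw [mul_comm, ← eq_div_iff hyz] at hA12 hG hB hH'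
  rw [mul_comm, ← eq_div_iff hzy] at hB2
  subst hA hA1 hA2 hA12 hB hB1 hB2 hB21 hG hG1 hG' hG2 hH hH'
  field_simp
  ring

lemma heckeT_braid (q : K) (i : ℕ) (F : Lau K) :
    heckeT q i (heckeT q (i + 1) (heckeT q i F))
      = heckeT q (i + 1) (heckeT q i (heckeT q (i + 1) F)) := by
  have e1 : swapHom (i + 1) (yVar i : Lau K) = yVar i := swapHom_ne (by omega) (by omega)
  have e2 : swapHom i (yVar (i + 1 + 1) : Lau K) = yVar (i + 1 + 1) :=
    swapHom_ne (by omega) (by omega)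
  have simpset : ∀ {j} {F G : Lau K}, F = G → swapHom j F = swapHom j G := fun h => by rw [h]
  have hA := heckeT_eq q i F
  have hA2 := simpset (j := i + 1) hA
  have hA1 := simpset (j := i) hA
  have hA12 := simpset (j := i) hA2
  have hG := heckeT_eq q (i + 1) (heckeT q i F)
  have hG1 := simpset (j := i) hG
  have hH := heckeT_eq q i (heckeT q (i + 1) (heckeT q i F))
  have hB := heckeT_eq q (i + 1) F
  have hB1 := simpset (j := i) hB
  have hB2 := simpset (j := i + 1) hB
  have hB21 := simpset (j := i + 1) hB1
  have hG' := heckeT_eq q i (heckeT q (i + 1) F)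
  have hG2 := simpset (j := i + 1) hG'
  have hH' := heckeT_eq q (i + 1) (heckeT q i (heckeT q (i + 1) F))
  simp only [map_mul, map_sub, map_add, swapHom_left, swapHom_right, swapHom_swapHom, e1, e2,
    AlgHom.commutes, map_one, swapHom_braid] at hA hA1 hA2 hA12 hG hG1 hH hB hB1 hB2 hB21 hG' hG2 hH'
  -- The defining equations are solved for the quotients in the fraction field, into which the
  -- Laurent polynomials embed.
  set φ := algebraMap (Lau K) (FractionRing (Lau K))
  have hφ : Function.Injective φ := IsFractionRing.injective _ _
  have hne : ∀ {i j : ℕ}, i ≠ j → φ (yVar i) - φ (yVar j) ≠ 0 := fun h => by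
    rw [← map_sub]
    exact (map_ne_zero_iff φ hφ).mpr (yVar_sub_ne_zero h)
  have lift : ∀ {F G : Lau K}, F = G → φ F = φ G := fun h => by rw [h]
  replace hA := lift hA
  replace hA1 := lift hA1
  replace hA2 := lift hA2
  replace hA12 := lift hA12
  replace hG := lift hG
  replace hG1 := lift hG1
  replace hH := lift hH
  replace hB := lift hB
  replace hB1 := lift hB1
  replace hB2 := lift hB2
  replace hB21 := lift hB21
  replace hG' := lift hG'
  replace hG2 := lift hG2
  replace hH' := lift hH'
  simp only [map_mul, map_sub, map_add, map_one]
    at hA hA1 hA2 hA12 hG hG1 hH hB hB1 hB2 hB21 hG' hG2 hH'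
  exact hφ (braid_aux (hne (by omega)) (hne (by omega)) (hne (by omega)) hA hA2 hA1 hA12 hG hG1
    hH hB hB1 hB2 hB21 hG' hG2 hH')

end HeckeT

/-! ### The plethystic exponential and its behaviour under shifts -/

section ExpSeries

open PowerSeries

variable {K : Type*} [Field K] [CharZero K]

lemma constantCoeff_pExpNeg : constantCoeff (pExpNeg K) = 1 := by
  have hs : (1 : PowerSeries (SymFun K)).subst (PowerSeries.mk fun n : ℕ =>
      if n = 0 then (0 : SymFun K) else -((n : K)⁻¹ • MvPolynomial.X (n - 1))) = 1 := by
    rw [← PowerSeries.coe_substAlgHom (HasSubst.of_constantCoeff_zero' (by simp)), map_one]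
  have h0 : constantCoeff (PowerSeries.mk fun n : ℕ =>
      if n = 0 then (0 : SymFun K) else -((n : K)⁻¹ • MvPolynomial.X (n - 1))) = 0 := by simp
  have h := constantCoeff_subst_eq_zero (a := PowerSeries.mk fun n : ℕ =>
      if n = 0 then (0 : SymFun K) else -((n : K)⁻¹ • MvPolynomial.X (n - 1)))
    h0 (exp (SymFun K) - 1) (by simp)
  rw [PowerSeries.subst_sub (HasSubst.of_constantCoeff_zero' (by simp)), hs] at h
  have h' : constantCoeff (pExpNeg K - 1) = 0 := h
  rwa [map_sub, map_one, sub_eq_zero] at h'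

/-- The logarithmic derivative is `-∑ p_{n+1} u^n`, linear in the power sums. Identities between
exponentials thus become first-order differential equations, and their infinite products are never
needed. -/
lemma derivative_pExpNeg : d⁄dX (SymFun K) (pExpNeg K)
    = -(PowerSeries.mk fun n => (MvPolynomial.X n : SymFun K)) * pExpNeg K := by
  rw [pExpNeg, derivative_subst (HasSubst.of_constantCoeff_zero' (by simp)), derivative_exp,
    mul_comm]
  congr 1
  ext n : 1
  rw [coeff_derivative]
  have h : ((n : K) + 1) ≠ 0 := by exact_mod_cast n.succ_ne_zero
  have h2 : ((n : SymFun K) + 1) = MvPolynomial.C ((n : K) + 1) := by simp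
  simp only [coeff_mk, map_neg, Nat.succ_ne_zero, if_false, Nat.add_sub_cancel, Nat.cast_add,
    Nat.cast_one]
  rw [h2, MvPolynomial.smul_eq_C_mul, neg_mul, mul_right_comm, ← map_mul, inv_mul_cancel₀ h]
  simp

/-- `Exp[-uX]` for the values `P n` of the power sums `p_{n+1}`. -/
def expPS {S : Type*} [CommRing S] [Algebra K S] (P : ℕ → S) : PowerSeries S :=
  PowerSeries.map (MvPolynomial.aeval (R := K) P : SymFun K →ₐ[K] S).toRingHom (pExpNeg K)

section
variable {S : Type*} [CommRing S] [Algebra K S]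

lemma constantCoeff_expPS (P : ℕ → S) : constantCoeff (expPS (K := K) P) = 1 := by
  rw [expPS, ← coeff_zero_eq_constantCoeff_apply, coeff_map, coeff_zero_eq_constantCoeff_apply,
    constantCoeff_pExpNeg, map_one]

lemma derivative_expPS (P : ℕ → S) :
    d⁄dX S (expPS (K := K) P) = -(PowerSeries.mk P) * expPS (K := K) P := by
  have h : d⁄dX S (expPS (K := K) P)
      = PowerSeries.map (MvPolynomial.aeval (R := K) P : SymFun K →ₐ[K] S).toRingHom
        (d⁄dX (SymFun K) (pExpNeg K)) := by
    ext n
    simp [expPS, coeff_derivative]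
  rw [h, derivative_pExpNeg, map_mul, map_neg]
  congr 2
  ext n
  simp

/-- The equation expresses `n + 1` times the coefficient of degree `n + 1` by lower ones, and `n +
1` is a unit in characteristic zero. -/
lemma eq_of_derivative (L : Type*) {S : Type*} [Field L] [CharZero L] [CommRing S] [Algebra L S] {F G H : PowerSeries S} (h0 : constantCoeff F = constantCoeff G)
    (hF : d⁄dX S F = H * F) (hG : d⁄dX S G = H * G) : F = G := by
  have key : ∀ n, coeff n F = coeff n G := by
    intro n
    induction n using Nat.strong_induction_on with
    | _ n ih =>
      cases n with
      | zero => simpa using h0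
      | succ n =>
        have e : coeff n (H * F) = coeff n (H * G) := by
          rw [coeff_mul, coeff_mul]
          refine Finset.sum_congr rfl fun p hp => ?_
          rw [ih p.2 (by have := Finset.HasAntidiagonal.mem_antidiagonal.mp hp; omega)]
        rw [← hF, ← hG, coeff_derivative, coeff_derivative] at e
        have hn : ((n : L) + 1) ≠ 0 := by exact_mod_cast n.succ_ne_zero
        have hu : IsUnit ((n : S) + 1) := by
          have := (IsUnit.mk0 _ hn).map (algebraMap L S)
          simpa using this
        exact hu.mul_right_cancel e
  ext n
  exact key n

lemma mk_pow_mul (x : S) : PowerSeries.mk (fun n => x ^ n) * (1 - C x * X) = 1 := by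
  have : C x * X = rescale x (X : PowerSeries S) := by rw [rescale_X]
  have h2 : PowerSeries.mk (fun n => x ^ n) = rescale x (PowerSeries.mk 1) := by
    ext n; simp
  rw [this, h2, ← map_one (rescale x), ← map_sub, ← map_mul, mk_one_mul_one_sub_eq_one, map_one]

/-- Shifting the power sums by `(q^n - 1) x^n` changes `Exp[-uX]` by the factor
`(1 - q x u) / (1 - x u)`. -/
lemma expPS_mul {q : K} {P P' : ℕ → S} {x : S}
    (h : ∀ n, P' n = P n + (q ^ (n + 1) - 1) • x ^ (n + 1)) :
    expPS (K := K) P' * (1 - C x * X) = expPS (K := K) P * (1 - C (q • x) * X) := by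
  have hd : ∀ x : S, d⁄dX S (1 - C x * X : PowerSeries S) = -C x := by
    intro x
    rw [map_sub, Derivation.leibniz, derivative_X, derivative_one, derivative_C]
    simp
  have hm : PowerSeries.mk P' = PowerSeries.mk P + C (q • x) * PowerSeries.mk (fun n => (q • x) ^ n)
      - C x * PowerSeries.mk (fun n => x ^ n) := by
    ext n
    simp only [coeff_mk, map_sub, map_add, coeff_C_mul, h, sub_smul, one_smul, ← pow_succ',
      ← smul_pow]
    ring
  have h1 := mk_pow_mul x
  have h2 := mk_pow_mul (q • x)
  -- Both sides solve the equation with the part of the logarithmic derivative that is left after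
  -- `1/(1 - xu)`, respectively `1/(1 - qxu)`, has been cancelled.
  refine eq_of_derivative K
    (H := -(PowerSeries.mk P + C (q • x) * PowerSeries.mk (fun n => (q • x) ^ n)))
    (by simp [constantCoeff_expPS]) ?_ ?_
  · rw [Derivation.leibniz, hd, derivative_expPS, hm, smul_eq_mul, smul_eq_mul]
    linear_combination (expPS (K := K) P') * C x * h1
  · rw [Derivation.leibniz, hd, derivative_expPS, smul_eq_mul, smul_eq_mul]
    linear_combination (expPS (K := K) P) * C (q • x) * h2

lemma map_expPS {S' : Type*} [CommRing S'] [Algebra K S'] (g : S →ₐ[K] S') (P : ℕ → S) :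
    PowerSeries.map (g : S →+* S') (expPS (K := K) P) = expPS (K := K) fun n => g (P n) := by
  have : (MvPolynomial.aeval (R := K) (fun n => g (P n)))
      = g.comp (MvPolynomial.aeval (R := K) P) := by
    refine MvPolynomial.algHom_ext fun n => by simp
  ext n
  simp only [expPS, coeff_map, this]
  rfl

end

end ExpSeries
end DyckPath
end

noncomputable section

namespace DyckPath

/-! ### Laurent series in `w⁻¹` and leading terms -/

section Residue

variable {K : Type*} [Field K] {S : Type*} [CommRing S] [Algebra K S]
  {S' : Type*} [CommRing S'] [Algebra K S']

/-- Laurent series over a `K`-algebra form a `K`-algebra. -/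
instance lsAlgebra : Algebra K (LaurentSeries S) := HahnSeries.instAlgebra

variable (K S) in
/-- The constants in the ring of Laurent series `S((w⁻¹))`. -/
def lsC : S →ₐ[K] LaurentSeries S :=
  { HahnSeries.C with commutes' := fun _ => rfl }

lemma coeff_lsC_mul (c : S) (A : LaurentSeries S) (n : ℤ) :
    (lsC K S c * A).coeff n = c * A.coeff n :=
  HahnSeries.coeff_single_zero_mul

variable (S) in
/-- The variable `w`, whose inverse is the uniformizer. -/
def lsW : (LaurentSeries S)ˣ where
  val := HahnSeries.single (-1) 1
  inv := HahnSeries.single 1 1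
  val_inv := by simp
  inv_val := by simp

lemma lsW_zpow (m : ℤ) : ((lsW S ^ m : (LaurentSeries S)ˣ) : LaurentSeries S)
    = HahnSeries.single (-m) 1 := by
  induction m using Int.induction_on with
  | zero => simp
  | succ n ih =>
    rw [zpow_add_one, Units.val_mul, ih]
    change _ * HahnSeries.single (-1) 1 = _
    rw [HahnSeries.single_mul_single, neg_add, one_mul]
  | pred n ih =>
    rw [zpow_sub_one, Units.val_mul, ih]
    change _ * HahnSeries.single 1 1 = _
    rw [HahnSeries.single_mul_single, one_mul]
    rw [show -(-(n : ℤ)) + 1 = -(-(n : ℤ) - 1) by ring]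

/-- The application of a homomorphism to all coefficients. -/
def lsMap (g : S →ₐ[K] S') : LaurentSeries S →ₐ[K] LaurentSeries S' where
  toFun A := A.map g
  map_one' := by
    refine (HahnSeries.map_single (Γ := ℤ) (a := 0) (r := (1 : S))
      ((g : S →+ S') : ZeroHom S S')).trans ?_
    change HahnSeries.single 0 (g 1) = _
    rw [map_one]
    rfl
  map_mul' _ _ := HahnSeries.map_mul ((g : S →+* S') : S →ₙ+* S')
  map_zero' := by ext; simp
  map_add' _ _ := by ext; simp
  commutes' r := by
    have := HahnSeries.map_single (Γ := ℤ) (a := 0) (r := algebraMap K S r) ((g : S →+ S') : ZeroHom S S')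
    refine this.trans ?_
    change HahnSeries.single 0 (g (algebraMap K S r)) = HahnSeries.single 0 (algebraMap K S' r)
    rw [g.commutes]

lemma coeff_lsMap (g : S →ₐ[K] S') (A : LaurentSeries S) (n : ℤ) :
    (lsMap g A).coeff n = g (A.coeff n) := rfl

lemma lsMap_lsC (g : S →ₐ[K] S') (c : S) : lsMap g (lsC K S c) = lsC K S' (g c) :=
  HahnSeries.map_single (Γ := ℤ) (a := 0) (r := c) ((g : S →+ S') : ZeroHom S S')

lemma lsMap_lsW (g : S →ₐ[K] S') : lsMap g (lsW S : LaurentSeries S) = lsW S' := by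
  refine (HahnSeries.map_single (Γ := ℤ) (a := -1) (r := (1 : S)) ((g : S →+ S') : ZeroHom S S')).trans ?_
  change HahnSeries.single (-1) (g 1) = HahnSeries.single (-1) 1
  rw [map_one]

/-- A power series in `w⁻¹`. -/
abbrev lsPow : PowerSeries S →+* LaurentSeries S := HahnSeries.ofPowerSeries ℤ S

lemma coeff_lsPow_of_neg (A : PowerSeries S) {n : ℤ} (h : n < 0) : (lsPow A).coeff n = 0 := by
  rw [lsPow, HahnSeries.ofPowerSeries_apply, HahnSeries.embDomain_of_notMem_range]
  rintro ⟨m, rfl⟩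
  simp at h
  omega

lemma lsMap_lsPow (g : S →ₐ[K] S') (A : PowerSeries S) :
    lsMap g (lsPow A) = lsPow (PowerSeries.map (g : S →+* S') A) := by
  ext n
  rw [coeff_lsMap]
  rcases lt_or_ge n 0 with h | h
  · rw [coeff_lsPow_of_neg _ h, coeff_lsPow_of_neg _ h, map_zero]
  · lift n to ℕ using h
    rw [lsPow, lsPow, HahnSeries.ofPowerSeries_apply_coeff, HahnSeries.ofPowerSeries_apply_coeff,
      PowerSeries.coeff_map]
    rfl

lemma coeff_lsW_zpow_mul (m : ℤ) (A : LaurentSeries S) (n : ℤ) :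
    (((lsW S ^ m : (LaurentSeries S)ˣ) : LaurentSeries S) * A).coeff n = A.coeff (n + m) := by
  rw [lsW_zpow, HahnSeries.coeff_single_mul]
  simp

lemma coeff_lsW_inv_mul (A : LaurentSeries S) (n : ℤ) :
    (((((lsW S)⁻¹ : (LaurentSeries S)ˣ)) : LaurentSeries S) * A).coeff n = A.coeff (n - 1) := by
  have := coeff_lsW_zpow_mul (-1) A n
  rwa [zpow_neg_one] at this

variable (K) in
lemma lsPow_one_sub (x : S) :
    lsPow (1 - PowerSeries.C x * PowerSeries.X)
      = ((lsW S : LaurentSeries S) - lsC K S x) * (((lsW S)⁻¹ : (LaurentSeries S)ˣ) : LaurentSeries S) := by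
  rw [map_sub, map_one, map_mul, lsPow, HahnSeries.ofPowerSeries_X, HahnSeries.ofPowerSeries_C,
    sub_mul, Units.mul_inv]
  rfl

variable (K) in
/-- `w - x`. -/
def lsLin (x : S) : LaurentSeries S := lsW S - lsC K S x

/-- The inverse of `w - x`. -/
def lsGeo (x : S) : LaurentSeries S :=
  (((lsW S)⁻¹ : (LaurentSeries S)ˣ) : LaurentSeries S) * lsPow (PowerSeries.mk fun n => x ^ n)

lemma lsLin_mul_lsGeo (x : S) : lsLin K x * lsGeo x = 1 := by
  rw [lsLin, lsGeo, ← mul_assoc, ← lsPow_one_sub K, ← map_mul, mul_comm, mk_pow_mul, map_one]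

lemma lsMap_lsLin (g : S →ₐ[K] S') (x : S) : lsMap g (lsLin K x) = lsLin K (g x) := by
  rw [lsLin, map_sub, lsMap_lsW, lsMap_lsC, lsLin]

/-- Both sides are inverse to the same linear factor, and inverses are unique. -/
lemma lsMap_lsGeo (g : S →ₐ[K] S') (x : S) : lsMap g (lsGeo x) = lsGeo (g x) := by
  have h1 := lsLin_mul_lsGeo (K := K) (g x)
  have h2 := congrArg (lsMap g) (lsLin_mul_lsGeo (K := K) x)
  rw [map_mul, lsMap_lsLin, map_one] at h2
  linear_combination -lsMap g (lsGeo x) * h1 + lsGeo (g x) * h2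

variable [CharZero K]

variable (K) in
/-- `Exp[-w⁻¹ X]` for the values `P n` of the power sums `p_{n+1}`. -/
def expL (P : ℕ → S) : LaurentSeries S := lsPow (expPS (K := K) P)

lemma lsMap_expL (g : S →ₐ[K] S') (P : ℕ → S) :
    lsMap g (expL K P) = expL K fun n => g (P n) := by
  rw [expL, lsMap_lsPow, map_expPS, expL]

/-- With `u = w⁻¹`, the factors `1 - xu` become `(w - x) w⁻¹`. This ratio `(w - qx)/(w - x)` of
exponentials is the source of all later residue identities. -/
lemma expL_mul {q : K} {P P' : ℕ → S} {x : S}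
    (h : ∀ n, P' n = P n + (q ^ (n + 1) - 1) • x ^ (n + 1)) :
    expL K P' * lsLin K x = expL K P * lsLin K (q • x) := by
  have := congrArg lsPow (expPS_mul h)
  rw [map_mul, map_mul, lsPow_one_sub K, lsPow_one_sub K, ← mul_assoc, ← mul_assoc] at this
  exact (Units.mul_left_inj _).mp this

/-- The uniformizer is `w⁻¹`, so coefficient `1` is the residue. The series is `c w⁻¹` plus terms of
lower degree in `w`. -/
lemma coeff_expL_mul_lsGeo (P : ℕ → S) (c x : S) :
    (lsC K S c * (expL K P * lsGeo x)).coeff 1 = c := by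
  rw [coeff_lsC_mul, lsGeo, mul_left_comm, coeff_lsW_inv_mul, sub_self, expL, ← map_mul,
    ← Nat.cast_zero, lsPow, HahnSeries.ofPowerSeries_apply_coeff]
  simp [constantCoeff_expPS]

/-- With two linear denominators the series starts at `w⁻²` and has no residue. -/
lemma coeff_expL_mul_lsGeo_mul_lsGeo (P : ℕ → S) (c x x' : S) :
    (lsC K S c * (expL K P * lsGeo x * lsGeo x')).coeff 1 = 0 := by
  rw [coeff_lsC_mul, lsGeo, lsGeo, mul_left_comm, coeff_lsW_inv_mul,
    mul_left_comm, mul_assoc, coeff_lsW_inv_mul, expL, ← map_mul, ← map_mul,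
    coeff_lsPow_of_neg _ (by norm_num), mul_zero]

end Residue

/-! ### The operator `d_-` as a residue in a formal variable -/

section ResHom

variable {K : Type*} [Field K] {S : Type*} [CommRing S] [Algebra K S]
  {S' : Type*} [CommRing S'] [Algebra K S']

/-- The extension of a homomorphism `f` to `F ↦ f (F[X - (q - 1) y_k])`, where `y_k` becomes the
variable `w` of the Laurent series. -/
def resHom (q : K) (k : ℕ) (f : Lau K →ₐ[K] S) : Lau K →ₐ[K] LaurentSeries S :=
  evalHom (fun n => lsC K S (f (pSum n)) - (q ^ (n + 1) - 1) • (lsW S : LaurentSeries S) ^ (n + 1))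
    fun i => if i = k then lsW S
      else Units.map ((lsC K S).comp f : Lau K →* LaurentSeries S) (yUnit i)

lemma resHom_pSum (q : K) (k : ℕ) (f : Lau K →ₐ[K] S) (n : ℕ) : resHom q k f (pSum n)
    = lsC K S (f (pSum n)) - (q ^ (n + 1) - 1) • (lsW S : LaurentSeries S) ^ (n + 1) :=
  evalHom_pSum _ _ _

lemma resHom_yVar (q : K) (k : ℕ) (f : Lau K →ₐ[K] S) (i : ℕ) : resHom q k f (yVar i)
    = if i = k then (lsW S : LaurentSeries S) else lsC K S (f (yVar i)) := by
  rw [resHom, evalHom_yVar]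
  split_ifs <;> rfl

lemma resHom_yVar_self (q : K) (k : ℕ) (f : Lau K →ₐ[K] S) :
    resHom q k f (yVar k) = lsW S := by
  rw [resHom_yVar, if_pos rfl]

lemma resHom_yVar_ne (q : K) {k i : ℕ} (h : i ≠ k) (f : Lau K →ₐ[K] S) :
    resHom q k f (yVar i) = lsC K S (f (yVar i)) := by
  rw [resHom_yVar, if_neg h]

lemma lsMap_resHom (q : K) (k : ℕ) (f : Lau K →ₐ[K] S) (g : S →ₐ[K] S') (F : Lau K) :
    lsMap g (resHom q k f F) = resHom q k (g.comp f) F := by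
  have : (lsMap g).comp (resHom q k f) = resHom q k (g.comp f) := by
    refine lau_algHom_ext (fun n => ?_) fun i => ?_
    · simp [resHom_pSum, lsMap_lsC, lsMap_lsW]
    · simp only [AlgHom.comp_apply, resHom_yVar, apply_ite (lsMap g), lsMap_lsC, lsMap_lsW]
  exact DFunLike.congr_fun this F

variable [CharZero K]

lemma resExp_add (k : ℕ) (F G : Lau K) : resExp k (F + G) = resExp k F + resExp k G := by
  unfold resExp
  rw [AddMonoidAlgebra.coeff_add, Finsupp.sum_add_index']
  · simp
  · intro a b c
    split_ifs
    · rw [add_mul, AddMonoidAlgebra.single_add]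
    · simp

/-- Allowing an arbitrary homomorphism `f` after the residue makes compositions of operators, and
iterated residues, instances of the same formula. On a monomial the power of `y_k` becomes the power
of `w` that selects a coefficient of the exponential. -/
lemma algHom_resExp {k : ℕ} (f : Lau K →ₐ[K] S) {psi : Lau K →ₐ[K] LaurentSeries S}
    (hp : ∀ n, psi (pSum n) = lsC K S (f (pSum n))) (hk : psi (yVar k) = lsW S)
    (hy : ∀ i, i ≠ k → psi (yVar i) = lsC K S (f (yVar i))) (F : Lau K) :
    f (resExp k F) = (psi F * expL K fun n => f (pSum n)).coeff 1 := by
  induction F using AddMonoidAlgebra.induction_linear with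
  | zero => simp [resExp]
  | add F G hF hG => rw [resExp_add, map_add, hF, hG, map_add, add_mul, HahnSeries.coeff_add]
  | single a c =>
    have e1 : (AddMonoidAlgebra.single a c : Lau K)
        = AddMonoidAlgebra.single (a.erase k) c * yPow k (a k) := by
      conv_lhs => rw [← Finsupp.erase_add_single k a]
      simp [yPow, AddMonoidAlgebra.single_mul_single]
    have e2 : psi (AddMonoidAlgebra.single (a.erase k) c)
        = (lsC K S).comp f (AddMonoidAlgebra.single (a.erase k) c) := by
      refine algHom_eq_of_supp (s := {i | i ≠ k}) hp (fun i hi => hy i hi) ?_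
      intro b hb i hi
      rintro rfl
      have hb' : b = a.erase i := by
        by_contra hne
        exact hb (by simp [AddMonoidAlgebra.coeff_single, Ne.symm hne])
      rw [hb'] at hi
      simp at hi
    have e3 : psi (yPow k (a k)) = ((lsW S ^ (a k) : (LaurentSeries S)ˣ) : LaurentSeries S) := by
      have h : Units.map (psi : Lau K →* LaurentSeries S) (yUnit k) = lsW S := Units.ext hk
      rw [← yUnit_zpow, ← h, ← map_zpow]
      rfl
    rw [e1, map_mul, e2, e3, AlgHom.comp_apply, mul_assoc, coeff_lsC_mul, coeff_lsW_zpow_mul, ← e1]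
    have e4 : resExp k (AddMonoidAlgebra.single a c) = if 0 ≤ a k + 1 then
        AddMonoidAlgebra.single (a.erase k) (c * (pExpNeg K).coeff (a k + 1).toNat) else 0 := by
      rw [resExp, AddMonoidAlgebra.coeff_single, Finsupp.sum_single_index]
      simp
    rw [e4]
    split_ifs with h
    · have e5 : (AddMonoidAlgebra.single (a.erase k) (c * (pExpNeg K).coeff (a k + 1).toNat)
          : Lau K) = AddMonoidAlgebra.single (a.erase k) c
            * cst ((pExpNeg K).coeff (a k + 1).toNat) := by
        simp [cst_apply, AddMonoidAlgebra.single_mul_single]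
      have e6 : f.comp cst = MvPolynomial.aeval (R := K) fun n => f (pSum n) :=
        MvPolynomial.algHom_ext fun n => by simp [cst_X]
      have e7 : 1 + a k = ((a k + 1).toNat : ℤ) := by omega
      rw [e5, map_mul, e7, expL, lsPow, HahnSeries.ofPowerSeries_apply_coeff, expPS,
        PowerSeries.coeff_map, ← AlgHom.comp_apply, e6]
      rfl
    · rw [expL, coeff_lsPow_of_neg _ (by omega), map_zero, mul_zero]

/-- `d_-` as a residue. -/
lemma algHom_dMinusOp (q : K) (k : ℕ) (f : Lau K →ₐ[K] S) (F : Lau K) :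
    f (dMinusOp q k F) = -(resHom q k f F * expL K fun n => f (pSum n)).coeff 1 := by
  set psi : Lau K →ₐ[K] LaurentSeries S := evalHom (fun n => lsC K S (f (pSum n)))
    fun i => if i = k then lsW S
      else Units.map ((lsC K S).comp f : Lau K →* LaurentSeries S) (yUnit i)
  have hp : ∀ n, psi (pSum n) = lsC K S (f (pSum n)) := fun n => evalHom_pSum _ _ _
  have hy : ∀ i, psi (yVar i) = if i = k then (lsW S : LaurentSeries S)
      else lsC K S (f (yVar i)) := by
    intro i
    rw [evalHom_yVar]
    split_ifs <;> rfl
  have hk : psi (yVar k) = lsW S := by rw [hy, if_pos rfl]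
  have h : psi.comp (plethHom q (-1) k) = resHom q k f := by
    refine lau_algHom_ext (fun n => ?_) fun i => ?_
    · rw [AlgHom.comp_apply, plethHom_pSum, map_add, map_smul, map_pow, hk, hp, resHom_pSum,
        neg_one_mul, neg_smul, ← sub_eq_add_neg]
    · rw [AlgHom.comp_apply, plethHom_yVar, hy, resHom_yVar]
  rw [dMinusOp, map_neg, pleth_eq,
    algHom_resExp f hp hk (fun i hi => by rw [hy, if_neg hi]), ← h, AlgHom.comp_apply]

lemma dMinusOp_eq (q : K) (k : ℕ) (F : Lau K) :
    dMinusOp q k F = -(resHom q k (AlgHom.id K _) F * expL K pSum).coeff 1 :=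
  algHom_dMinusOp q k (AlgHom.id K _) F

end ResHom

/-! ### Identities with at most one residue -/

section Identities

variable {K : Type*} [Field K]

/-- `F` involves only the variables `y_1, …, y_k`. -/
def SuppIn (k : ℕ) (F : Lau K) : Prop := ∀ a, F.coeff a ≠ 0 → ∀ i, a i ≠ 0 → 1 ≤ i ∧ i ≤ k

lemma algHom_eq_of_suppIn {S : Type*} [CommRing S] [Algebra K S] {f g : Lau K →ₐ[K] S} {k : ℕ}
    {F : Lau K} (hF : SuppIn k F) (hp : ∀ n, f (pSum n) = g (pSum n))
    (hy : ∀ i, 1 ≤ i → i ≤ k → f (yVar i) = g (yVar i)) : f F = g F :=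
  algHom_eq_of_supp (s := {i | 1 ≤ i ∧ i ≤ k}) hp (fun i hi => hy i hi.1 hi.2) hF

/-- The homomorphism `p_n ↦ p_n + (q^n - 1) (t y_1)^n`, `y_i ↦ y_{i+1}` that gives `d_{+,CM}^*`. -/
def shiftHom (q t : K) : Lau K →ₐ[K] Lau K :=
  evalHom (fun n => pSum n + (q ^ (n + 1) - 1) • (t • yVar 1) ^ (n + 1))
    -- The variable `y_0` lies in no `W_k`. It is kept fixed because sending it to `y_1` would make
    -- the square of this homomorphism send it to `y_2`, destroying invariance under `s_1` on the
    -- whole ring.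
    fun i => yUnit (if i = 0 then 0 else i + 1)

lemma shiftHom_pSum (q t : K) (n : ℕ) : shiftHom q t (pSum n)
    = pSum n + (q ^ (n + 1) - 1) • (t • yVar 1) ^ (n + 1) := evalHom_pSum _ _ _

lemma shiftHom_yVar (q t : K) {i : ℕ} (h : 1 ≤ i) : shiftHom q t (yVar i) = yVar (i + 1) := by
  rw [shiftHom, evalHom_yVar, if_neg (by omega), yUnit_val]

lemma shiftHom_yVar_zero (q t : K) : shiftHom q t (yVar 0) = yVar 0 := by
  rw [shiftHom, evalHom_yVar, if_pos rfl, yUnit_val]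

lemma dPlusStarCM_eq {q t : K} (ht : t ≠ 0) {k : ℕ} {F : Lau K} (hF : SuppIn k F) :
    dPlusStarCM q t k F = shiftHom q t F := by
  rw [dPlusStarCM, gammaOp_eq ht, pleth_eq, ← AlgHom.comp_apply (gammaHom ht k)]
  refine algHom_eq_of_suppIn hF (fun n => ?_)
    fun i h1 h2 => ?_
  · rw [AlgHom.comp_apply, plethHom_pSum, map_add, map_smul, map_pow, gammaHom_pSum, gammaHom_yVar,
      if_pos rfl, one_mul, shiftHom_pSum]
  · rw [AlgHom.comp_apply, plethHom_yVar, gammaHom_yVar, if_neg (by omega), shiftHom_yVar q t h1]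

/-- The operator `-(q t y_1)⁻¹ f` for the homomorphism `f` that gives `d_{+,CM}^*`. -/
def starHom (q t : K) (F : Lau K) : Lau K :=
  -((q * t)⁻¹ • (yPow 1 (-1) * shiftHom q t F))

lemma dPlusStarOp_eq {q t : K} (ht : t ≠ 0) {k : ℕ} {F : Lau K} (hF : SuppIn k F) :
    dPlusStarOp q t k F = starHom q t F := by
  rw [dPlusStarOp, dPlusStarCM_eq ht hF, starHom]

/-- The factor `y_1⁻¹` of `starHom` as a scalar. -/
lemma starHom_eq (q t : K) (F : Lau K) :
    starHom q t F = algebraMap K (Lau K) (-(q * t)⁻¹) * yPow 1 (-1) * shiftHom q t F := by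
  rw [starHom, Algebra.smul_def, map_neg]
  ring

/-! ### Operators without residues -/

lemma plethHom_heckeT (q ε : K) {i j : ℕ} (h1 : j ≠ i) (h2 : j ≠ i + 1) (F : Lau K) :
    plethHom q ε j (heckeT q i F) = heckeT q i (plethHom q ε j F) := by
  refine (heckeT_algHom (plethHom_yVar _ _ _ _) (plethHom_yVar _ _ _ _) ?_).symm
  have : (plethHom q ε j).comp (swapHom i) = (swapHom i).comp (plethHom q ε j) := by
    refine lau_algHom_ext (fun n => ?_) fun l => ?_
    · simp only [AlgHom.comp_apply, plethHom_pSum, swapHom_pSum, map_add, map_smul, map_pow,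
        swapHom_ne h1 h2]
    · simp only [AlgHom.comp_apply, plethHom_yVar, swapHom_yVar]
  exact DFunLike.congr_fun this F

/-- As `F` does not contain `y_{k+1}` and `y_{k+2}`, the double shift is symmetric in them, and
`T_{k+1}` fixes symmetric functions. -/
lemma heckeT_plethHom_plethHom (q : K) {k : ℕ} {F : Lau K} (hF : SuppIn k F) :
    heckeT q (k + 1) (plethHom q 1 (k + 2) (plethHom q 1 (k + 1) F))
      = plethHom q 1 (k + 2) (plethHom q 1 (k + 1) F) := by
  refine heckeT_of_swap q _ ?_
  rw [← AlgHom.comp_apply (plethHom q 1 (k + 2)), ← AlgHom.comp_apply (swapHom (k + 1))]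
  refine algHom_eq_of_suppIn hF (fun n => ?_) fun i h1 h2 => ?_
  · simp only [AlgHom.comp_apply, plethHom_pSum, plethHom_yVar, swapHom_pSum, map_add, map_smul,
      map_pow, swapHom_left, swapHom_right]
    abel
  · simp only [AlgHom.comp_apply, plethHom_yVar, swapHom_ne (show i ≠ k + 1 by omega)
      (show i ≠ k + 1 + 1 by omega)]

lemma heckeT_shiftHom (q t : K) {i : ℕ} (hi : 1 ≤ i) (F : Lau K) :
    heckeT q (i + 1) (shiftHom q t F) = shiftHom q t (heckeT q i F) := by
  refine heckeT_algHom (shiftHom_yVar q t hi) (shiftHom_yVar q t (by omega)) ?_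
  have : (shiftHom q t).comp (swapHom i) = (swapHom (i + 1)).comp (shiftHom q t) := by
    refine lau_algHom_ext (fun n => ?_) fun l => ?_
    · simp only [AlgHom.comp_apply, shiftHom_pSum, swapHom_pSum, map_add, map_smul, map_pow,
        swapHom_ne (show 1 ≠ i + 1 by omega) (show 1 ≠ i + 1 + 1 by omega)]
    · simp only [AlgHom.comp_apply, swapHom_yVar, shiftHom, evalHom_yVar, yUnit_val]
      congr 1
      simp only [Equiv.swap_apply_def]
      split_ifs <;> omega
  exact DFunLike.congr_fun this F

lemma swapHom_yPow_ne {i j : ℕ} (h1 : j ≠ i) (h2 : j ≠ i + 1) (m : ℤ) :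
    swapHom i (yPow j m : Lau K) = yPow j m :=
  algHom_yPow_congr (g := AlgHom.id K _) (swapHom_ne h1 h2) m

lemma heckeT_starHom (q t : K) {i : ℕ} (hi : 1 ≤ i) (F : Lau K) :
    heckeT q (i + 1) (starHom q t F) = starHom q t (heckeT q i F) := by
  rw [starHom_eq, starHom_eq, heckeT_mul, heckeT_shiftHom q t hi]
  rw [map_mul, AlgHom.commutes, swapHom_yPow_ne (by omega) (by omega)]

lemma starHom_yVar_mul (q t : K) {i : ℕ} (hi : 1 ≤ i) (F : Lau K) :
    starHom q t (yVar i * F) = yVar (i + 1) * starHom q t F := by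
  rw [starHom_eq, starHom_eq, map_mul, shiftHom_yVar q t hi]
  ring

lemma swapHom_comp_shiftHom (q t : K) : (swapHom 1).comp ((shiftHom q t).comp (shiftHom q t))
    = (shiftHom q t).comp (shiftHom q t) := by
  refine lau_algHom_ext (fun n => ?_) fun l => ?_
  · simp only [AlgHom.comp_apply, shiftHom_pSum, swapHom_pSum, map_add, map_smul, map_pow,
      swapHom_left, swapHom_right, shiftHom_yVar q t le_rfl]
    abel
  · rcases Nat.eq_zero_or_pos l with rfl | hl
    · simp only [AlgHom.comp_apply, shiftHom_yVar_zero,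
        swapHom_ne (show 0 ≠ 1 by omega) (show 0 ≠ 1 + 1 by omega)]
    · simp only [AlgHom.comp_apply, shiftHom_yVar q t hl, shiftHom_yVar q t (Nat.succ_pos l),
        swapHom_ne (show l + 1 + 1 ≠ 1 by omega) (show l + 1 + 1 ≠ 1 + 1 by omega)]

lemma swapHom_shiftHom_shiftHom (q t : K) (F : Lau K) :
    swapHom 1 (shiftHom q t (shiftHom q t F)) = shiftHom q t (shiftHom q t F) :=
  DFunLike.congr_fun (swapHom_comp_shiftHom q t) F

lemma shiftHom_yPow (q t : K) {i : ℕ} (hi : 1 ≤ i) (m : ℤ) :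
    shiftHom q t (yPow i m) = yPow (i + 1) m := by
  rw [shiftHom, evalHom_yPow, if_neg (by omega), yUnit_zpow]

lemma swapHom_yPow_left (i : ℕ) (m : ℤ) : swapHom i (yPow i m : Lau K) = yPow (i + 1) m := by
  rw [swapHom, evalHom_yPow, Equiv.swap_apply_left, yUnit_zpow]

lemma swapHom_yPow_right (i : ℕ) (m : ℤ) : swapHom i (yPow (i + 1) m : Lau K) = yPow i m := by
  rw [swapHom, evalHom_yPow, Equiv.swap_apply_right, yUnit_zpow]

/-- Applying the operator twice gives the symmetric factor `y_1⁻¹ y_2⁻¹` times a function symmetric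
in `y_1, y_2`. -/
lemma heckeT_starHom_starHom (q t : K) (F : Lau K) :
    heckeT q 1 (starHom q t (starHom q t F)) = starHom q t (starHom q t F) := by
  refine heckeT_of_swap q _ ?_
  simp only [starHom_eq, map_mul, AlgHom.commutes, shiftHom_yPow q t le_rfl,
    swapHom_shiftHom_shiftHom, swapHom_yPow_left, swapHom_yPow_right]
  ring

/-- The shift contained in `d_-` undoes the shift by `y_{k+1}`, so the result is constant in `w`. -/
lemma resHom_plethHom {S : Type*} [CommRing S] [Algebra K S] (q : K) {k : ℕ} {F : Lau K}
    (hF : SuppIn k F) (f : Lau K →ₐ[K] S) :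
    resHom q (k + 1) f (plethHom q 1 (k + 1) F) = lsC K S (f F) := by
  rw [← AlgHom.comp_apply (resHom q (k + 1) f), ← AlgHom.comp_apply (lsC K S)]
  refine algHom_eq_of_suppIn hF (fun n => ?_) fun i h1 h2 => ?_
  · simp only [AlgHom.comp_apply, plethHom_pSum, resHom_pSum, resHom_yVar_self, map_add,
      map_smul, map_pow, one_mul, sub_add_cancel]
  · simp only [AlgHom.comp_apply, plethHom_yVar, resHom_yVar_ne q (show i ≠ k + 1 by omega)]

/-- The defining equation of `T_k` is evaluated at `y_{k+1} = w`. The unswapped term is constant in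
`w`; in the swapped one `y_k` has become `w`, and the shift by `y_{k+1}` has become a shift by
`y_k`. -/
lemma resHom_heckeT_plethHom {S : Type*} [CommRing S] [Algebra K S] (q : K) {k : ℕ} {F : Lau K}
    (hF : SuppIn k F) (f : Lau K →ₐ[K] S) :
    lsLin K (f (yVar k))
        * resHom q (k + 1) f (heckeT q k (plethHom q 1 (k + 1) F))
      = lsC K S (f ((q - 1) • (yVar k * F)))
        + lsLin K (q • f (yVar k)) * resHom q k (f.comp (plethHom q 1 k)) F := by
  have h := congrArg (resHom q (k + 1) f) (heckeT_eq q k (plethHom q 1 (k + 1) F))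
  have e1 := resHom_plethHom q hF f
  have e2 : resHom q (k + 1) f (swapHom k (plethHom q 1 (k + 1) F))
      = resHom q k (f.comp (plethHom q 1 k)) F := by
    rw [← AlgHom.comp_apply (swapHom k), ← AlgHom.comp_apply (resHom q (k + 1) f)]
    refine algHom_eq_of_suppIn hF (fun n => ?_) fun i h1 h2 => ?_
    · simp only [AlgHom.comp_apply, plethHom_pSum, resHom_pSum, swapHom_pSum, map_add, map_smul,
        map_pow, swapHom_right, resHom_yVar_ne q (show k ≠ k + 1 by omega), one_mul]
      abel
    · rcases eq_or_ne i k with rfl | hi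
      · simp only [AlgHom.comp_apply, plethHom_yVar, swapHom_left, resHom_yVar_self]
      · simp only [AlgHom.comp_apply, plethHom_yVar, swapHom_ne hi (show i ≠ k + 1 by omega),
          resHom_yVar_ne q hi, resHom_yVar_ne q (show i ≠ k + 1 by omega)]
  simp only [map_mul, map_sub, map_add, map_one, e1, e2, resHom_yVar_self,
    resHom_yVar_ne q (show k ≠ k + 1 by omega)] at h
  rw [lsLin, lsLin, h, Algebra.smul_def, Algebra.smul_def]
  simp only [map_mul, map_sub, map_one, AlgHom.commutes]

lemma resHom_shiftHom {S : Type*} [CommRing S] [Algebra K S] (q t : K) {k : ℕ} {F : Lau K}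
    (hF : SuppIn k F) (f : Lau K →ₐ[K] S) (hk : 1 ≤ k) :
    resHom q (k + 1) f (shiftHom q t F) = resHom q k (f.comp (shiftHom q t)) F := by
  rw [← AlgHom.comp_apply (resHom q (k + 1) f)]
  refine algHom_eq_of_suppIn hF (fun n => ?_)
    fun i h1 h2 => ?_
  · simp only [AlgHom.comp_apply, shiftHom_pSum, resHom_pSum, map_add, map_smul, map_pow,
      resHom_yVar_ne q (show 1 ≠ k + 1 by omega)]
    abel
  · rw [AlgHom.comp_apply, shiftHom_yVar q t h1, resHom_yVar, resHom_yVar, AlgHom.comp_apply,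
      shiftHom_yVar q t h1]
    simp

/-! ### Single residues -/

variable [CharZero K]

lemma dMinusOp_yVar_mul (q : K) {i k : ℕ} (h : i ≠ k) (F : Lau K) :
    dMinusOp q k (yVar i * F) = yVar i * dMinusOp q k F := by
  rw [dMinusOp_eq, dMinusOp_eq, map_mul, resHom_yVar_ne q h, AlgHom.id_apply, mul_assoc,
    coeff_lsC_mul]
  ring

/-- The residue variable is different from `y_i` and `y_{i+1}`. So `s_i` acts on coefficients only,
and the factors in the equation of `T_i` can be pulled out of the residue. -/
lemma dMinusOp_heckeT (q : K) {i k : ℕ} (h1 : i ≠ k) (h2 : i + 1 ≠ k) (F : Lau K) :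
    dMinusOp q k (heckeT q i F) = heckeT q i (dMinusOp q k F) := by
  refine (heckeT_unique ?_).symm
  set r := resHom q k (AlgHom.id K (Lau K))
  have hs : r (swapHom i F) = lsMap (swapHom i) (r F) := by
    rw [lsMap_resHom]
    have : r.comp (swapHom i) = resHom q k ((swapHom i).comp (AlgHom.id K (Lau K))) := by
      refine lau_algHom_ext (fun n => ?_) fun l => ?_
      · simp only [r, AlgHom.comp_apply, swapHom_pSum, resHom_pSum, AlgHom.id_apply]
      · have e : Equiv.swap i (i + 1) l = k ↔ l = k := by
          rw [Equiv.swap_apply_eq_iff, Equiv.swap_apply_of_ne_of_ne h1.symm h2.symm]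
        simp only [r, AlgHom.comp_apply, swapHom_yVar, resHom_yVar, AlgHom.id_apply, e]
    exact DFunLike.congr_fun this F
  have hE : swapHom i ((r F * expL K pSum).coeff 1) = (r (swapHom i F) * expL K pSum).coeff 1 := by
    rw [← coeff_lsMap, map_mul, ← hs, lsMap_expL]
    simp only [swapHom_pSum]
  have h := congrArg (fun A => (r A * expL K pSum).coeff 1) (heckeT_eq q i F)
  simp only [map_mul, map_sub, map_add, map_one, add_mul] at h
  have e1 : r (yVar i) = lsC K _ (yVar i) := resHom_yVar_ne q h1 _
  have e2 : r (yVar (i + 1)) = lsC K _ (yVar (i + 1)) := resHom_yVar_ne q h2 _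
  have e3 : r (algebraMap K (Lau K) q) = lsC K _ (algebraMap K (Lau K) q) := by
    rw [AlgHom.commutes, AlgHom.commutes]
  rw [e1, e2, e3, ← map_one (lsC K (Lau K)), ← map_sub, ← map_sub, ← map_mul, ← map_sub,
    HahnSeries.coeff_add, mul_assoc, mul_assoc, mul_assoc, mul_assoc, coeff_lsC_mul, coeff_lsC_mul,
    coeff_lsC_mul, coeff_lsC_mul, ← hE] at h
  rw [dMinusOp_eq, dMinusOp_eq, map_neg]
  linear_combination -h

/-- The commutator of `d_-` and `F ↦ F[X + (q - 1) y]`. -/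
lemma plethHom_dMinusOp (q : K) {k : ℕ} {F : Lau K} (hF : SuppIn k F) :
    plethHom q 1 k (dMinusOp q k F) - dMinusOp q (k + 1) (heckeT q k (plethHom q 1 (k + 1) F))
      = (q - 1) • (yVar k * F) := by
  have h := resHom_heckeT_plethHom q hF (AlgHom.id K (Lau K))
  have hE : expL K (fun n => plethHom q 1 k (pSum n)) * lsLin K (yVar k : Lau K)
      = expL K pSum * lsLin K (q • yVar k : Lau K) :=
    expL_mul fun n => by rw [plethHom_pSum, one_mul]
  have hi := lsLin_mul_lsGeo (K := K) (yVar k : Lau K)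
  simp only [AlgHom.id_apply, AlgHom.id_comp] at h
  rw [algHom_dMinusOp, dMinusOp_eq]
  set R := resHom q (k + 1) (AlgHom.id K (Lau K)) (heckeT q k (plethHom q 1 (k + 1) F))
  set M := resHom q k (plethHom q 1 k) F
  -- The swapped term of the Hecke equation times `E` equals `M E'`, the integrand of the other
  -- operator, since both carry the ratio `(w - q y_k)/(w - y_k)`. The rest has a simple pole with
  -- constant numerator, which is its residue.
  have key : R * expL K pSum = lsC K _ ((q - 1) • (yVar k * F))
      * (expL K pSum * lsGeo (yVar k)) + M * expL K fun n => plethHom q 1 k (pSum n) := by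
    generalize (expL K fun n => plethHom q 1 k (pSum n)) = E' at hE ⊢
    generalize expL K (pSum : ℕ → Lau K) = E at hE ⊢
    set g := lsGeo (yVar k : Lau K)
    linear_combination -(R * E - M * E') * hi + E * g * h - M * g * hE
  rw [key, HahnSeries.coeff_add, coeff_expL_mul_lsGeo]
  ring

/-- `(q⁻¹ - 1)⁻¹ (d_+^* d_- - d_- d_+^*)` as a residue. -/
def phiStar (q t : K) (k : ℕ) (F : Lau K) : Lau K :=
  (resHom q k (shiftHom q t) F * (expL K pSum
    * lsGeo (t • yVar 1))).coeff 1

lemma expL_shiftHom (q t : K) : expL K (fun n => shiftHom q t (pSum n)) * lsLin K (t • yVar 1 : Lau K)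
    = expL K pSum * lsLin K (q • t • yVar 1 : Lau K) :=
  expL_mul fun n => shiftHom_pSum q t n

/-- The commutator of `d_-` and `d_+^*`. -/
lemma starHom_dMinusOp {q t : K} (hq : q ≠ 0) (ht : t ≠ 0) {k : ℕ} {F : Lau K} (hF : SuppIn k F)
    (hk : 1 ≤ k) : starHom q t (dMinusOp q k F) - dMinusOp q (k + 1) (starHom q t F)
      = (q⁻¹ - 1) • phiStar q t k F := by
  have hE := expL_shiftHom q t
  have hi := lsLin_mul_lsGeo (K := K) (t • yVar 1 : Lau K)
  rw [starHom_eq, starHom_eq, algHom_dMinusOp, dMinusOp_eq, map_mul, map_mul, AlgHom.commutes,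
    algHom_yPow_congr (g := (lsC K _).comp (AlgHom.id K (Lau K)))
      (resHom_yVar_ne q (show 1 ≠ k + 1 by omega) _) (-1),
    resHom_shiftHom q t hF _ hk, AlgHom.id_comp, AlgHom.comp_id,
    ← AlgHom.commutes (lsC K (Lau K)), ← map_mul, mul_assoc (lsC K _ _), coeff_lsC_mul,
    phiStar]
  set M := resHom q k (shiftHom q t) F
  have hu : (yPow 1 (-1) * yVar 1 : Lau K) = 1 := yPow_neg_one_mul 1
  set E := expL K (pSum : ℕ → Lau K)
  set E' := expL K fun n => shiftHom q t (pSum n)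
  set g := lsGeo (t • yVar 1 : Lau K)
  -- Here `(w - q t y_1)/(w - t y_1)` is written as `1 + (1-q) t y_1/(w - t y_1)`. The numerator `t
  -- y_1` cancels the factor `(t y_1)⁻¹` of `d_+^*`, so no negative power of `y_1` remains in front
  -- of the residue.
  have hd : M * E' = M * E + lsC K _ ((1 - q) • t • yVar 1) * (M * (E * g)) := by
    have e : lsLin K (q • t • yVar 1 : Lau K)
        = lsLin K (t • yVar 1) + lsC K _ ((1 - q) • t • yVar 1) := by
      rw [lsLin, lsLin, sub_smul, one_smul, map_sub]
      ring
    rw [e] at hE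
    linear_combination -(M * E' - M * E) * hi + M * g * hE
  rw [hd, HahnSeries.coeff_add, coeff_lsC_mul]
  have hc : algebraMap K (Lau K) (-(q * t)⁻¹) * ((1 - q) • t • yVar 1)
      = -(algebraMap K (Lau K) (q⁻¹ - 1) * yVar 1) := by
    have e : -(q * t)⁻¹ * (1 - q) * t = -(q⁻¹ - 1) := by
      field_simp
    rw [Algebra.smul_def, Algebra.smul_def, ← mul_assoc, ← mul_assoc, ← map_mul, ← map_mul, e,
      map_neg]
    ring
  rw [Algebra.smul_def (q⁻¹ - 1)]
  generalize (1 - q) • t • (yVar 1 : Lau K) = x at hc ⊢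
  linear_combination -(yPow 1 (-1) * (M * (E * g)).coeff 1) * hc
    + algebraMap K (Lau K) (q⁻¹ - 1) * (M * (E * g)).coeff 1 * hu

end Identities

section Identities

variable {K : Type*} [Field K]

/-! ### Double residues -/

section Double

variable {R : Type*} [CommRing R] [Algebra K R]

variable (K) in
/-- The coefficients of `x` and `x'` in two variables are exchanged when the two variables are. -/
def SwapRes (x x' : LaurentSeries (LaurentSeries R)) : Prop :=
  ∀ P Q : LaurentSeries R, ((x * (lsC K _ P * lsMap (lsC K R) Q)).coeff 1).coeff 1
    = ((x' * (lsC K _ Q * lsMap (lsC K R) P)).coeff 1).coeff 1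

lemma swapRes_one : SwapRes K (1 : LaurentSeries (LaurentSeries R)) 1 := by
  intro P Q
  rw [one_mul, one_mul, coeff_lsC_mul, coeff_lsC_mul, coeff_lsMap, coeff_lsMap, mul_comm P,
    mul_comm Q, coeff_lsC_mul, coeff_lsC_mul, mul_comm]

variable (K R) in
/-- The pairs `(p, p')` for which multiplication by `p` and `p'` preserves `SwapRes`. -/
def swapSub : Subalgebra K (LaurentSeries (LaurentSeries R) × LaurentSeries (LaurentSeries R)) where
  carrier := {p | ∀ x x', SwapRes K x x' → SwapRes K (p.1 * x) (p.2 * x')}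
  mul_mem' := by
    intro p p' hp hp' x x' h
    rw [Prod.fst_mul, Prod.snd_mul, mul_assoc, mul_assoc]
    exact hp _ _ (hp' _ _ h)
  add_mem' := by
    intro p p' hp hp' x x' h P Q
    rw [Prod.fst_add, Prod.snd_add, add_mul, add_mul, add_mul, add_mul, HahnSeries.coeff_add,
      HahnSeries.coeff_add, HahnSeries.coeff_add, HahnSeries.coeff_add, hp x x' h P Q,
      hp' x x' h P Q]
  algebraMap_mem' := by
    intro c x x' h P Q
    have e : ∀ (y : LaurentSeries (LaurentSeries R)) (P Q : LaurentSeries R),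
        (((algebraMap K (LaurentSeries (LaurentSeries R)) c * y)
          * (lsC K _ P * lsMap (lsC K R) Q)).coeff 1).coeff 1
        = algebraMap K R c * ((y * (lsC K _ P * lsMap (lsC K R) Q)).coeff 1).coeff 1 := by
      intro y P Q
      rw [mul_assoc, ← AlgHom.commutes (lsC K _), ← AlgHom.commutes (lsC K R), coeff_lsC_mul,
        coeff_lsC_mul]
    rw [Prod.algebraMap_apply, e, e, h]

/-- A product of series in the separate variables can be absorbed into the test series `P` and `Q`.
-/
lemma mem_swapSub (A B : LaurentSeries R) :
    (lsC K _ A * lsMap (lsC K R) B, lsC K _ B * lsMap (lsC K R) A) ∈ swapSub K R := by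
  intro x x' h P Q
  have := h (A * P) (B * Q)
  rw [map_mul, map_mul, map_mul, map_mul] at this
  convert this using 3 <;> ring

lemma mem_swapSub_left (A : LaurentSeries R) :
    (lsC K _ A, lsMap (lsC K R) A) ∈ swapSub K R := by
  simpa using mem_swapSub (K := K) A 1

lemma mem_swapSub_right (A : LaurentSeries R) :
    (lsMap (lsC K R) A, lsC K _ A) ∈ swapSub K R := by
  simpa using mem_swapSub (K := K) 1 A

lemma mem_swapSub_const (c : R) :
    (lsC K _ (lsC K R c), lsC K _ (lsC K R c)) ∈ swapSub K R := by
  simpa [lsMap_lsC] using mem_swapSub_left (K := K) (lsC K R c)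

end Double

/-! ### Relations of the residue operators -/

variable [CharZero K]

/-- The first factor of the integrand is constant in `w`, and `E/(w - t y_1)` has residue `1`. -/
lemma phiStar_plethHom (q t : K) {k : ℕ} {F : Lau K} (hF : SuppIn k F) :
    phiStar q t (k + 1) (plethHom q 1 (k + 1) F) = shiftHom q t F := by
  rw [phiStar, resHom_plethHom q hF, coeff_expL_mul_lsGeo]

/-- This is the computation of `plethHom_dMinusOp` with the additional factor `1/(w - t y_1)`; it
makes the remainder decay like `w⁻²`, so the commutator term disappears. -/
lemma phiStar_heckeT_plethHom (q t : K) {k : ℕ} {F : Lau K} (hF : SuppIn k F) (hk : 1 ≤ k) :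
    phiStar q t (k + 1) (heckeT q k (plethHom q 1 (k + 1) F))
      = plethHom q 1 (k + 1) (phiStar q t k F) := by
  have h := resHom_heckeT_plethHom q hF (shiftHom q t)
  rw [shiftHom_yVar q t hk] at h
  have hi := lsLin_mul_lsGeo (K := K) (yVar (k + 1) : Lau K)
  have hE : expL K (fun n => plethHom q 1 (k + 1) (pSum n)) * lsLin K (yVar (k + 1) : Lau K)
      = expL K pSum * lsLin K (q • yVar (k + 1) : Lau K) :=
    expL_mul fun n => by rw [plethHom_pSum, one_mul]
  have hc : (shiftHom q t).comp (plethHom q 1 k)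
      = (plethHom q 1 (k + 1)).comp (shiftHom q t) := by
    refine lau_algHom_ext (fun n => ?_) fun i => ?_
    · simp only [AlgHom.comp_apply, plethHom_pSum, shiftHom_pSum, map_add, map_smul, map_pow,
        shiftHom_yVar q t hk, plethHom_yVar]
      abel
    · rcases Nat.eq_zero_or_pos i with rfl | hi
      · simp only [AlgHom.comp_apply, plethHom_yVar, shiftHom_yVar_zero]
      · simp only [AlgHom.comp_apply, plethHom_yVar, shiftHom_yVar q t hi]
  rw [hc] at h
  rw [phiStar, phiStar, ← coeff_lsMap, map_mul, map_mul, lsMap_resHom, lsMap_expL, lsMap_lsGeo,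
    map_smul, plethHom_yVar]
  generalize (expL K fun n => plethHom q 1 (k + 1) (pSum n)) = E' at hE ⊢
  set E := expL K (pSum : ℕ → Lau K)
  set M := resHom q k ((plethHom q 1 (k + 1)).comp (shiftHom q t)) F
  set R := resHom q (k + 1) (shiftHom q t) (heckeT q k (plethHom q 1 (k + 1) F))
  set c := shiftHom q t ((q - 1) • (yVar k * F))
  set g := lsGeo (t • yVar 1 : Lau K)
  set g' := lsGeo (yVar (k + 1) : Lau K)
  have key : R * (E * g) = lsC K _ c * (E * g * g') + M * (E' * g) := by
    linear_combination -(R * E * g - M * E' * g) * hi + E * g * g' * h - M * g * g' * hE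
  rw [key, HahnSeries.coeff_add, coeff_expL_mul_lsGeo_mul_lsGeo, zero_add]

/-- After two shifts the integrand `M` is symmetric in `y_1, y_2`. With `X = M E/((w - t y_1)(w - t
y_2))`, the three residues in the equation of `T_1` are those of `X` times `w - q t y_1`, `w - q t
y_2` and `w - t y_2`. The claim is then linear in the residues of `X` and `w X`. -/
lemma heckeT_starHom_phiStar (q t : K) {k : ℕ} {F : Lau K} (hF : SuppIn k F) (hk : 1 ≤ k) :
    heckeT q 1 (starHom q t (phiStar q t k F)) = q • phiStar q t (k + 1) (starHom q t F) := by
  have y1 : (yPow 1 (-1) * yVar 1 : Lau K) = 1 := yPow_neg_one_mul 1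
  have y2 : (yPow 2 (-1) * yVar 2 : Lau K) = 1 := yPow_neg_one_mul 2
  have hE := expL_shiftHom q t
  have hE2 := congrArg (lsMap (swapHom 1)) hE
  have hg := lsLin_mul_lsGeo (K := K) (t • yVar 1 : Lau K)
  have hg2 := lsLin_mul_lsGeo (K := K) (t • yVar 2 : Lau K)
  have s1 : swapHom 1 (t • yVar 1 : Lau K) = t • yVar 2 := by rw [map_smul, swapHom_left]
  have s2 : swapHom 1 (t • yVar 2 : Lau K) = t • yVar 1 := by rw [map_smul, swapHom_right]
  have hp : ∀ n, swapHom 1 (pSum n : Lau K) = pSum n := swapHom_pSum 1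
  have hM : lsMap (swapHom 1) (resHom q k ((shiftHom q t).comp (shiftHom q t)) F)
      = resHom q k ((shiftHom q t).comp (shiftHom q t)) F := by
    rw [lsMap_resHom, swapHom_comp_shiftHom]
  rw [map_mul, map_mul, lsMap_lsLin, lsMap_lsLin, lsMap_expL (swapHom 1) pSum, map_smul _ q, s1]
    at hE2
  simp only [hp] at hE2
  have e1 : shiftHom q t (phiStar q t k F)
      = (resHom q k ((shiftHom q t).comp (shiftHom q t)) F
        * (expL K (fun n => shiftHom q t (pSum n)) * lsGeo (t • yVar 2))).coeff 1 := by
    rw [phiStar, ← coeff_lsMap, map_mul, map_mul, lsMap_resHom, lsMap_expL, lsMap_lsGeo,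
      map_smul, shiftHom_yVar q t le_rfl]
  have e2 : swapHom 1 (shiftHom q t (phiStar q t k F))
      = (resHom q k ((shiftHom q t).comp (shiftHom q t)) F
        * (lsMap (swapHom 1) (expL K (fun n => shiftHom q t (pSum n)))
          * lsGeo (t • yVar 1))).coeff 1 := by
    rw [e1, ← coeff_lsMap, map_mul, map_mul, hM, lsMap_lsGeo, s2]
  have e3 : phiStar q t (k + 1) (starHom q t F)
      = algebraMap K (Lau K) (-(q * t)⁻¹) * yPow 2 (-1)
        * (resHom q k ((shiftHom q t).comp (shiftHom q t)) F
          * (expL K pSum * lsGeo (t • yVar 1))).coeff 1 := by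
    rw [phiStar, starHom_eq, map_mul, map_mul, AlgHom.commutes,
      algHom_yPow_congr (g := (lsC K _).comp (shiftHom q t))
        (resHom_yVar_ne q (show 1 ≠ k + 1 by omega) _) (-1), AlgHom.comp_apply,
      shiftHom_yPow q t le_rfl, resHom_shiftHom q t hF _ hk, ← AlgHom.commutes (lsC K (Lau K)),
      ← map_mul, mul_assoc, coeff_lsC_mul]
  rw [e3]
  refine heckeT_unique ?_
  rw [starHom_eq, map_mul, map_mul, AlgHom.commutes, swapHom_yPow_left, e2, e1, Algebra.smul_def]
  set M := resHom q k ((shiftHom q t).comp (shiftHom q t)) F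
  set E := expL K (pSum : ℕ → Lau K)
  generalize lsMap (swapHom 1) (expL K (fun n => shiftHom q t (pSum n))) = E2 at hE2 ⊢
  generalize expL K (fun n => shiftHom q t (pSum n)) = E1 at hE ⊢
  set g := lsGeo (t • yVar 1 : Lau K)
  set g2 := lsGeo (t • yVar 2 : Lau K)
  set X := M * E * g * g2
  have hlin : ∀ x : Lau K, (lsLin K x * X).coeff 1 = (lsW (Lau K) * X).coeff 1 - x * X.coeff 1 := by
    intro x
    rw [lsLin, sub_mul, HahnSeries.coeff_sub, coeff_lsC_mul]
  have k1 : M * (E1 * g2) = lsLin K (q • t • yVar 1) * X := by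
    linear_combination -M * E1 * g2 * hg + M * g * g2 * hE
  have k2 : M * (E2 * g) = lsLin K (q • t • yVar 2) * X := by
    linear_combination -M * E2 * g * hg2 + M * g * g2 * hE2
  have k3 : M * (E * g) = lsLin K (t • yVar 2) * X := by
    linear_combination -M * E * g * hg2
  rw [k1, k2, k3, hlin, hlin, hlin]
  simp only [Algebra.smul_def, one_add_one_eq_two]
  generalize (lsW (Lau K) * X).coeff 1 = xw
  generalize X.coeff 1 = x
  generalize algebraMap K (Lau K) (-(q * t)⁻¹) = a
  generalize algebraMap K (Lau K) q = q
  generalize algebraMap K (Lau K) t = t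
  linear_combination a * (q - 1) * (xw - q * t * yVar 1 * x) * (y2 - y1)

end Identities

/-! ### Relations with two residues -/

section DoubleResidue

variable {K : Type*} [Field K] {R : Type*} [CommRing R] [Algebra K R]

lemma algHom_yPow_of_eq {S T : Type*} [CommRing S] [Algebra K S] [CommRing T] [Algebra K T]
    {f : Lau K →ₐ[K] T} {j : S →ₐ[K] T} {i : ℕ} {u : Sˣ} (h : f (yVar i) = j u) (m : ℤ) :
    f (yPow i m) = j ((u ^ m : Sˣ) : S) := by
  have h' : Units.map (f : Lau K →* T) (yUnit i) = Units.map (j : S →* T) u := Units.ext h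
  have := congrArg (fun u : Tˣ => ((u ^ m : Tˣ) : T)) h'
  simpa only [← map_zpow, Units.coe_map, yUnit_zpow, MonoidHom.coe_coe] using this

lemma algHom_mem_of_gen {S : Type*} [CommRing S] [Algebra K S] {f : Lau K →ₐ[K] S}
    {s : Subalgebra K S} (hp : ∀ n, f (pSum n) ∈ s) (hy : ∀ i m, f (yPow i m) ∈ s) (F : Lau K) :
    f F ∈ s := by
  have hc : ∀ c, f (cst c) ∈ s := by
    intro c
    induction c using MvPolynomial.induction_on with
    | C a =>
      have : f (cst (MvPolynomial.C a)) = algebraMap K S a := by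
        rw [← MvPolynomial.algebraMap_eq, AlgHom.commutes, AlgHom.commutes]
      rw [this]
      exact s.algebraMap_mem a
    | add a b ha hb => rw [map_add, map_add]; exact s.add_mem ha hb
    | mul_X a n ha => rw [map_mul, map_mul, cst_X]; exact s.mul_mem ha (hp n)
  have hm : ∀ a : ℕ →₀ ℤ, f (AddMonoidAlgebra.single a 1) ∈ s := by
    intro a
    induction a using Finsupp.induction_linear with
    | zero => rw [← AddMonoidAlgebra.one_def, map_one]; exact s.one_mem
    | add a b ha hb =>
      have : (AddMonoidAlgebra.single (a + b) 1 : Lau K)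
          = AddMonoidAlgebra.single a 1 * AddMonoidAlgebra.single b 1 := by
        rw [AddMonoidAlgebra.single_mul_single, one_mul]
      rw [this, map_mul]
      exact s.mul_mem ha hb
    | single i m => exact hy i m
  induction F using AddMonoidAlgebra.induction_linear with
  | zero => rw [map_zero]; exact s.zero_mem
  | add F G hF hG => rw [map_add]; exact s.add_mem hF hG
  | single a c => rw [single_eq_cst_mul, map_mul]; exact s.mul_mem (hc c) (hm a)

/-- Exchanging the variables of the iterated Laurent series exchanges `y_k` and `y_{k+1}`. -/
lemma coeff_resHom_resHom_swapHom (q : K) (k : ℕ) (f : Lau K →ₐ[K] R) (F : Lau K)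
    (P Q : LaurentSeries R) :
    ((resHom q (k + 1) (resHom q k f) F * (lsC K _ P * lsMap (lsC K R) Q)).coeff 1).coeff 1
      = ((resHom q (k + 1) (resHom q k f) (swapHom k F)
        * (lsC K _ Q * lsMap (lsC K R) P)).coeff 1).coeff 1 := by
  set J := resHom q (k + 1) (resHom q k f)
  have hw : (lsW (LaurentSeries R) : LaurentSeries (LaurentSeries R))
      = lsMap (lsC K R) (lsW R : LaurentSeries R) := (lsMap_lsW _).symm
  have hk : J (yVar k) = lsC K _ (lsW R : LaurentSeries R) := by
    rw [resHom_yVar_ne q (by omega), resHom_yVar_self]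
  have hk1 : J (yVar (k + 1)) = lsMap (lsC K R) (lsW R : LaurentSeries R) := by
    rw [resHom_yVar_self, hw]
  have hJ : ∀ i, i ≠ k → i ≠ k + 1 → J (yVar i)
      = ((lsC K (LaurentSeries R)).comp ((lsC K R).comp f)) (yUnit i : (Lau K)ˣ) := by
    intro i h1 h2
    rw [resHom_yVar_ne q h2, resHom_yVar_ne q h1]
    rfl
  -- Pairs that respect the exchange form a subalgebra, so it is enough to test power sums and
  -- powers of the variables.
  have hmem : (J.prod (J.comp (swapHom k))) F ∈ swapSub K R := by
    refine algHom_mem_of_gen (fun n => ?_) (fun i m => ?_) F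
    · have e : J (pSum n) = lsC K _ (lsC K R (f (pSum n)))
          - (q ^ (n + 1) - 1) • (lsC K _ ((lsW R : LaurentSeries R) ^ (n + 1))
            + lsMap (lsC K R) ((lsW R : LaurentSeries R) ^ (n + 1))) := by
        rw [resHom_pSum, resHom_pSum, map_sub, map_smul, map_pow _ (lsW R : LaurentSeries R),
          map_pow _ (lsW R : LaurentSeries R), hw, smul_add]
        abel
      have e' : (J.prod (J.comp (swapHom k))) (pSum n)
          = (lsC K _ (lsC K R (f (pSum n))), lsC K _ (lsC K R (f (pSum n))))
            - (q ^ (n + 1) - 1) • ((lsC K _ ((lsW R : LaurentSeries R) ^ (n + 1)),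
                lsMap (lsC K R) ((lsW R : LaurentSeries R) ^ (n + 1)))
              + (lsMap (lsC K R) ((lsW R : LaurentSeries R) ^ (n + 1)),
                lsC K _ ((lsW R : LaurentSeries R) ^ (n + 1)))) := by
        rw [AlgHom.prod_apply, AlgHom.comp_apply, swapHom_pSum, e]
        refine Prod.ext rfl ?_
        rw [add_comm (lsC K (LaurentSeries R) ((lsW R : LaurentSeries R) ^ (n + 1)))]
        rfl
      rw [e']
      exact (swapSub K R).sub_mem (mem_swapSub_const _) ((swapSub K R).smul_mem
        ((swapSub K R).add_mem (mem_swapSub_left _) (mem_swapSub_right _)) _)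
    · rw [AlgHom.prod_apply, AlgHom.comp_apply]
      rcases eq_or_ne i k with rfl | h1
      · rw [swapHom_yPow_left, algHom_yPow_of_eq hk, algHom_yPow_of_eq hk1]
        exact mem_swapSub_left _
      · rcases eq_or_ne i (k + 1) with rfl | h2
        · rw [swapHom_yPow_right, algHom_yPow_of_eq hk, algHom_yPow_of_eq hk1]
          exact mem_swapSub_right _
        · rw [swapHom_yPow_ne h1 h2, algHom_yPow_of_eq (hJ i h1 h2)]
          exact mem_swapSub_const _
  have := hmem 1 1 swapRes_one P Q
  simpa using this

lemma resHom_resHom_heckeT (q : K) (k : ℕ) (f : Lau K →ₐ[K] R) (F : Lau K) :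
    lsLin K (lsW R : LaurentSeries R) * resHom q (k + 1) (resHom q k f) (heckeT q k F)
      = (algebraMap K _ q - 1) * (lsC K _ (lsW R : LaurentSeries R)
          * resHom q (k + 1) (resHom q k f) F)
        + lsLin K (q • (lsW R : LaurentSeries R))
          * resHom q (k + 1) (resHom q k f) (swapHom k F) := by
  have h := congrArg (resHom q (k + 1) (resHom q k f)) (heckeT_eq q k F)
  rw [map_mul, map_add, map_mul, map_mul, map_mul, map_sub, map_sub, map_sub, map_mul, map_one,
    AlgHom.commutes, resHom_yVar_self, resHom_yVar_ne q (show k ≠ k + 1 by omega),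
    resHom_yVar_self] at h
  rw [lsLin, lsLin, h, map_smul, Algebra.smul_def]

lemma lsLin_smul (q : K) (x : R) :
    lsLin K (q • x) = lsW R - algebraMap K (LaurentSeries R) q * lsC K R x := by
  rw [lsLin, map_smul, Algebra.smul_def]

lemma lsC_lsLin (x : R) : lsC K (LaurentSeries R) (lsLin K x)
    = lsC K _ (lsW R : LaurentSeries R) - lsC K _ (lsC K R x) := by
  rw [lsLin, map_sub]

lemma lsC_lsLin_smul (q : K) (x : R) : lsC K (LaurentSeries R) (lsLin K (q • x))
    = lsC K _ (lsW R : LaurentSeries R) - algebraMap K _ q * lsC K _ (lsC K R x) := by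
  rw [lsLin_smul, map_sub, map_mul, AlgHom.commutes]

variable [CharZero K]

/-- Write `a, b` for the variables of `y_k, y_{k+1}`. Then `T_k F - F = (b - qa)/(b - a) (s_k F -
F)`, while the two exponentials contribute `(b - a)/(b - qa)` times a symmetric product. The
difference of the integrands is `s_k F - F` times that symmetric product, and its double residue
vanishes by exchange of the variables. -/
lemma dMinusOp_dMinusOp_heckeT (q : K) (k : ℕ) (F : Lau K) :
    dMinusOp q k (dMinusOp q (k + 1) (heckeT q k F)) = dMinusOp q k (dMinusOp q (k + 1) F) := by
  set psi := resHom q k (AlgHom.id K (Lau K))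
  set J := resHom q (k + 1) psi
  set E := expL K (pSum : ℕ → Lau K)
  set E' := expL K fun n => psi (pSum n)
  have hdd : ∀ G, dMinusOp q k (dMinusOp q (k + 1) G)
      = ((J G * E' * lsC K _ E).coeff 1).coeff 1 := by
    intro G
    rw [dMinusOp_eq, algHom_dMinusOp, mul_comm (J G * E'), coeff_lsC_mul, mul_comm E, neg_mul,
      HahnSeries.coeff_neg, neg_neg]
  have hE : lsMap (lsC K (Lau K)) E * lsLin K (lsW (Lau K) : LaurentSeries (Lau K))
      = E' * lsLin K (q • (lsW (Lau K) : LaurentSeries (Lau K))) := by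
    rw [lsMap_expL]
    exact expL_mul fun n => by simp only [psi, resHom_pSum, AlgHom.id_apply, sub_add_cancel]
  have hT := resHom_resHom_heckeT q k (AlgHom.id K (Lau K)) F
  have hs := coeff_resHom_resHom_swapHom q k (AlgHom.id K (Lau K)) F E E
  have hi := lsLin_mul_lsGeo (K := K) (q • (lsW (Lau K) : LaurentSeries (Lau K)))
  have hd : lsLin K (q • (lsW (Lau K) : LaurentSeries (Lau K)))
      = lsLin K (lsW (Lau K) : LaurentSeries (Lau K))
        - (algebraMap K _ q - 1) * lsC K _ (lsW (Lau K) : LaurentSeries (Lau K)) := by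
    rw [lsLin_smul, lsLin]
    ring
  have key : J (heckeT q k F) * E' * lsC K _ E = J F * E' * lsC K _ E
      + (J (swapHom k F) * (lsC K _ E * lsMap (lsC K (Lau K)) E)
        - J F * (lsC K _ E * lsMap (lsC K (Lau K)) E)) := by
    set D := lsLin K (lsW (Lau K) : LaurentSeries (Lau K))
    set Dq := lsLin K (q • (lsW (Lau K) : LaurentSeries (Lau K)))
    set G := lsGeo (q • (lsW (Lau K) : LaurentSeries (Lau K)))
    set B := lsMap (lsC K (Lau K)) E
    set A := lsC K (LaurentSeries (Lau K)) E
    change D * J (heckeT q k F) = _ * (_ * J F) + Dq * J (swapHom k F) at hT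
    linear_combination (-(J (heckeT q k F) - J F) * E' * A
        + (J (swapHom k F) - J F) * A * B) * hi - (J (heckeT q k F) - J F) * A * G * hE
        + A * B * G * hT + A * B * G * J F * hd
  rw [hdd, hdd, key, HahnSeries.coeff_add, HahnSeries.coeff_add, HahnSeries.coeff_sub,
    HahnSeries.coeff_sub, ← hs, sub_self, add_zero]

/-- Here `a, b` are the two residue variables, `s` is `t y_1`, and `Q` is `q`. `JT, JF, Js` come
from `T_k F, F, s_k F`; `A, B` are the exponentials at `a, b`; `ga, gb, G` invert `a - s, b - s, b -
Qa`. The integrand is `Q` times the desired one plus a bracket whose terms are matched by exchanging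
`a` and `b`. -/
lemma residue_aux {L : Type*} [CommRing L] {a b s Q JT JF Js Eh E1 Ep A B ga gb G : L}
    (hEp : B * (b - a) = Ep * (b - Q * a)) (hE1 : E1 * (b - s) = B * (b - Q * s))
    (hE2 : E1 * (b - a) = Eh * (b - Q * a))
    (hT : (b - a) * JT = (Q - 1) * (a * JF) + (b - Q * a) * Js)
    (hwq : (b - Q * a) * G = 1) (hga : (a - s) * ga = 1) (hgb : (b - s) * gb = 1) :
    JT * Eh * (A * ga) = Q * (JF * Ep * gb * A)
      + (Js * (A * ga * (B * (b - Q * s) * gb)) - JF * (A * (a - Q * s) * ga * (B * gb))) := by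
  have h1 : E1 = B * (b - Q * s) * gb := by linear_combination -E1 * hgb + gb * hE1
  have h2 : Eh = E1 * (b - a) * G := by linear_combination -Eh * hwq - G * hE2
  have h3 : Ep = B * (b - a) * G := by linear_combination -Ep * hwq - G * hEp
  rw [h2, h3, h1]
  linear_combination B * (b - Q * s) * gb * G * A * ga * hT
    + Js * A * B * (b - Q * s) * gb * ga * hwq
    + JF * A * B * gb * (Q * (b - a) * G * hga - (a - Q * s) * ga * hwq)

lemma phiStar_dMinusOp_heckeT (q t : K) {k : ℕ} {F : Lau K} (hF : SuppIn (k + 1) F) (hk : 1 ≤ k) :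
    phiStar q t k (dMinusOp q (k + 1) (heckeT q k F))
      = q • dMinusOp q (k + 1) (phiStar q t (k + 1) F) := by
  set h := resHom q k (shiftHom q t)
  set psi := resHom q (k + 1) (AlgHom.id K (Lau K))
  set J := resHom q (k + 1) h
  set E := expL K (pSum : ℕ → Lau K)
  set Eh := expL K fun n => h (pSum n)
  set Ep := expL K fun n => psi (pSum n)
  set s : Lau K := t • yVar 1
  set g := lsGeo s
  set w : LaurentSeries (Lau K) := Units.val (lsW (Lau K))
  have e1 : phiStar q t k (dMinusOp q (k + 1) (heckeT q k F))
      = -((J (heckeT q k F) * Eh * lsC K _ (E * g)).coeff 1).coeff 1 := by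
    rw [phiStar, algHom_dMinusOp, mul_comm (J _ * Eh), coeff_lsC_mul, mul_comm (E * g), neg_mul,
      HahnSeries.coeff_neg]
  -- The two orders of operations give the same substitution: `y_k` goes to the inner residue
  -- variable, `y_{k+1}` to the outer one, and the other variables are shifted.
  have hJ : resHom q (k + 1) (psi.comp (shiftHom q t)) F = J F := by
    refine algHom_eq_of_suppIn hF (fun n => ?_) fun i h1 h2 => ?_
    · simp only [J, h, psi, resHom_pSum, AlgHom.comp_apply, shiftHom_pSum, map_add, map_sub,
        map_smul, map_pow, resHom_yVar_ne q (show 1 ≠ k + 1 by omega), AlgHom.id_apply]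
      abel
    · rcases eq_or_ne i (k + 1) with rfl | hi
      · rw [resHom_yVar_self, resHom_yVar_self]
      · rw [resHom_yVar_ne q hi, resHom_yVar_ne q hi, AlgHom.comp_apply, shiftHom_yVar q t h1]
        rcases eq_or_ne i k with rfl | hi'
        · rw [resHom_yVar_self, resHom_yVar_self]
        · rw [resHom_yVar_ne q hi', resHom_yVar_ne q (show i + 1 ≠ k + 1 by omega),
            shiftHom_yVar q t h1, AlgHom.id_apply]
  have hps : psi s = lsC K _ s := by
    rw [map_smul, resHom_yVar_ne q (show 1 ≠ k + 1 by omega), AlgHom.id_apply, map_smul]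
  have e2 : dMinusOp q (k + 1) (phiStar q t (k + 1) F)
      = -((J F * Ep * lsGeo (lsC K _ s) * lsC K _ E).coeff 1).coeff 1 := by
    rw [dMinusOp_eq, phiStar, ← coeff_lsMap, map_mul, map_mul, lsMap_resHom, lsMap_expL,
      lsMap_lsGeo, hps, hJ, ← mul_assoc, mul_comm (J F * Ep * _), coeff_lsC_mul, mul_comm E]
  have hB : lsMap (lsC K (Lau K)) E = expL K fun n => lsC K (Lau K) (pSum n) := lsMap_expL _ _
  have hEp : lsMap (lsC K (Lau K)) E * lsLin K w = Ep * lsLin K (q • w) := by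
    rw [hB]
    exact expL_mul fun n => by simp only [psi, w, resHom_pSum, AlgHom.id_apply, sub_add_cancel]
  obtain ⟨E1, hE1, hE2⟩ : ∃ E1, E1 * lsLin K (lsC K _ s)
      = lsMap (lsC K (Lau K)) E * lsLin K (q • lsC K _ s) ∧
      E1 * lsLin K w = Eh * lsLin K (q • w) := by
    refine ⟨expL K fun n => lsC K _ (shiftHom q t (pSum n)), ?_, ?_⟩
    · rw [hB]
      exact expL_mul fun n => by rw [shiftHom_pSum, map_add, map_smul, map_pow]
    · exact expL_mul fun n => by simp only [h, w, resHom_pSum, sub_add_cancel]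
  have hT : lsLin K w * J (heckeT q k F) = (algebraMap K _ q - 1) * (lsC K _ w * J F)
      + lsLin K (q • w) * J (swapHom k F) := resHom_resHom_heckeT q k (shiftHom q t) F
  have hs := coeff_resHom_resHom_swapHom q k (shiftHom q t) F (E * lsLin K (q • s) * g) (E * g)
  change ((J F * _).coeff 1).coeff 1 = ((J (swapHom k F) * _).coeff 1).coeff 1 at hs
  have hwq := lsLin_mul_lsGeo (K := K) (q • w)
  have hga := congrArg (lsC K (LaurentSeries (Lau K))) (lsLin_mul_lsGeo (K := K) s)
  have hgb := lsLin_mul_lsGeo (K := K) (lsC K (Lau K) s)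
  have hgb' : lsMap (lsC K (Lau K)) g = lsGeo (lsC K _ s) := lsMap_lsGeo _ _
  have hlb : lsMap (lsC K (Lau K)) (lsLin K (q • s)) = lsLin K (q • lsC K _ s) := by
    rw [lsMap_lsLin, map_smul]
  have key : J (heckeT q k F) * Eh * lsC K _ (E * g)
      = algebraMap K _ q * (J F * Ep * lsGeo (lsC K _ s) * lsC K _ E)
      + (J (swapHom k F) * (lsC K _ (E * g) * lsMap (lsC K (Lau K)) (E * lsLin K (q • s) * g))
        - J F * (lsC K _ (E * lsLin K (q • s) * g) * lsMap (lsC K (Lau K)) (E * g))) := by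
    rw [map_mul, map_one, lsC_lsLin] at hga
    rw [lsLin_smul] at hEp hE1 hE2 hT hwq
    rw [map_mul _ E g, map_mul _ E g, map_mul _ (E * _) g, map_mul _ (E * _) g, map_mul _ E,
      map_mul _ E, lsC_lsLin_smul, hlb, hgb', lsLin_smul]
    exact residue_aux hEp hE1 hE2 hT hwq hga hgb
  rw [e1, e2, key, HahnSeries.coeff_add, HahnSeries.coeff_add, HahnSeries.coeff_sub,
    HahnSeries.coeff_sub, ← hs, sub_self, add_zero, ← AlgHom.commutes (lsC K _),
    ← AlgHom.commutes (lsC K (Lau K)), coeff_lsC_mul, coeff_lsC_mul, smul_neg, Algebra.smul_def]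

end DoubleResidue

/-! ### Invariance of `V_k` and `W_k` -/

section Closure

variable {K : Type*} [Field K]

/-- The algebra generated by the power sums and `y_1, …, y_k`. -/
def vSub (K : Type*) [Field K] (k : ℕ) : Subalgebra K (Lau K) :=
  Algebra.adjoin K (Set.range pSum ∪ yVar '' {i | 1 ≤ i ∧ i ≤ k})

lemma pSum_mem_vSub (k n : ℕ) : pSum n ∈ vSub K k :=
  Algebra.subset_adjoin (Or.inl ⟨n, rfl⟩)

lemma yVar_mem_vSub {k i : ℕ} (h1 : 1 ≤ i) (h2 : i ≤ k) : yVar i ∈ vSub K k :=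
  Algebra.subset_adjoin (Or.inr ⟨i, ⟨h1, h2⟩, rfl⟩)

lemma vSub_le {k : ℕ} {s : Subalgebra K (Lau K)} (hp : ∀ n, pSum n ∈ s)
    (hy : ∀ i, 1 ≤ i → i ≤ k → yVar i ∈ s) : vSub K k ≤ s := by
  refine Algebra.adjoin_le ?_
  rintro _ (⟨n, rfl⟩ | ⟨i, ⟨h1, h2⟩, rfl⟩)
  · exact hp n
  · exact hy i h1 h2

lemma algHom_mem_of_vSub {S : Type*} [CommRing S] [Algebra K S] {f : Lau K →ₐ[K] S}
    {s : Subalgebra K S} {k : ℕ} (hp : ∀ n, f (pSum n) ∈ s)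
    (hy : ∀ i, 1 ≤ i → i ≤ k → f (yVar i) ∈ s) {F : Lau K} (hF : F ∈ vSub K k) : f F ∈ s :=
  vSub_le (s := s.comap f) hp hy hF

lemma V_mul_mem {k : ℕ} {F G : Lau K} (hF : F ∈ V K k) (hG : G ∈ V K k) : F * G ∈ V K k := by
  classical
  intro a ha i
  have h : a ∈ (F * G).coeff.support := Finsupp.mem_support_iff.mpr ha
  obtain ⟨b, hb, c, hc, rfl⟩ := Finset.mem_add.mp (AddMonoidAlgebra.support_coeff_mul_subset F G h)
  have h1 := hF b (Finsupp.mem_support_iff.mp hb) i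
  have h2 := hG c (Finsupp.mem_support_iff.mp hc) i
  rw [Finsupp.add_apply]
  exact ⟨by omega, fun h => by
    by_cases hb0 : b i = 0
    · exact h2.2 (by omega)
    · exact h1.2 hb0⟩

/-- As a generated subalgebra, `V_k` can be shown to be preserved by a homomorphism on generators
alone. -/
lemma mem_V_iff {k : ℕ} {F : Lau K} : F ∈ V K k ↔ F ∈ vSub K k := by
  constructor
  · intro hF
    have hc : ∀ c : SymFun K, cst c ∈ vSub K k := by
      intro c
      induction c using MvPolynomial.induction_on with
      | C a =>
        rw [← MvPolynomial.algebraMap_eq, AlgHom.commutes]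
        exact (vSub K k).algebraMap_mem a
      | add a b ha hb => rw [map_add]; exact (vSub K k).add_mem ha hb
      | mul_X a n ha => rw [map_mul, cst_X]; exact (vSub K k).mul_mem ha (pSum_mem_vSub k n)
    have hm : ∀ a : ℕ →₀ ℤ, (∀ i, 0 ≤ a i ∧ (a i ≠ 0 → 1 ≤ i ∧ i ≤ k)) →
        AddMonoidAlgebra.single a 1 ∈ vSub K k := by
      intro a
      induction a using Finsupp.induction with
      | zero => exact fun _ => (vSub K k).one_mem
      | single_add i m a hi hm ih =>
        intro h
        have hi0 : a i = 0 := by simpa using hi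
        have hi1 := h i
        simp only [Finsupp.add_apply, Finsupp.single_eq_same, hi0, add_zero] at hi1
        lift m to ℕ using hi1.1
        have e : (AddMonoidAlgebra.single (Finsupp.single i (m : ℤ) + a) 1 : Lau K)
            = yVar i ^ m * AddMonoidAlgebra.single a 1 := by
          rw [yVar_pow, yPow, AddMonoidAlgebra.single_mul_single, one_mul]
        rw [e]
        refine (vSub K k).mul_mem ((vSub K k).pow_mem
          (yVar_mem_vSub (hi1.2 hm).1 (hi1.2 hm).2) m) (ih fun j => ?_)
        rcases eq_or_ne j i with rfl | hj
        · simp [hi0]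
        · simpa [Finsupp.single_apply, hj.symm] using h j
    rw [← AddMonoidAlgebra.sum_coeff_single F, Finsupp.sum]
    refine (vSub K k).sum_mem fun a ha => ?_
    rw [single_eq_cst_mul]
    exact (vSub K k).mul_mem (hc _) (hm a (hF a (Finsupp.mem_support_iff.mp ha)))
  · intro hF
    have h0 : ∀ c : SymFun K, cst c ∈ V K k := by
      intro c a ha i
      have : a = 0 := by
        by_contra h
        exact ha (by simp [cst_apply, AddMonoidAlgebra.coeff_single, Ne.symm h])
      simp [this]
    have h1 : (1 : Lau K) ∈ V K k := by simpa using h0 1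
    let s : Subalgebra K (Lau K) :=
      { V K k with
        mul_mem' := V_mul_mem
        algebraMap_mem' := fun r => by
          have := h0 (algebraMap K _ r)
          rwa [AlgHom.commutes] at this }
    exact vSub_le (s := s) (fun n => h0 _)
      (fun i h1' h2 => by
        have := yVar_mul_mem K ⟨h1', h2⟩ h1
        rwa [mul_one] at this) hF

/-- `y_1 ⋯ y_k`. -/
def yProd (K : Type*) [Field K] (k : ℕ) : Lau K := ∏ i ∈ Finset.Icc 1 k, yVar i

lemma mem_W_iff {k : ℕ} {F : Lau K} : F ∈ W K k ↔ yProd K k * F ∈ vSub K k := by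
  rw [← mem_V_iff]
  rfl

lemma yProd_succ (k : ℕ) : yProd K (k + 1) = yProd K k * yVar (k + 1) :=
  Finset.prod_Icc_succ_top (by omega) _

lemma swapHom_yProd {k i : ℕ} (h1 : 1 ≤ i) (h2 : i < k) :
    swapHom i (yProd K k) = yProd K k := by
  rw [yProd, map_prod]
  refine Finset.prod_equiv (Equiv.swap i (i + 1)) (fun j => ?_) fun j _ => swapHom_yVar i j
  simp only [Finset.mem_Icc, Equiv.swap_apply_def]
  split_ifs <;> omega

/-- The additional `y_1` in the denominator of `W_{k+1}` is exactly the pole introduced by `d_+^*`;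
this is why `W_•` is the right space. -/
lemma shiftHom_yProd (q t : K) (k : ℕ) : yVar 1 * shiftHom q t (yProd K k) = yProd K (k + 1) := by
  induction k with
  | zero => simp [yProd]
  | succ k ih =>
    rw [yProd_succ, map_mul, ← mul_assoc, ih, shiftHom_yVar q t (by omega), ← yProd_succ]

lemma SuppIn.of_yVar_mul {k i : ℕ} (h1 : 1 ≤ i) (h2 : i ≤ k) {F : Lau K}
    (hF : SuppIn k (yVar i * F)) : SuppIn k F := by
  intro a ha j hj
  rcases eq_or_ne j i with rfl | h
  · exact ⟨h1, h2⟩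
  · refine hF (Finsupp.single i 1 + a) ?_ j ?_
    · have : (yVar i * F).coeff (Finsupp.single i 1 + a) = F.coeff a := by
        simp [yVar, yPow, AddMonoidAlgebra.coeff_single_mul_apply]
      rwa [this]
    · simpa [Finsupp.single_apply, h.symm] using hj

lemma suppIn_of_mem_W {k : ℕ} {F : Lau K} (hF : F ∈ W K k) : SuppIn k F := by
  have h0 : SuppIn k (yProd K k * F) := fun a ha i hi => (hF a ha i).2 hi
  have : ∀ m ≤ k, ∀ G, SuppIn k (yProd K m * G) → SuppIn k G := by
    intro m
    induction m with
    | zero => intro _ G h; simpa [yProd] using h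
    | succ m ih =>
      intro hm G h
      rw [yProd_succ, mul_assoc] at h
      exact (ih (by omega) _ h).of_yVar_mul (by omega) hm
  exact this k le_rfl F h0

lemma suppIn_of_mem_V {k : ℕ} {F : Lau K} (hF : F ∈ V K k) : SuppIn k F :=
  fun a ha i hi => (hF a ha i).2 hi

lemma plethHom_mem_vSub (q : K) {k : ℕ} {F : Lau K} (hF : F ∈ vSub K k) :
    plethHom q 1 (k + 1) F ∈ vSub K (k + 1) := by
  refine algHom_mem_of_vSub (fun n => ?_) (fun i h1 h2 => ?_) hF
  · rw [plethHom_pSum]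
    exact add_mem (pSum_mem_vSub _ _) (Subalgebra.smul_mem _
      (pow_mem (yVar_mem_vSub (by omega) le_rfl) _) _)
  · rw [plethHom_yVar]
    exact yVar_mem_vSub h1 (by omega)

lemma plethHom_mem_W (q : K) {k : ℕ} {F : Lau K} (hF : F ∈ W K k) :
    plethHom q 1 (k + 1) F ∈ W K (k + 1) := by
  rw [mem_W_iff] at hF ⊢
  have e : plethHom q 1 (k + 1) (yProd K k) = yProd K k := by
    simp only [yProd, map_prod, plethHom_yVar]
  have := mul_mem (yVar_mem_vSub (K := K) (k := k + 1) (by omega) le_rfl) (plethHom_mem_vSub q hF)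
  rw [map_mul, e] at this
  rw [yProd_succ, mul_comm (yProd K k), mul_assoc]
  exact this

lemma heckeT_mem_vSub (q : K) {k i : ℕ} (h1 : 1 ≤ i) (h2 : i < k) {F : Lau K}
    (hF : F ∈ vSub K k) : heckeT q i F ∈ vSub K k := by
  have yi : yVar i ∈ vSub K k := yVar_mem_vSub h1 h2.le
  have yi' : yVar (i + 1) ∈ vSub K k := yVar_mem_vSub (by omega) h2
  have hq : algebraMap K (Lau K) q - 1 ∈ vSub K k :=
    sub_mem ((vSub K k).algebraMap_mem q) (one_mem _)
  -- `T_i` is not multiplicative. Instead, the elements whose multiplication preserves the condition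
  -- `T_i G ∈ V_k` form a subalgebra, and the generators satisfy this by the commutation rules of
  -- `T_i` with `y_i` and `y_{i+1}`.
  let s : Subalgebra K (Lau K) :=
    { carrier := {F | F ∈ vSub K k ∧
        ∀ G ∈ vSub K k, heckeT q i G ∈ vSub K k → heckeT q i (F * G) ∈ vSub K k}
      mul_mem' := fun {F F'} hF hF' => ⟨mul_mem hF.1 hF'.1, fun G hG hT => by
        rw [mul_assoc]
        exact hF.2 _ (mul_mem hF'.1 hG) (hF'.2 G hG hT)⟩
      add_mem' := fun {F F'} hF hF' => ⟨add_mem hF.1 hF'.1, fun G hG hT => by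
        rw [add_mul, heckeT_add]
        exact add_mem (hF.2 G hG hT) (hF'.2 G hG hT)⟩
      algebraMap_mem' := fun r => ⟨(vSub K k).algebraMap_mem r, fun G hG hT => by
        rw [heckeT_mul q i (AlgHom.commutes _ _)]
        exact mul_mem ((vSub K k).algebraMap_mem r) hT⟩ }
  have hs : vSub K k ≤ s := by
    refine vSub_le (fun n => ⟨pSum_mem_vSub k n, fun G hG hT => ?_⟩)
      fun j hj1 hj2 => ⟨yVar_mem_vSub hj1 hj2, fun G hG hT => ?_⟩
    · rw [heckeT_mul q i (swapHom_pSum i n)]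
      exact mul_mem (pSum_mem_vSub k n) hT
    · rcases eq_or_ne j i with rfl | hj
      · rw [heckeT_yVar_mul]
        exact sub_mem (mul_mem yi' hT) (mul_mem hq (mul_mem yi hG))
      · rcases eq_or_ne j (i + 1) with rfl | hj'
        · rw [heckeT_yVar_succ_mul]
          exact add_mem (mul_mem yi hT) (mul_mem hq (mul_mem yi hG))
        · rw [heckeT_mul q i (swapHom_ne hj hj')]
          exact mul_mem (yVar_mem_vSub hj1 hj2) hT
  have := (hs hF).2 1 (one_mem _) (by rw [heckeT_one]; exact one_mem _)
  rwa [mul_one] at this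

lemma heckeT_mem_W (q : K) {k i : ℕ} (h1 : 1 ≤ i) (h2 : i < k) {F : Lau K}
    (hF : F ∈ W K k) : heckeT q i F ∈ W K k := by
  rw [mem_W_iff] at hF ⊢
  rw [← heckeT_mul q i (swapHom_yProd h1 h2)]
  exact heckeT_mem_vSub q h1 h2 hF

lemma shiftHom_mem_vSub (q t : K) {k : ℕ} {F : Lau K} (hF : F ∈ vSub K k) :
    shiftHom q t F ∈ vSub K (k + 1) := by
  refine algHom_mem_of_vSub (fun n => ?_) (fun i h1 h2 => ?_) hF
  · rw [shiftHom_pSum]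
    exact add_mem (pSum_mem_vSub _ _) (Subalgebra.smul_mem _
      (pow_mem (Subalgebra.smul_mem _ (yVar_mem_vSub le_rfl (by omega)) _) _) _)
  · rw [shiftHom_yVar q t h1]
    exact yVar_mem_vSub (by omega) (by omega)

lemma starHom_mem_W (q t : K) {k : ℕ} {F : Lau K} (hF : F ∈ W K k) :
    starHom q t F ∈ W K (k + 1) := by
  rw [mem_W_iff] at hF ⊢
  have e : yProd K (k + 1) * starHom q t F
      = algebraMap K (Lau K) (-(q * t)⁻¹) * shiftHom q t (yProd K k * F) := by
    rw [← shiftHom_yProd q t, starHom_eq, map_mul]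
    linear_combination algebraMap K (Lau K) (-(q * t)⁻¹) * shiftHom q t (yProd K k)
      * shiftHom q t F * yPow_neg_one_mul (K := K) 1
  rw [e]
  exact mul_mem (Subalgebra.algebraMap_mem _ _) (shiftHom_mem_vSub q t hF)

lemma yVar_mul_mem_W {k i : ℕ} (h1 : 1 ≤ i) (h2 : i ≤ k) {F : Lau K} (hF : F ∈ W K k) :
    yVar i * F ∈ W K k := by
  rw [mem_W_iff] at hF ⊢
  rw [mul_left_comm]
  exact mul_mem (yVar_mem_vSub h1 h2) hF

/-- The Laurent series with coefficients in a subalgebra. -/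
def coeffSub {S : Type*} [CommRing S] [Algebra K S] (s : Subalgebra K S) :
    Subalgebra K (LaurentSeries S) where
  carrier := {A | ∀ n, A.coeff n ∈ s}
  mul_mem' := by
    intro A B hA hB n
    rw [HahnSeries.coeff_mul]
    exact s.sum_mem fun p _ => s.mul_mem (hA _) (hB _)
  add_mem' := by
    intro A B hA hB n
    rw [HahnSeries.coeff_add]
    exact s.add_mem (hA n) (hB n)
  algebraMap_mem' := by
    intro r n
    have h := coeff_lsC_mul (K := K) (algebraMap K S r) 1 n
    rw [mul_one, AlgHom.commutes] at h
    rw [h, HahnSeries.coeff_one]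
    split_ifs
    · rw [mul_one]; exact s.algebraMap_mem r
    · rw [mul_zero]; exact s.zero_mem

section

variable {S : Type*} [CommRing S] [Algebra K S] {s : Subalgebra K S}

lemma coeff_mem {A : LaurentSeries S} (h : A ∈ coeffSub s) (n : ℤ) : A.coeff n ∈ s := h n

lemma lsW_zpow_mem (m : ℤ) : ((lsW S ^ m : (LaurentSeries S)ˣ) : LaurentSeries S) ∈ coeffSub s := by
  intro n
  rw [lsW_zpow, HahnSeries.coeff_single]
  split_ifs
  · exact s.one_mem
  · exact s.zero_mem

lemma lsW_mem : (lsW S : LaurentSeries S) ∈ coeffSub s := by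
  simpa using lsW_zpow_mem (s := s) 1

lemma lsW_inv_mem : (((lsW S)⁻¹ : (LaurentSeries S)ˣ) : LaurentSeries S) ∈ coeffSub s := by
  simpa using lsW_zpow_mem (s := s) (-1)

lemma lsC_mem {c : S} (hc : c ∈ s) : lsC K S c ∈ coeffSub s := by
  intro n
  have h := coeff_lsC_mul (K := K) c 1 n
  rw [mul_one] at h
  rw [h, HahnSeries.coeff_one]
  split_ifs
  · rwa [mul_one]
  · rw [mul_zero]; exact s.zero_mem

lemma lsPow_mem {A : PowerSeries S} (h : ∀ n, PowerSeries.coeff n A ∈ s) :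
    lsPow A ∈ coeffSub s := by
  intro n
  rcases lt_or_ge n 0 with hn | hn
  · rw [coeff_lsPow_of_neg _ hn]; exact s.zero_mem
  · lift n to ℕ using hn
    rw [lsPow, HahnSeries.ofPowerSeries_apply_coeff]
    exact h n

lemma lsGeo_mem {x : S} (hx : x ∈ s) : lsGeo x ∈ coeffSub s := by
  refine mul_mem lsW_inv_mem (lsPow_mem fun n => ?_)
  rw [PowerSeries.coeff_mk]
  exact pow_mem hx n

lemma expL_mem [CharZero K] {P : ℕ → S} (hP : ∀ n, P n ∈ s) : expL K P ∈ coeffSub s := by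
  refine lsPow_mem fun n => ?_
  rw [expPS, PowerSeries.coeff_map]
  have : ∀ c : SymFun K, MvPolynomial.aeval P c ∈ s := by
    intro c
    induction c using MvPolynomial.induction_on with
    | C a => rw [← MvPolynomial.algebraMap_eq, AlgHom.commutes]; exact s.algebraMap_mem a
    | add a b ha hb => rw [map_add]; exact s.add_mem ha hb
    | mul_X a n ha => rw [map_mul, MvPolynomial.aeval_X]; exact s.mul_mem ha (hP n)
  exact this _

lemma resHom_mem (q : K) {k : ℕ} {f : Lau K →ₐ[K] S} (hp : ∀ n, f (pSum n) ∈ s)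
    (hy : ∀ i, 1 ≤ i → i < k → f (yVar i) ∈ s) {F : Lau K} (hF : F ∈ vSub K k) :
    resHom q k f F ∈ coeffSub s := by
  refine algHom_mem_of_vSub (fun n => ?_) (fun i h1 h2 => ?_) hF
  · rw [resHom_pSum]
    exact sub_mem (lsC_mem (hp n)) (Subalgebra.smul_mem _ (pow_mem lsW_mem _) _)
  · rcases eq_or_ne i k with rfl | h
    · rw [resHom_yVar_self]; exact lsW_mem
    · rw [resHom_yVar_ne q h]; exact lsC_mem (hy i h1 (by omega))

end

variable [CharZero K]

/-- A pole in `y_{k+1}` is harmless: it only multiplies the series by `w⁻¹`, and all coefficients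
stay free of it. -/
lemma dMinusOp_mem_vSub (q : K) {k : ℕ} {F : Lau K} (hF : yVar (k + 1) * F ∈ vSub K (k + 1)) :
    dMinusOp q (k + 1) F ∈ vSub K k := by
  have h := resHom_mem q (f := AlgHom.id K (Lau K)) (s := vSub K k) (pSum_mem_vSub k)
    (fun i h1 h2 => yVar_mem_vSub h1 (by omega)) hF
  rw [map_mul, resHom_yVar_self] at h
  have h' := mul_mem lsW_inv_mem h
  rw [Units.inv_mul_cancel_left] at h'
  rw [dMinusOp_eq]
  exact neg_mem (coeff_mem (mul_mem h' (expL_mem (pSum_mem_vSub k))) 1)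

lemma dMinusOp_mem_V (q : K) {k : ℕ} {F : Lau K} (hF : F ∈ V K (k + 1)) :
    dMinusOp q (k + 1) F ∈ V K k := by
  rw [mem_V_iff] at hF ⊢
  exact dMinusOp_mem_vSub q (mul_mem (yVar_mem_vSub (by omega) le_rfl) hF)

/-- The denominators `y_1, …, y_k` pass through `d_-`, and the remaining simple pole in `y_{k+1}` is
removed by the residue. -/
lemma dMinusOp_mem_W (q : K) {k : ℕ} {F : Lau K} (hF : F ∈ W K (k + 1)) :
    dMinusOp q (k + 1) F ∈ W K k := by
  rw [mem_W_iff] at hF ⊢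
  have : ∀ m ≤ k, ∀ G, yProd K m * dMinusOp q (k + 1) G = dMinusOp q (k + 1) (yProd K m * G) := by
    intro m
    induction m with
    | zero => intro _ G; simp [yProd]
    | succ m ih =>
      intro hm G
      rw [yProd_succ, mul_assoc, mul_assoc, ← ih (by omega), dMinusOp_yVar_mul q (by omega)]
  rw [this k le_rfl]
  refine dMinusOp_mem_vSub q ?_
  rwa [← mul_assoc, mul_comm (yVar _), ← yProd_succ]

/-- The residue formula contains only polynomial values of the `p_n` and `y_i` and the expansion of
`1/(w - t y_1)`, whose coefficients are polynomial. So the commutator preserves `V_k` although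
`d_+^*` has a pole. -/
lemma phiStar_mem_V (q t : K) {k : ℕ} (hk : 1 ≤ k) {F : Lau K} (hF : F ∈ V K k) :
    phiStar q t k F ∈ V K k := by
  rw [mem_V_iff] at hF ⊢
  have hs : t • yVar 1 ∈ vSub K k := Subalgebra.smul_mem _ (yVar_mem_vSub le_rfl hk) _
  refine coeff_mem (mul_mem (resHom_mem q (fun n => ?_) (fun i h1 h2 => ?_) hF)
    (mul_mem (expL_mem (pSum_mem_vSub k)) (lsGeo_mem hs))) 1
  · rw [shiftHom_pSum]
    exact add_mem (pSum_mem_vSub _ _) (Subalgebra.smul_mem _ (pow_mem hs _) _)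
  · rw [shiftHom_yVar q t h1]
    exact yVar_mem_vSub (by omega) (by omega)

end Closure

/-! ### Operators between single summands of a direct sum -/

section Block

variable {K₀ K : Type*} [Field K₀] [Field K] [Algebra K₀ K] {M : ℕ → Submodule K (Lau K)}

instance directSumAddCommGroup : AddCommGroup (DirectSum ℕ fun k => M k) :=
  Module.addCommMonoidToAddCommGroup K

open Classical in
/-- The operator on `⨁ M_k` which is `g` on `M_k`, with values in `M_l`, and zero on the other
summands. -/
def opBlk (M : ℕ → Submodule K (Lau K)) (k l : ℕ) (g : Lau K →ₗ[K] Lau K) :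
    Module.End K (DirectSum ℕ fun k => M k) :=
  if h : ∀ F ∈ M k, g F ∈ M l then
    DirectSum.lof K ℕ (fun k => M k) l ∘ₗ g.restrict h
      ∘ₗ DirectSum.component K ℕ (fun k => M k) k
  else 0

variable {k l m : ℕ}

lemma opBlk_apply {g : Lau K →ₗ[K] Lau K} (h : ∀ F ∈ M k, g F ∈ M l) (w : DirectSum ℕ fun k => M k) :
    opBlk M k l g w = DirectSum.of (fun k => M k) l ⟨g (w k), h _ (w k).2⟩ := by
  rw [opBlk, dif_pos h]
  rfl

/-- The operator `X` on `⨁ M_k` is `f` on `M_k`, with values in `M_l`, and zero on the other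
summands. -/
def IsBlk (M : ℕ → Submodule K (Lau K)) (k l : ℕ) (f : Lau K → Lau K)
    (X : Module.End K (DirectSum ℕ fun k => M k)) : Prop :=
  ∃ h : ∀ F ∈ M k, f F ∈ M l,
    ∀ w, X w = DirectSum.of (fun k => M k) l ⟨f (w k), h _ (w k).2⟩

variable {f f' : Lau K → Lau K} {X X' : Module.End K (DirectSum ℕ fun k => M k)}

lemma isBlk_opBlk {g : Lau K →ₗ[K] Lau K} (h : ∀ F ∈ M k, g F ∈ M l) :
    IsBlk M k l g (opBlk M k l g) := ⟨h, opBlk_apply h⟩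

lemma IsBlk.mem (h : IsBlk M k l f X) {F : Lau K} (hF : F ∈ M k) : f F ∈ M l := h.1 F hF

lemma IsBlk.apply_coe (h : IsBlk M k l f X) (w : DirectSum ℕ fun k => M k) :
    (X w l : Lau K) = f (w k) := by
  rw [h.2, DirectSum.of_eq_same]

/-- This reduces every relation between endomorphisms of the direct sum to an identity of functions
on one summand. -/
lemma IsBlk.eq (h : IsBlk M k l f X) (h' : IsBlk M k l f' X') (e : ∀ F ∈ M k, f F = f' F) :
    X = X' := by
  refine LinearMap.ext fun w => ?_
  rw [h.2, h'.2]
  congr 2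
  exact e _ (w k).2

lemma IsBlk.congr (h : IsBlk M k l f X) (e : ∀ F ∈ M k, f F = f' F) : IsBlk M k l f' X := by
  refine ⟨fun F hF => e F hF ▸ h.mem hF, fun w => ?_⟩
  rw [h.2]
  congr 2
  exact e _ (w k).2

lemma IsBlk.mul (h' : IsBlk M l m f' X') (h : IsBlk M k l f X) :
    IsBlk M k m (fun F => f' (f F)) (X' * X) := by
  refine ⟨fun F hF => h'.mem (h.mem hF), fun w => ?_⟩
  rw [Module.End.mul_apply, h'.2]
  congr 2
  rw [h.apply_coe]

lemma IsBlk.sub (h : IsBlk M k l f X) (h' : IsBlk M k l f' X') :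
    IsBlk M k l (fun F => f F - f' F) (X - X') := by
  refine ⟨fun F hF => sub_mem (h.mem hF) (h'.mem hF), fun w => ?_⟩
  rw [LinearMap.sub_apply, h.2, h'.2, ← map_sub]
  rfl

lemma IsBlk.smul (c : K₀) (h : IsBlk M k l f X) :
    IsBlk M k l (fun F => algebraMap K₀ K c • f F) (c • X) := by
  refine ⟨fun F hF => (M l).smul_mem _ (h.mem hF), fun w => ?_⟩
  rw [LinearMap.smul_apply, h.2, ← algebraMap_smul K c]
  exact ((DirectSum.lof K ℕ (fun k => M k) l).map_smul _ _).symm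

lemma IsBlk.mul_of_ne {l' : ℕ} (h' : IsBlk M l' m f' X') (h : IsBlk M k l f X) (hl : l ≠ l')
    (h0 : f' 0 = 0) : X' * X = 0 := by
  refine LinearMap.ext fun w => ?_
  rw [Module.End.mul_apply, h'.2, h.2, LinearMap.zero_apply]
  have : (⟨f' ((DirectSum.of (fun k => M k) l ⟨f (w k), h.mem (w k).2⟩) l'), h'.mem (Subtype.prop _)⟩
      : M m) = 0 := by
    refine Subtype.ext ?_
    rw [DirectSum.of_eq_of_ne _ _ _ hl.symm]
    exact h0
  rw [this, map_zero]

lemma IsBlk.id_mul {E : Module.End K (DirectSum ℕ fun k => M k)} (hE : IsBlk M l l (fun F => F) E)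
    (h : IsBlk M k l f X) : E * X = X := (hE.mul h).eq h fun _ _ => rfl

lemma IsBlk.mul_id {E : Module.End K (DirectSum ℕ fun k => M k)} (hE : IsBlk M k k (fun F => F) E)
    (h : IsBlk M k l f X) : X * E = X := (h.mul hE).eq h fun _ _ => rfl

end Block

/-! ### Restriction of representations to an invariant subspace -/

section Restrict

variable {K₀ K : Type*} [Field K₀] [Field K] [Algebra K₀ K] {V W : Type*} [AddCommGroup V]
  [AddCommGroup W] [Module K V] [Module K W] [Module K₀ V] [Module K₀ W] [IsScalarTower K₀ K V]
  [IsScalarTower K₀ K W]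

/-- The endomorphisms that preserve the range of a linear map. -/
def stabRange (K₀ : Type*) [Field K₀] [Algebra K₀ K] [Module K₀ W] [IsScalarTower K₀ K W]
    (i : V →ₗ[K] W) : Subalgebra K₀ (Module.End K W) where
  carrier := {f | ∀ v, ∃ v', f (i v) = i v'}
  mul_mem' := by
    intro f f' hf hf' v
    obtain ⟨v', h'⟩ := hf' v
    obtain ⟨v'', h''⟩ := hf v'
    exact ⟨v'', by rw [Module.End.mul_apply, h', h'']⟩
  add_mem' := by
    intro f f' hf hf' v
    obtain ⟨v', h'⟩ := hf' v
    obtain ⟨v'', h''⟩ := hf v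
    exact ⟨v'' + v', by rw [LinearMap.add_apply, h', h'', map_add]⟩
  algebraMap_mem' := fun r v => ⟨algebraMap K₀ K r • v, by
    rw [map_smul, algebraMap_smul]
    rfl⟩

/-- The preimages are chosen pointwise; injectivity of the inclusion makes them unique, hence linear
and multiplicative. -/
lemma exists_restrict {A : Type*} [Ring A] [Algebra K₀ A] (f : A →ₐ[K₀] Module.End K W)
    {i : V →ₗ[K] W} (hi : Function.Injective i) (h : ∀ a, f a ∈ stabRange K₀ i) :
    ∃ τ : A →ₐ[K₀] Module.End K V, ∀ a v, f a (i v) = i (τ a v) := by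
  choose τ hτ using h
  refine ⟨{ toFun := fun a =>
              { toFun := τ a
                map_add' := fun v w => hi ?_
                map_smul' := fun c v => hi ?_ }
            map_one' := LinearMap.ext fun v => hi ?_
            map_mul' := fun a b => LinearMap.ext fun v => hi ?_
            map_zero' := LinearMap.ext fun v => hi ?_
            map_add' := fun a b => LinearMap.ext fun v => hi ?_
            commutes' := fun r => LinearMap.ext fun v => hi ?_ }, hτ⟩
  · rw [← hτ, map_add, map_add, map_add, hτ, hτ]
  · rw [← hτ, map_smul, map_smul, hτ, RingHom.id_apply, map_smul]
  · change i (τ 1 v) = i v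
    rw [← hτ, map_one]
    rfl
  · change i (τ (a * b) v) = i (τ a (τ b v))
    rw [← hτ, map_mul, Module.End.mul_apply, hτ, hτ]
  · change i (τ 0 v) = i 0
    rw [← hτ, map_zero, map_zero]
    rfl
  · change i (τ (a + b) v) = i (τ a v + τ b v)
    rw [← hτ, map_add, LinearMap.add_apply, hτ, hτ, map_add]
  · change i (τ (algebraMap K₀ A r) v) = i (r • v)
    rw [← hτ, AlgHom.commutes, ← algebraMap_smul K r v, map_smul, algebraMap_smul]
    rfl

end Restrict

/-! ### The inclusion of `V_•` into `W_•` -/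

section Incl

variable {K₀ K : Type*} [Field K₀] [Field K] [Algebra K₀ K]

lemma inclVW_apply (v : VBullet K) (k : ℕ) : (inclVW K v k : Lau K) = v k := by
  rw [inclVW, DirectSum.lmap_apply]
  rfl

lemma inclVW_injective : Function.Injective (inclVW K) := by
  intro v w h
  refine DFinsupp.ext fun k => Subtype.ext ?_
  have := congrArg (fun x : WBullet K => (x k : Lau K)) h
  simpa only [inclVW_apply] using this

lemma inclVW_of (k : ℕ) (x : V K k) : inclVW K (DirectSum.of (fun k => V K k) k x)
    = DirectSum.of (fun k => W K k) k ⟨x, V_le_W K k x.2⟩ := by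
  exact DirectSum.lmap_lof _ _ _

lemma IsBlk.mem_stabRange {k l : ℕ} {f : Lau K → Lau K} {X : Module.End K (WBullet K)} (h : IsBlk (W K) k l f X)
    (h' : ∀ F ∈ V K k, f F ∈ V K l) : X ∈ stabRange K₀ (inclVW K) := by
  refine fun v => ⟨DirectSum.of (fun k => V K k) l ⟨f (v k), h' _ (v k).2⟩, ?_⟩
  rw [h.2, inclVW_of]
  exact congrArg _ (Subtype.ext (congrArg f (inclVW_apply v k)))

end Incl

/-! ### The representation on `W_•` -/

section Representation

variable {K : Type*} [Field K]

/-- `d_+^*` as a linear map. -/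
def starL (q t : K) : Lau K →ₗ[K] Lau K :=
  LinearMap.mulLeft K (algebraMap K (Lau K) (-(q * t)⁻¹) * yPow 1 (-1))
    ∘ₗ (shiftHom q t).toLinearMap

lemma starL_apply (q t : K) (F : Lau K) : starL q t F = starHom q t F :=
  (starHom_eq q t F).symm

/-- Undoing the normalisation `-(q t y_1)⁻¹` serves twice: it yields the relation `φ^* τ = -qt y_1
d_+^*`, and it identifies `-qt y_1 d_+^*` with the operator of Carlsson and Mellit. -/
lemma shiftHom_eq_smul {q t : K} (hq : q ≠ 0) (ht : t ≠ 0) (F : Lau K) :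
    shiftHom q t F = -(q * t) • (yVar 1 * starHom q t F) := by
  have h : -(q * t) * -(q * t)⁻¹ = 1 := by
    rw [neg_mul_neg, mul_inv_cancel₀ (mul_ne_zero hq ht)]
  rw [starHom_eq, Algebra.smul_def]
  calc shiftHom q t F = algebraMap K (Lau K) (-(q * t) * -(q * t)⁻¹) * (yPow 1 (-1) * yVar 1)
        * shiftHom q t F := by rw [h, yPow_neg_one_mul, map_one, one_mul, one_mul]
    _ = _ := by rw [map_mul]; ring

/-- The operator `Id_k` on `W_•`. -/
def eB (K : Type*) [Field K] (k : ℕ) : Module.End K (WBullet K) := opBlk (W K) k k LinearMap.id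

/-- The operator `F ↦ F[X + (q - 1) y_{k+1}]` on `W_•`. -/
def tauB (q : K) (k : ℕ) : Module.End K (WBullet K) :=
  opBlk (W K) k (k + 1) (plethHom q 1 (k + 1)).toLinearMap

/-- The operator `d_+^*` on `W_•`. -/
def starB (q t : K) (k : ℕ) : Module.End K (WBullet K) := opBlk (W K) k (k + 1) (starL q t)

/-- The operator `T_i` on `W_•`. -/
def tB (q : K) (k i : ℕ) : Module.End K (WBullet K) := opBlk (W K) k k (heckeTL q i)

/-- The operator `y_i` on `W_•`. -/
def yB (K : Type*) [Field K] (k i : ℕ) : Module.End K (WBullet K) :=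
  opBlk (W K) k k (LinearMap.mulLeft K (yVar i))

lemma isBlk_e (k : ℕ) : IsBlk (W K) k k (fun F => F) (eB K k) :=
  isBlk_opBlk (g := LinearMap.id) fun _ hF => hF

lemma isBlk_tau (q : K) (k : ℕ) : IsBlk (W K) k (k + 1) (plethHom q 1 (k + 1)) (tauB q k) :=
  isBlk_opBlk (g := (plethHom q 1 (k + 1)).toLinearMap) fun _ hF => plethHom_mem_W q hF

lemma isBlk_star (q t : K) (k : ℕ) : IsBlk (W K) k (k + 1) (starHom q t) (starB q t k) :=
  (isBlk_opBlk fun F hF => (starL_apply q t F).symm ▸ starHom_mem_W q t hF).congr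
    fun F _ => starL_apply q t F

lemma isBlk_T (q : K) {k i : ℕ} (h1 : 1 ≤ i) (h2 : i < k) :
    IsBlk (W K) k k (heckeT q i) (tB q k i) :=
  isBlk_opBlk (g := heckeTL q i) fun _ hF => heckeT_mem_W q h1 h2 hF

lemma isBlk_y {k i : ℕ} (h1 : 1 ≤ i) (h2 : i ≤ k) :
    IsBlk (W K) k k (fun F => yVar i * F) (yB K k i) :=
  isBlk_opBlk (g := LinearMap.mulLeft K (yVar i)) fun _ hF => yVar_mul_mem_W h1 h2 hF

section Parameters

variable {K₀ : Type*} [Field K₀] [Algebra K₀ K] {q t : K₀}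

local notation "qK" => algebraMap K₀ K q
local notation "tK" => algebraMap K₀ K t

lemma tB_mul_tB {k i : ℕ} (h1 : 1 ≤ i) (h2 : i < k) :
    tB qK k i * tB qK k i = q • eB K k - (q - 1) • tB qK k i := by
  refine ((isBlk_T qK h1 h2).mul (isBlk_T qK h1 h2)).eq
    (((isBlk_e k).smul q).sub ((isBlk_T qK h1 h2).smul (q - 1))) fun F _ => ?_
  rw [heckeT_heckeT, map_sub, map_one]

lemma heckeSystem_W : HeckeSystem q (eB K) (tB qK) fun k i => heckeInv q (eB K k) (tB qK k i) where
  e_e k := (isBlk_e k).id_mul (isBlk_e k)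
  e_T k _ h1 h2 := (isBlk_e k).id_mul (isBlk_T qK h1 h2)
  T_e k _ h1 h2 := (isBlk_e k).mul_id (isBlk_T qK h1 h2)
  Ti_eq _ _ _ _ := rfl
  T_T _ _ h1 h2 := tB_mul_tB h1 h2
  braidSeq k := ⟨fun i h1 h2 =>
      have hi := isBlk_T (k := k) qK h1 (by omega)
      have hj := isBlk_T qK (by omega) h2
      ((hi.mul hj).mul hi).eq ((hj.mul hi).mul hj) fun F _ => heckeT_braid qK i F,
    fun i j h1 h2 h3 =>
      have hi := isBlk_T (k := k) qK h1 (by omega)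
      have hj := isBlk_T qK (by omega) h3
      (hi.mul hj).eq (hj.mul hi) fun F _ => heckeT_comm qK h2 F⟩

end Parameters

variable [CharZero K]

/-- `d_-` as a linear map. -/
def dMinusL (q : K) (k : ℕ) : Lau K →ₗ[K] Lau K where
  toFun := dMinusOp q k
  map_add' F G := by
    rw [dMinusOp_eq, dMinusOp_eq, dMinusOp_eq, map_add, add_mul, HahnSeries.coeff_add, neg_add]
  map_smul' c F := by
    rw [dMinusOp_eq, dMinusOp_eq, map_smul, smul_mul_assoc, Algebra.smul_def,
      ← AlgHom.commutes (lsC K (Lau K)), coeff_lsC_mul, RingHom.id_apply, Algebra.smul_def]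
    ring

/-- The operator `d_-` on `W_•`. -/
def dmB (q : K) (k : ℕ) : Module.End K (WBullet K) := opBlk (W K) (k + 1) k (dMinusL q (k + 1))

lemma isBlk_dm (q : K) (k : ℕ) : IsBlk (W K) (k + 1) k (dMinusOp q (k + 1)) (dmB q k) :=
  isBlk_opBlk (g := dMinusL q (k + 1)) fun _ hF => dMinusOp_mem_W q hF

variable {K₀ : Type*} [Field K₀] [Algebra K₀ K] {q t : K₀}

local notation "qK" => algebraMap K₀ K q
local notation "tK" => algebraMap K₀ K t

lemma isBlk_phi (hq : q ≠ 0) (hq1 : q ≠ 1) (ht : t ≠ 0) (n : ℕ) :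
    IsBlk (W K) (n + 1) (n + 1) (phiStar qK tK (n + 1)) (phiOf q⁻¹ (starB qK tK) (dmB qK) n) := by
  have hQ : qK ≠ 0 := by simpa using hq
  have hT : tK ≠ 0 := by simpa using ht
  have h : qK⁻¹ - 1 ≠ 0 := by
    rw [← map_inv₀, ← map_one (algebraMap K₀ K), ← map_sub, map_ne_zero]
    exact fun h => hq1 (inv_eq_one.mp (sub_eq_zero.mp h))
  refine (IsBlk.smul (q⁻¹ - 1)⁻¹ (((isBlk_star qK tK n).mul (isBlk_dm qK n)).sub
    ((isBlk_dm qK (n + 1)).mul (isBlk_star qK tK (n + 1))))).congr fun F hF => ?_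
  rw [starHom_dMinusOp hQ hT (suppIn_of_mem_W hF) (by omega), smul_smul, map_inv₀, map_sub,
    map_inv₀, map_one, inv_mul_cancel₀ h, one_smul]

/-- The operators on `W_•` satisfy the relations that imply those of `𝔸_{q,t}`. -/
theorem opSystem_W (hq : q ≠ 0) (hq1 : q ≠ 1) (ht : t ≠ 0) :
    OpSystem q t (eB K) (tauB qK) (starB qK tK) (dmB qK) (tB qK)
      (fun k i => heckeInv q (eB K k) (tB qK k i)) (yB K) := by
  have hQ : qK ≠ 0 := by simpa using hq
  have hT : tK ≠ 0 := by simpa using ht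
  have tau := isBlk_tau qK
  have star := isBlk_star qK tK
  have dm := isBlk_dm qK
  have phi := isBlk_phi (K := K) hq hq1 ht
  have hT' : ∀ {k i : ℕ}, 1 ≤ i → i < k → IsBlk (W K) k k (heckeT qK i) (tB qK k i) := isBlk_T qK
  have hy : ∀ {k i : ℕ}, 1 ≤ i → i ≤ k → IsBlk (W K) k k (fun F => yVar i * F) (yB K k i) :=
    isBlk_y
  refine { heckeSystem_W with
    e_tau := fun k => (isBlk_e _).id_mul (tau k)
    tau_e := fun k => (isBlk_e _).mul_id (tau k)
    e_dps := fun k => (isBlk_e _).id_mul (star k)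
    dps_e := fun k => (isBlk_e _).mul_id (star k)
    e_dm := fun k => (isBlk_e _).id_mul (dm k)
    dm_e := fun k => (isBlk_e _).mul_id (dm k)
    e_y := fun k i h1 h2 => (isBlk_e _).id_mul (hy h1 h2)
    y_e := fun k i h1 h2 => (isBlk_e _).mul_id (hy h1 h2)
    T_y_T := fun k i h1 h2 => ?_
    y_T := fun k i j hi hj hij => ?_
    y_comm := fun k i j hi hj => ?_
    dm_y := fun k i h1 h2 => ?_
    tau_y := fun k i h1 h2 => ?_
    tau_T := fun k i h1 h2 => ?_
    T_tau_tau := fun k => ?_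
    dm_T := fun k i h1 h2 => ?_
    dm_dm_T := fun n => ?_
    tau_dm := fun n => ?_
    dps_T := fun k i h1 h2 => ?_
    dps_y := fun k i h1 h2 => ?_
    T_dps_dps := fun k => ?_
    phi_dm_T := fun n => ?_
    T_dps_phi := fun n => ?_
    phi_T_tau := fun n => ?_
    phi_tau := fun k => ?_ }
  · exact (((hT' h1 h2).mul (hy (by omega) h2)).mul (hT' h1 h2)).eq ((hy h1 h2.le).smul q)
      fun F _ => heckeT_y_heckeT qK i F
  · exact ((hy hi.1 hi.2).mul (hT' hj.1 hj.2)).eq ((hT' hj.1 hj.2).mul (hy hi.1 hi.2))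
      fun F _ => (heckeT_mul qK j (swapHom_ne hij.1 hij.2) F).symm
  · exact ((hy hi.1 hi.2).mul (hy hj.1 hj.2)).eq ((hy hj.1 hj.2).mul (hy hi.1 hi.2))
      fun F _ => mul_left_comm _ _ _
  · exact ((dm k).mul (hy h1 (by omega))).eq ((hy h1 h2).mul (dm k))
      fun F _ => dMinusOp_yVar_mul qK (by omega) F
  · refine ((tau k).mul (hy h1 h2)).eq ((hy h1 (by omega)).mul (tau k)) fun F _ => ?_
    rw [map_mul, plethHom_yVar]
  · exact ((tau k).mul (hT' h1 h2)).eq ((hT' h1 (by omega)).mul (tau k))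
      fun F _ => plethHom_heckeT qK 1 (by omega) (by omega) F
  · exact ((hT' (by omega) (by omega)).mul ((tau (k + 1)).mul (tau k))).eq
      ((tau (k + 1)).mul (tau k)) fun F hF => heckeT_plethHom_plethHom qK (suppIn_of_mem_W hF)
  · exact ((dm k).mul (hT' h1 (by omega))).eq ((hT' h1 h2).mul (dm k))
      fun F _ => dMinusOp_heckeT qK (by omega) (by omega) F
  · exact (((dm n).mul (dm (n + 1))).mul (hT' (by omega) (by omega))).eq
      ((dm n).mul (dm (n + 1))) fun F _ => dMinusOp_dMinusOp_heckeT qK (n + 1) F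
  · refine (((tau n).mul (dm n)).sub
      ((dm (n + 1)).mul ((hT' (by omega) (by omega)).mul (tau (n + 1))))).eq
      ((hy (by omega) le_rfl).smul (q - 1)) fun F hF => ?_
    rw [map_sub, map_one]
    exact plethHom_dMinusOp qK (suppIn_of_mem_W hF)
  · exact ((star k).mul (hT' h1 h2)).eq ((hT' (by omega) (by omega)).mul (star k))
      fun F _ => (heckeT_starHom qK tK h1 F).symm
  · exact ((star k).mul (hy h1 h2)).eq ((hy (by omega) (by omega)).mul (star k))
      fun F _ => starHom_yVar_mul qK tK h1 F
  · exact ((hT' le_rfl (by omega)).mul ((star (k + 1)).mul (star k))).eq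
      ((star (k + 1)).mul (star k)) fun F _ => heckeT_starHom_starHom qK tK F
  · exact (((phi n).mul (dm (n + 1))).mul (hT' (by omega) (by omega))).eq
      (((dm (n + 1)).mul (phi (n + 1))).smul q)
      fun F hF => phiStar_dMinusOp_heckeT qK tK (suppIn_of_mem_W hF) (by omega)
  · exact ((hT' le_rfl (by omega)).mul ((star (n + 1)).mul (phi n))).eq
      (((phi (n + 1)).mul (star (n + 1))).smul q)
      fun F hF => heckeT_starHom_phiStar qK tK (suppIn_of_mem_W hF) (by omega)
  · exact ((phi (n + 1)).mul ((hT' (by omega) (by omega)).mul (tau (n + 1)))).eq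
      ((tau (n + 1)).mul (phi n))
      fun F hF => phiStar_heckeT_plethHom qK tK (suppIn_of_mem_W hF) (by omega)
  · refine ((phi k).mul (tau k)).eq (((hy le_rfl (by omega)).mul (star k)).smul (-(q * t)))
      fun F hF => ?_
    rw [phiStar_plethHom qK tK (suppIn_of_mem_W hF), map_neg, map_mul]
    exact shiftHom_eq_smul hQ hT F

end Representation

/-! ### Invariance of `V_•` and the final assembly -/

section Main

variable {K : Type*} [Field K]

lemma IsBlk.prodUp_mul (q : K) {k n m : ℕ} {f : Lau K → Lau K} {X : Module.End K (WBullet K)}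
    (h : IsBlk (W K) k n f X) (hm : m < n) :
    IsBlk (W K) k n (fun F => heckeProd q m (f F)) (prodUp (tB q n) m * X) := by
  induction m generalizing f X with
  | zero => rwa [prodUp_zero, one_mul]
  | succ m ih =>
    rw [prodUp_succ, mul_assoc]
    exact ih ((isBlk_T q (by omega) hm).mul h) (by omega)

lemma isBlk_dPlus (q : K) (k : ℕ) :
    IsBlk (W K) k (k + 1) (dPlusOp q k) (dpOf (tauB q) (tB q) k) :=
  ((isBlk_tau q k).prodUp_mul q k.lt_succ_self).congr fun F _ => by rw [dPlusOp, pleth_eq]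

section Stab

variable {K₀ : Type*} [Field K₀] [Algebra K₀ K]

lemma e_mem_stabRange (k : ℕ) : eB K k ∈ stabRange K₀ (inclVW K) :=
  (isBlk_e k).mem_stabRange fun _ hF => hF

lemma T_mem_stabRange (q : K) {k i : ℕ} (h1 : 1 ≤ i) (h2 : i < k) :
    tB q k i ∈ stabRange K₀ (inclVW K) :=
  (isBlk_T q h1 h2).mem_stabRange fun _ hF =>
    mem_V_iff.mpr (heckeT_mem_vSub q h1 h2 (mem_V_iff.mp hF))

lemma dPlus_mem_stabRange (q : K) (k : ℕ) :
    dpOf (tauB q) (tB q) k ∈ stabRange K₀ (inclVW K) :=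
  mul_mem (Subalgebra.list_prod_mem _ fun x hx => by
      obtain ⟨j, hj, rfl⟩ := List.mem_map.mp hx
      exact T_mem_stabRange q (by omega) (by have := List.mem_range.mp hj; omega))
    ((isBlk_tau q k).mem_stabRange fun _ hF =>
      mem_V_iff.mpr (plethHom_mem_vSub q (mem_V_iff.mp hF)))

variable [CharZero K] {q t : K₀}

local notation "qK" => algebraMap K₀ K q
local notation "tK" => algebraMap K₀ K t

lemma dMinus_mem_stabRange (q : K) (k : ℕ) : dmB q k ∈ stabRange K₀ (inclVW K) :=
  (isBlk_dm q k).mem_stabRange fun _ hF => dMinusOp_mem_V q hF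

/-- `z_1` is a multiple of `φ^*` times a word in the `T_i⁻¹`, and the other `z_i` arise by
conjugating with the `T_i`; so invariance rests on that of `φ^*`. -/
lemma z_mem_stabRange (hq : q ≠ 0) (hq1 : q ≠ 1) (ht : t ≠ 0)
    {z : ℕ → ℕ → Module.End K (WBullet K)}
    (hZ : IsYFamily q⁻¹ (starB qK tK) (dmB qK)
      (fun k i => heckeInv q (eB K k) (tB qK k i)) (tB qK) z) {k i : ℕ} (h1 : 1 ≤ i) (h2 : i ≤ k) :
    z k i ∈ stabRange K₀ (inclVW K) := by
  induction i, h1 using Nat.le_induction with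
  | base =>
    obtain ⟨n, rfl⟩ : ∃ n, k = n + 1 := ⟨k - 1, by omega⟩
    rw [hZ.one]
    refine Subalgebra.smul_mem _ (mul_mem ((isBlk_phi hq hq1 ht n).mem_stabRange fun _ hF =>
      phiStar_mem_V qK tK (by omega) hF) (Subalgebra.list_prod_mem _ fun x hx => ?_)) _
    obtain ⟨j, hj, rfl⟩ := List.mem_map.mp (List.mem_reverse.mp hx)
    exact Subalgebra.smul_mem _ (add_mem
      (T_mem_stabRange qK (by omega) (by have := List.mem_range.mp hj; omega))
      (Subalgebra.smul_mem _ (e_mem_stabRange _) _)) _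
  | succ i h1 ih =>
    rw [hZ.succ k i h1 h2]
    exact Subalgebra.smul_mem _ (mul_mem (mul_mem (T_mem_stabRange qK h1 h2) (ih (by omega)))
      (T_mem_stabRange qK h1 h2)) _

/-- The representation of `𝔸_{q,t}` on `W_•`, in which the image of `𝔹_{q,t}` preserves `V_•`. -/
theorem exists_representation_W (hq : q ≠ 0) (hq1 : q ≠ 1) (ht : t ≠ 0) :
    ∃ ρ : AAlg K₀ q t →ₐ[K₀] Module.End K (WBullet K),
      ActsBy q t (W K) (dPlusStarOp qK tK) ρ ∧
      ∀ α : BAlg K₀ q t →ₐ[K₀] AAlg K₀ q t, IsAlpha α →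
        ∀ b, ρ (α b) ∈ stabRange K₀ (inclVW K) := by
  obtain ⟨z, hZ⟩ := exists_isYFamily q⁻¹ (starB qK tK) (dmB qK)
    (fun k i => heckeInv q (eB K k) (tB qK k i)) (tB qK)
  have S := opSystem_W (K := K) hq hq1 ht
  have hT : tK ≠ 0 := by simpa using ht
  obtain ⟨ρ, h_idem, h_dPlus, h_dPlusStar, h_dMinus, h_T, h_y, h_z⟩ :=
    (S.aSystem hq hq1 hZ).exists_lift hq
      (fun j k h => (isBlk_e j).mul_of_ne (isBlk_e k) h.symm rfl) S.e_dps S.dps_e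
  refine ⟨ρ, ⟨fun k w => ?_, fun k i w h1 h2 => ?_, fun k i w h1 h2 => ?_, fun k w => ?_,
    fun k w => ?_, fun k w => ?_⟩, fun α hα => bAlg_algHom_mem K₀ q t (ρ.comp α) _ fun g hg => ?_⟩
  · rw [h_idem, (isBlk_e k).2]
  · rw [h_T k i h1 h2, (isBlk_T qK h1 h2).apply_coe]
  · rw [h_y k i h1 h2, (isBlk_y h1 h2).apply_coe]
  · rw [h_dPlus, (isBlk_dPlus qK k).apply_coe]
  · rw [h_dMinus, (isBlk_dm qK k).apply_coe]
  · rw [h_dPlusStar, (isBlk_star qK tK k).apply_coe, dPlusStarOp_eq hT (suppIn_of_mem_W (w k).2)]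
  · rw [AlgHom.comp_apply]
    cases g with
    | idem k => rw [hα.idem, h_idem]; exact e_mem_stabRange k
    | dPlus k => rw [hα.dPlus, h_dPlus]; exact dPlus_mem_stabRange qK k
    | dMinus k => rw [hα.dMinus, h_dMinus]; exact dMinus_mem_stabRange qK k
    | T k i =>
      rw [hα.T k i hg.1 hg.2, h_T k i hg.1 hg.2]
      exact T_mem_stabRange qK hg.1 hg.2
    | z k i =>
      rw [hα.z k i hg.1 hg.2, h_z k i hg.1 hg.2]
      exact z_mem_stabRange hq hq1 ht hZ hg.1 hg.2

/-- A representation on `V_•` that agrees with that of `αβ(𝔸_{q,t})` on `W_•` is the one by the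
operators of Carlsson and Mellit. -/
theorem ActsBy.restrict (hq : q ≠ 0) (hq1 : q ≠ 1) (ht : t ≠ 0)
    {α : BAlg K₀ q t →ₐ[K₀] AAlg K₀ q t} {β : AAlg K₀ q t →ₐ[K₀] BAlg K₀ q t}
    (hα : IsAlpha α) (hβ : IsBeta β) {ρ : AAlg K₀ q t →ₐ[K₀] Module.End K (WBullet K)}
    (hρ : ActsBy q t (W K) (dPlusStarOp qK tK) ρ)
    {σ : AAlg K₀ q t →ₐ[K₀] Module.End K (VBullet K)}
    (h : ∀ a v, ρ (α (β a)) (inclVW K v) = inclVW K (σ a v)) :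
    ActsBy q t (V K) (dPlusStarCM qK tK) σ := by
  have hQ : qK ≠ 0 := by simpa using hq
  have hT : tK ≠ 0 := by simpa using ht
  have key : ∀ a v k, (σ a v k : Lau K) = ρ (α (β a)) (inclVW K v) k := fun a v k => by
    rw [h, inclVW_apply]
  refine ⟨fun k v => inclVW_injective ?_, fun k i v h1 h2 => ?_, fun k i v h1 h2 => ?_,
    fun k v => ?_, fun k v => ?_, fun k v => ?_⟩
  · rw [← h, hβ.idem, hα.idem, hρ.idem, inclVW_of]
    exact congrArg _ (Subtype.ext (inclVW_apply v k))
  · rw [key, hβ.T k i h1 h2, hα.T k i h1 h2, hρ.T k i _ h1 h2, inclVW_apply]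
  · rw [key, alpha_beta_y hq hα hβ h1 h2 hq1, hρ.y k i _ h1 h2, inclVW_apply]
  · rw [key, hβ.dPlus, hα.dPlus, hρ.dPlus, inclVW_apply]
  · rw [key, hβ.dMinus, hα.dMinus, hρ.dMinus, inclVW_apply]
  · have hv := suppIn_of_mem_V (v k).2
    -- Under `αβ` the generator `d_+^*` becomes `-qt y_1 d_+^*`, which cancels the normalising
    -- factor of the operator on `W_•`.
    rw [key, alpha_beta_dPlusStar hq hα hβ, map_smul, map_mul, ← algebraMap_smul K]
    change algebraMap K₀ K (-(q * t))
      • (ρ (aGen K₀ q t (.y (k + 1) 1)) (ρ (aGen K₀ q t (.dPlusStar k)) (inclVW K v)) (k + 1) : Lau K)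
      = _
    rw [hρ.y (k + 1) 1 _ le_rfl (by omega), hρ.dPlusStar, inclVW_apply, dPlusStarOp_eq hT hv,
      dPlusStarCM_eq hT hv, shiftHom_eq_smul hQ hT, map_neg, map_mul]

/-- The homomorphisms `α`, `β` and the representations of the two algebras, over any fields and for
any parameters `q ≠ 0, 1` and `t ≠ 0`. -/
theorem exists_representations (hq : q ≠ 0) (hq1 : q ≠ 1) (ht : t ≠ 0) :
    ∃ (α : BAlg K₀ q t →ₐ[K₀] AAlg K₀ q t) (β : AAlg K₀ q t →ₐ[K₀] BAlg K₀ q t),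
      IsAlpha α ∧ IsBeta β ∧
      ∃ ρ : AAlg K₀ q t →ₐ[K₀] Module.End K (WBullet K),
        ActsBy q t (W K) (dPlusStarOp qK tK) ρ ∧
        (∃ τ : BAlg K₀ q t →ₐ[K₀] Module.End K (VBullet K),
          ∀ b v, ρ (α b) (inclVW K v) = inclVW K (τ b v)) ∧
        (∃ σ : AAlg K₀ q t →ₐ[K₀] Module.End K (VBullet K),
          (∀ a v, ρ (α (β a)) (inclVW K v) = inclVW K (σ a v)) ∧
          ActsBy q t (V K) (dPlusStarCM qK tK) σ) := by
  obtain ⟨α, hα⟩ := exists_alpha (t := t) hq hq1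
  obtain ⟨β, hβ⟩ := exists_beta (t := t) hq hq1
  obtain ⟨ρ, hρ, hstab⟩ := exists_representation_W (K := K) hq hq1 ht
  obtain ⟨τ, hτ⟩ := exists_restrict (ρ.comp α) inclVW_injective (hstab α hα)
  -- The action in part 3 is that of part 2 pulled back along `β`, so no further invariance has to
  -- be proved.
  have hσ : ∀ a v, ρ (α (β a)) (inclVW K v) = inclVW K (τ.comp β a v) := fun a v => hτ (β a) v
  exact ⟨α, β, hα, hβ, ρ, hρ, ⟨τ, hτ⟩, τ.comp β, hσ, hρ.restrict hq hq1 ht hα hβ hσ⟩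

end Stab

lemma qPar_ne_zero : qPar ≠ 0 := by
  rw [qPar, Ne, FaithfulSMul.algebraMap_eq_zero_iff]
  exact MvPolynomial.X_ne_zero 0

lemma tPar_ne_zero : tPar ≠ 0 := by
  rw [tPar, Ne, FaithfulSMul.algebraMap_eq_zero_iff]
  exact MvPolynomial.X_ne_zero 1

lemma qPar_ne_one : qPar ≠ 1 := by
  rw [qPar, ← map_one (algebraMap (MvPolynomial (Fin 2) ℚ) Qqt)]
  intro h
  have := congrArg (MvPolynomial.eval 0) (IsFractionRing.injective (MvPolynomial (Fin 2) ℚ) Qqt h)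
  simp at this

end Main

end DyckPath

end

theorem mainTheorem4 :
    ∃ (α : BAlg Qqt qPar tPar →ₐ[Qqt] AAlg Qqt qPar tPar)
      (β : AAlg Qqt qPar tPar →ₐ[Qqt] BAlg Qqt qPar tPar),
      IsAlpha α ∧ IsBeta β ∧
      ∃ ρ : AAlg Qqt qPar tPar →ₐ[Qqt] Module.End Cqt (WBullet Cqt),
        ActsBy qPar tPar (W Cqt)
          (dPlusStarOp (algebraMap Qqt Cqt qPar) (algebraMap Qqt Cqt tPar)) ρ ∧
        (∃ τ : BAlg Qqt qPar tPar →ₐ[Qqt] Module.End Cqt (VBullet Cqt),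
          ∀ b v, ρ (α b) (inclVW Cqt v) = inclVW Cqt (τ b v)) ∧
        (∃ σ : AAlg Qqt qPar tPar →ₐ[Qqt] Module.End Cqt (VBullet Cqt),
          (∀ a v, ρ (α (β a)) (inclVW Cqt v) = inclVW Cqt (σ a v)) ∧
          ActsBy qPar tPar (V Cqt)
            (dPlusStarCM (algebraMap Qqt Cqt qPar) (algebraMap Qqt Cqt tPar)) σ) := by
  exact exists_representations qPar_ne_zero qPar_ne_one tPar_ne_zero
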